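/- **Setting.** Let $(\varepsilon_t)_{t\in\mathbb Z}$ be i.i.d. real random variables with $\mathbb E\varepsilon_t=0$, $\operatorname{var}\varepsilon_t=1$, $\mathbb E|\varepsilon_t|^{16}<\infty$ and fourth cumulant $\kappa_4=\mathbb E\varepsilon_t^4-3$. For $1\le t\le T$ let $$X_{t,T}=\sum_{j\ge 0}\psi_{t,T}(j)\,\varepsilon_{t-j}\quad\text{a.s.},$$ and suppose there are functions $\psi_j:[0,1]\to\mathbb R$, positive numbers $\ell(j)$ with $\ell(j)^{-1}$ nonincreasing and $\sum_j j^2\ell(j)^{-1}<\infty$, and a constant $L$ with $$|\psi_j(t/T)-\psi_{t,T}(j)|\le T^{-1}\ell(j)^{-1},\qquad \sup_u|\psi_j(u)|\le\ell(j)^{-1},\qquad |\psi_j(u)-\psi_j(v)|\le L\,\ell(j)^{-1}|u-v| .$$ Put $A(u,\omega)=(2\pi)^{-1/2}\sum_{j\ge0}\psi_j(u)e^{ij\omega}$, $f(u,\omega)=|A(u,\omega)|^2$ and $f(\omega)=\int_0^1f(u,\omega)\,du$, and suppose $\inf_\omega f(\omega)>0$. Suppose moreover that either (a) the $\psi_j$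 are twice differentiable on $[0,1]$ with $\sup_u\sum_j|\psi_j''(u)|<\infty$, or (b) for every $\omega$ the real and imaginary parts of $u\mapsto A(u,\omega)$ and of $u\mapsto\partial_uA(u,\omega)$ are piecewise monotone (the derivative existing off finitely many points). Let $\omega_k=2\pi k/T$ for $k\in\mathbb Z$, $$J_T(\omega)=\frac1{\sqrt{2\pi T}}\sum_{t=1}^TX_{t,T}e^{it\omega},\qquad \hat f_T(\omega)=\frac{2\pi}{bT}\sum_{j\in\mathbb Z}K\Big(\frac{\omega-\omega_j}{b}\Big)|J_T(\omega_j)|^2,$$ $$\tilde c_T(r)=\frac1T\sum_{k=1}^T\frac{J_T(\omega_k)\overline{J_T(\omega_{k+r})}}{\sqrt{f(\omega_k)f(\omega_{k+r})}}\qquad(r\in\mathbb Z),$$ where $K\ge0$ is symmetric, vanishes outside $[-\frac12,\frac12]$, is continuous and of bounded variation on $[-\frac12,\frac12]$, and satisfies $\int K=1$, and where $b=b_T\to0$ and $bT\to\infty$ as $T\to\infty$. Define $$f_2(u,\omega)=A(u,\omega)A(u,-\omega),\qquad f_4(u,\lambda_1,\lambda_2,\lambda_3)=\frac{\kappa_4}{2\pi}A(u,\lambda_1)A(u,\lambda_2)A(u,\lambda_3)A(u,-\lambda_1-\lambda_2-\lambda_3),$$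 $$F_n(s;\cdot)=\frac1T\sum_{t=1}^Tf_n(t/T,\cdot)\,e^{2\pi ist/T}\quad(n=2,4),\qquad g^{(r)}_k=\{f(\omega_k)f(\omega_{k+r})\}^{-1/2},$$ and, with all sums over $1\le k_1,k_2\le T$, $$\begin{aligned}\Gamma^{(1)}_{r_1,r_2}={}&\tfrac1T\sum_{k_1,k_2}g^{(r_1)}_{k_1}g^{(r_2)}_{k_2}\big\{F_2(k_1-k_2;\omega_{k_1})F_2(-k_1-r_1+k_2+r_2;-\omega_{k_1+r_1})\\&\quad+F_2(k_1+k_2+r_2;\omega_{k_1})F_2(-k_1-r_1-k_2;-\omega_{k_1+r_1})\big\}\\&+\tfrac{2\pi}{T^2}\sum_{k_1,k_2}g^{(r_1)}_{k_1}g^{(r_2)}_{k_2}F_4(r_2-r_1;\omega_{k_1},-\omega_{k_1+r_1},-\omega_{k_2}),\\ \Gamma^{(2)}_{r_1,r_2}={}&\tfrac1T\sum_{k_1,k_2}g^{(r_1)}_{k_1}g^{(r_2)}_{k_2}\big\{F_2(k_1+k_2;\omega_{k_1})F_2(-k_1-r_1-k_2-r_2;-\omega_{k_1+r_1})\\&\quad+F_2(k_1-k_2-r_2;\omega_{k_1})F_2(-k_1-r_1+k_2;-\omega_{k_1+r_1})\big\}\\&+\tfrac{2\pi}{T^2}\sum_{k_1,k_2}g^{(r_1)}_{k_1}g^{(r_2)}_{k_2}F_4(-r_2-r_1;\omega_{k_1},-\omega_{k_1+r_1},-\omega_{k_2}),\\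 \Gamma^{(3)}_{r_1,r_2}={}&\tfrac1T\sum_{k_1,k_2}g^{(r_1)}_{k_1}g^{(r_2)}_{k_2}\big\{F_2(-k_1+k_2;-\omega_{k_1})F_2(k_1+r_1-k_2-r_2;\omega_{k_1+r_1})\\&\quad+F_2(-k_1-k_2-r_2;-\omega_{k_1})F_2(k_1+r_1+k_2;\omega_{k_1+r_1})\big\}\\&+\tfrac{2\pi}{T^2}\sum_{k_1,k_2}g^{(r_1)}_{k_1}g^{(r_2)}_{k_2}F_4(r_1-r_2;-\omega_{k_1},\omega_{k_1+r_1},-\omega_{k_2}).\end{aligned}$$ **Lemma.** As $T\to\infty$: 1. uniformly in $\omega$, $\ \mathbb E\big(\hat f_T(\omega)-f(\omega)\big)^2=O\big(b^2+\frac1{bT}\big)$ (and $\hat f_T(\omega)$ is square integrable for all large $T$); 2. each $\tilde c_T(r)$ is square integrable, and for every fixed $r\in\mathbb Z$ $$\mathbb E\,\tilde c_T(r)-\frac1{2\pi}\int_0^{2\pi}\frac1{\sqrt{f(\omega)f(\omega+\omega_r)}}\int_0^1f(u,\omega)e^{-2\pi iru}\,du\,d\omega\longrightarrow0;$$ 3.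 for all fixed $r_1,r_2\in\mathbb Z$, $$\begin{aligned}\operatorname{cov}\big(\sqrt T\,\Re\tilde c_T(r_1),\sqrt T\,\Re\tilde c_T(r_2)\big)&=\tfrac14\big(\Gamma^{(1)}_{r_1,r_2}+\Gamma^{(2)}_{r_1,r_2}+\overline{\Gamma^{(2)}_{r_2,r_1}}+\Gamma^{(3)}_{r_1,r_2}\big)+O\big(\tfrac{\log T}T\big),\\ \operatorname{cov}\big(\sqrt T\,\Re\tilde c_T(r_1),\sqrt T\,\Im\tilde c_T(r_2)\big)&=\tfrac i4\big(\Gamma^{(1)}_{r_1,r_2}-\Gamma^{(2)}_{r_1,r_2}+\overline{\Gamma^{(2)}_{r_2,r_1}}-\Gamma^{(3)}_{r_1,r_2}\big)+O\big(\tfrac{\log T}T\big),\\ \operatorname{cov}\big(\sqrt T\,\Im\tilde c_T(r_1),\sqrt T\,\Im\tilde c_T(r_2)\big)&=\tfrac14\big(\Gamma^{(1)}_{r_1,r_2}-\Gamma^{(2)}_{r_1,r_2}-\overline{\Gamma^{(2)}_{r_2,r_1}}+\Gamma^{(3)}_{r_1,r_2}\big)+O\big(\tfrac{\log T}T\big).\end{aligned}$$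 -/

import Mathlib

open MeasureTheory ProbabilityTheory Filter Topology Set Asymptotics

noncomputable section

namespace LocStat

/-- The canonical frequency `ω_k = 2πk/T`. -/
def freq (T : ℕ) (k : ℤ) : ℝ := 2 * Real.pi * (k : ℝ) / (T : ℝ)

/-- `A(u,ω) = (2π)^{-1/2} ∑_{j ≥ 0} ψ_j(u) e^{ijω}`. -/
def transfer (ψ : ℕ → ℝ → ℝ) (u ω : ℝ) : ℂ :=
  ((Real.sqrt (2 * Real.pi))⁻¹ : ℝ) *
    ∑' j : ℕ, (ψ j u : ℂ) * Complex.exp (Complex.I * (j : ℂ) * (ω : ℂ))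

/-- The local spectral density `f(u,ω) = (2π)^{-1} |∑_{j ≥ 0} ψ_j(u) e^{ijω}|²`. -/
def localSpec (ψ : ℕ → ℝ → ℝ) (u ω : ℝ) : ℝ :=
  (2 * Real.pi)⁻¹ *
    ‖∑' j : ℕ, (ψ j u : ℂ) * Complex.exp (Complex.I * (j : ℂ) * (ω : ℂ))‖ ^ 2

/-- The integrated spectral density `f(ω) = ∫₀¹ f(u,ω) du`. -/
def intSpec (ψ : ℕ → ℝ → ℝ) (ω : ℝ) : ℝ := ∫ u in (0 : ℝ)..1, localSpec ψ u ω

/-- `h` is piecewise monotone on `(0,1)`: off finitely many points, it is monotone or antitone on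
every subinterval. -/
def PiecewiseMonotone (h : ℝ → ℝ) : Prop :=
  ∃ s : Finset ℝ, ∀ a b : ℝ, 0 ≤ a → a < b → b ≤ 1 → Disjoint (s : Set ℝ) (Ioo a b) →
    MonotoneOn h (Ioo a b) ∨ AntitoneOn h (Ioo a b)

/-- Independent, identically distributed innovations with mean `0`, variance `1` and a finite
absolute moment of order `16`. -/
structure IIDInnovations {Ω : Type*} [MeasurableSpace Ω] (μ : Measure Ω) (ε : ℤ → Ω → ℝ) :
    Prop where
  measurable : ∀ t, Measurable (ε t)
  indep : iIndepFun ε μ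
  identDistrib : ∀ t, IdentDistrib (ε t) (ε 0) μ μ
  mean_zero : ∫ w, ε 0 w ∂μ = 0
  var_one : ∫ w, ε 0 w ^ 2 ∂μ = 1
  moment : MemLp (ε 0) 16 μ

/-- The locally stationary linear time series. `X T t` is `X_{t,T}` for `1 ≤ t ≤ T`, `ψT T t j` is
`ψ_{t,T}(j)`, and `ψ j` is the function `ψ_j` on `[0,1]`. -/
structure LocallyStationary {Ω : Type*} [MeasurableSpace Ω] (μ : Measure Ω)
    (ε : ℤ → Ω → ℝ) (X : ℕ → ℕ → Ω → ℝ) (ψT : ℕ → ℕ → ℕ → ℝ) (ψ : ℕ → ℝ → ℝ) (ℓ : ℕ → ℝ) :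
    Prop where
  innovations : IIDInnovations μ ε
  linear : ∀ T t : ℕ, 1 ≤ t → t ≤ T → ∀ᵐ w ∂μ,
    HasSum (fun j : ℕ => ψT T t j * ε ((t : ℤ) - (j : ℤ)) w) (X T t w)
  ell_pos : ∀ j, 0 < ℓ j
  ell_anti : Antitone fun j => (ℓ j)⁻¹
  ell_summable : Summable fun j : ℕ => (j : ℝ) ^ 2 * (ℓ j)⁻¹
  approx : ∀ T t j : ℕ, 1 ≤ t → t ≤ T →
    |ψ j ((t : ℝ) / (T : ℝ)) - ψT T t j| ≤ (T : ℝ)⁻¹ * (ℓ j)⁻¹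
  bound : ∀ j, ∀ u ∈ Icc (0 : ℝ) 1, |ψ j u| ≤ (ℓ j)⁻¹
  lipschitz : ∃ L : ℝ, ∀ j, ∀ u ∈ Icc (0 : ℝ) 1, ∀ v ∈ Icc (0 : ℝ) 1,
    |ψ j u - ψ j v| ≤ L * (ℓ j)⁻¹ * |u - v|
  spec_pos : ∃ c : ℝ, 0 < c ∧ ∀ ω, c ≤ intSpec ψ ω
  smooth :
    (∃ ψ' ψ'' : ℕ → ℝ → ℝ,
      (∀ j, ∀ u ∈ Icc (0 : ℝ) 1, HasDerivWithinAt (ψ j) (ψ' j u) (Icc 0 1) u) ∧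
      (∀ j, ∀ u ∈ Icc (0 : ℝ) 1, HasDerivWithinAt (ψ' j) (ψ'' j u) (Icc 0 1) u) ∧
      ∃ C : ℝ, ∀ u ∈ Icc (0 : ℝ) 1,
        Summable (fun j => |ψ'' j u|) ∧ ∑' j, |ψ'' j u| ≤ C) ∨
    (∀ ω : ℝ,
      (∃ s : Finset ℝ, ∀ u ∈ Ioo (0 : ℝ) 1, u ∉ s →
        DifferentiableAt ℝ (fun v => transfer ψ v ω) u) ∧
      PiecewiseMonotone (fun u => (transfer ψ u ω).re) ∧
      PiecewiseMonotone (fun u => (transfer ψ u ω).im) ∧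
      PiecewiseMonotone (fun u => (deriv (fun v => transfer ψ v ω) u).re) ∧
      PiecewiseMonotone (fun u => (deriv (fun v => transfer ψ v ω) u).im))

/-- A kernel `K : [-1/2,1/2] → ℝ` (extended by `0`): nonnegative, continuous, symmetric, of bounded
variation, with integral `1`. -/
structure IsKernel (K : ℝ → ℝ) : Prop where
  nonneg : ∀ x, 0 ≤ K x
  support : ∀ x, x ∉ Icc (-(1 / 2) : ℝ) (1 / 2) → K x = 0
  continuousOn : ContinuousOn K (Icc (-(1 / 2) : ℝ) (1 / 2))
  symm : ∀ x, K (-x) = K x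
  integral_one : ∫ x in (-1 : ℝ)..1, K x = 1
  boundedVariation : BoundedVariationOn K (Icc (-(1 / 2) : ℝ) (1 / 2))

section Statistics

variable {Ω : Type*}

/-- The discrete Fourier transform `J_T(ω) = (2πT)^{-1/2} ∑_{t=1}^T X_{t,T} e^{itω}`. -/
def dft (X : ℕ → ℕ → Ω → ℝ) (T : ℕ) (ω : ℝ) (w : Ω) : ℂ :=
  ((Real.sqrt (2 * Real.pi * (T : ℝ)))⁻¹ : ℝ) *
    ∑ t ∈ Finset.Icc 1 T, (X T t w : ℂ) * Complex.exp (Complex.I * (t : ℂ) * (ω : ℂ))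

/-- The kernel spectral density estimator
`f̂_T(ω) = ∑_{j ∈ ℤ} (2π/(bT)) K((ω - ω_j)/b) |J_T(ω_j)|²`. For `b, T > 0` only finitely many terms
are nonzero; the factor `2π/T` is the spacing of the frequencies. -/
def specEst (X : ℕ → ℕ → Ω → ℝ) (K : ℝ → ℝ) (b : ℝ) (T : ℕ) (ω : ℝ) (w : Ω) : ℝ :=
  ∑' j : ℤ, 2 * Real.pi / (b * (T : ℝ)) * K ((ω - freq T j) / b) * ‖dft X T (freq T j) w‖ ^ 2

/-- `c̃_T(r) = T^{-1} ∑_{k=1}^T J_T(ω_k) conj(J_T(ω_{k+r})) / √(f(ω_k) f(ω_{k+r}))`. -/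
def covTilde (X : ℕ → ℕ → Ω → ℝ) (ψ : ℕ → ℝ → ℝ) (T : ℕ) (r : ℤ) (w : Ω) : ℂ :=
  (T : ℂ)⁻¹ * ∑ k ∈ Finset.Icc (1 : ℤ) (T : ℤ),
    dft X T (freq T k) w * (starRingEnd ℂ) (dft X T (freq T (k + r)) w) /
      (Real.sqrt (intSpec ψ (freq T k) * intSpec ψ (freq T (k + r))) : ℂ)

/-- `√T Re c̃_T(r)`. -/
def scaledRe (X : ℕ → ℕ → Ω → ℝ) (ψ : ℕ → ℝ → ℝ) (T : ℕ) (r : ℤ) (w : Ω) : ℝ :=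
  Real.sqrt (T : ℝ) * (covTilde X ψ T r w).re

/-- `√T Im c̃_T(r)`. -/
def scaledIm (X : ℕ → ℕ → Ω → ℝ) (ψ : ℕ → ℝ → ℝ) (T : ℕ) (r : ℤ) (w : Ω) : ℝ :=
  Real.sqrt (T : ℝ) * (covTilde X ψ T r w).im

/-- The fourth cumulant of a mean-zero random variable. -/
def fourthCumulant [MeasurableSpace Ω] (μ : Measure Ω) (Y : Ω → ℝ) : ℝ :=
  (∫ w, Y w ^ 4 ∂μ) - 3 * (∫ w, Y w ^ 2 ∂μ) ^ 2

end Statistics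

/-- `B_T(r) = (2π)^{-1} ∫₀^{2π} (f(ω) f(ω+ω_r))^{-1/2} (∫₀¹ f(u,ω) e^{-2πiru} du) dω`. -/
def meanLimit (ψ : ℕ → ℝ → ℝ) (T : ℕ) (r : ℤ) : ℂ :=
  (2 * (Real.pi : ℂ))⁻¹ * ∫ ω in (0 : ℝ)..(2 * Real.pi),
    ((Real.sqrt (intSpec ψ ω * intSpec ψ (ω + freq T r)))⁻¹ : ℂ) *
      ∫ u in (0 : ℝ)..1,
        (localSpec ψ u ω : ℂ) * Complex.exp (-2 * Complex.I * Real.pi * (r : ℂ) * (u : ℂ))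

/-- The second order cumulant spectrum `f₂(u,ω) = A(u,ω) A(u,-ω)`. -/
def spec2 (ψ : ℕ → ℝ → ℝ) (u ω : ℝ) : ℂ := transfer ψ u ω * transfer ψ u (-ω)

/-- The fourth order cumulant spectrum
`f₄(u,ω₁,ω₂,ω₃) = (κ₄/2π) A(u,ω₁) A(u,ω₂) A(u,ω₃) A(u,-ω₁-ω₂-ω₃)`. -/
def spec4 (κ₄ : ℝ) (ψ : ℕ → ℝ → ℝ) (u ω₁ ω₂ ω₃ : ℝ) : ℂ :=
  ((κ₄ / (2 * Real.pi) : ℝ) : ℂ) *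
    (transfer ψ u ω₁ * transfer ψ u ω₂ * transfer ψ u ω₃ * transfer ψ u (-(ω₁ + ω₂ + ω₃)))

/-- `F₂(s;ω) = T^{-1} ∑_{t=1}^T f₂(t/T,ω) e^{2πist/T}`. -/
def F2 (ψ : ℕ → ℝ → ℝ) (T : ℕ) (s : ℤ) (ω : ℝ) : ℂ :=
  (T : ℂ)⁻¹ * ∑ t ∈ Finset.Icc 1 T, spec2 ψ ((t : ℝ) / (T : ℝ)) ω *
    Complex.exp (Complex.I * (t : ℂ) * (freq T s : ℂ))

/-- `F₄(s;ω₁,ω₂,ω₃) = T^{-1} ∑_{t=1}^T f₄(t/T,ω₁,ω₂,ω₃) e^{2πist/T}`. -/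
def F4 (κ₄ : ℝ) (ψ : ℕ → ℝ → ℝ) (T : ℕ) (s : ℤ) (ω₁ ω₂ ω₃ : ℝ) : ℂ :=
  (T : ℂ)⁻¹ * ∑ t ∈ Finset.Icc 1 T, spec4 κ₄ ψ ((t : ℝ) / (T : ℝ)) ω₁ ω₂ ω₃ *
    Complex.exp (Complex.I * (t : ℂ) * (freq T s : ℂ))

/-- `g_{T,k}^{(r)} = (f(ω_k) f(ω_{k+r}))^{-1/2}`. -/
def gWeight (ψ : ℕ → ℝ → ℝ) (T : ℕ) (r k : ℤ) : ℝ :=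
  (Real.sqrt (intSpec ψ (freq T k) * intSpec ψ (freq T (k + r))))⁻¹

/-- `Γ^{(1)}_{T,r₁,r₂}`, the main term of `cov(√T c̃_T(r₁), √T c̃_T(r₂))`. -/
def Gamma1 (κ₄ : ℝ) (ψ : ℕ → ℝ → ℝ) (T : ℕ) (r₁ r₂ : ℤ) : ℂ :=
  (T : ℂ)⁻¹ * ∑ k₁ ∈ Finset.Icc (1 : ℤ) (T : ℤ), ∑ k₂ ∈ Finset.Icc (1 : ℤ) (T : ℤ),
    (gWeight ψ T r₁ k₁ : ℂ) * (gWeight ψ T r₂ k₂ : ℂ) *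
      (F2 ψ T (k₁ - k₂) (freq T k₁) * F2 ψ T (-k₁ - r₁ + k₂ + r₂) (-freq T (k₁ + r₁)) +
       F2 ψ T (k₁ + k₂ + r₂) (freq T k₁) * F2 ψ T (-k₁ - r₁ - k₂) (-freq T (k₁ + r₁))) +
  2 * (Real.pi : ℂ) / (T : ℂ) ^ 2 *
    ∑ k₁ ∈ Finset.Icc (1 : ℤ) (T : ℤ), ∑ k₂ ∈ Finset.Icc (1 : ℤ) (T : ℤ),
      (gWeight ψ T r₁ k₁ : ℂ) * (gWeight ψ T r₂ k₂ : ℂ) *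
        F4 κ₄ ψ T (r₂ - r₁) (freq T k₁) (-freq T (k₁ + r₁)) (-freq T k₂)

/-- `Γ^{(2)}_{T,r₁,r₂}`, the main term of `cov(√T c̃_T(r₁), √T conj c̃_T(r₂))`. -/
def Gamma2 (κ₄ : ℝ) (ψ : ℕ → ℝ → ℝ) (T : ℕ) (r₁ r₂ : ℤ) : ℂ :=
  (T : ℂ)⁻¹ * ∑ k₁ ∈ Finset.Icc (1 : ℤ) (T : ℤ), ∑ k₂ ∈ Finset.Icc (1 : ℤ) (T : ℤ),
    (gWeight ψ T r₁ k₁ : ℂ) * (gWeight ψ T r₂ k₂ : ℂ) *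
      (F2 ψ T (k₁ + k₂) (freq T k₁) * F2 ψ T (-k₁ - r₁ - k₂ - r₂) (-freq T (k₁ + r₁)) +
       F2 ψ T (k₁ - k₂ - r₂) (freq T k₁) * F2 ψ T (-k₁ - r₁ + k₂) (-freq T (k₁ + r₁))) +
  2 * (Real.pi : ℂ) / (T : ℂ) ^ 2 *
    ∑ k₁ ∈ Finset.Icc (1 : ℤ) (T : ℤ), ∑ k₂ ∈ Finset.Icc (1 : ℤ) (T : ℤ),
      (gWeight ψ T r₁ k₁ : ℂ) * (gWeight ψ T r₂ k₂ : ℂ) *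
        F4 κ₄ ψ T (-r₂ - r₁) (freq T k₁) (-freq T (k₁ + r₁)) (-freq T k₂)

/-- `Γ^{(3)}_{T,r₁,r₂}`, the main term of `cov(√T conj c̃_T(r₁), √T conj c̃_T(r₂))`. -/
def Gamma3 (κ₄ : ℝ) (ψ : ℕ → ℝ → ℝ) (T : ℕ) (r₁ r₂ : ℤ) : ℂ :=
  (T : ℂ)⁻¹ * ∑ k₁ ∈ Finset.Icc (1 : ℤ) (T : ℤ), ∑ k₂ ∈ Finset.Icc (1 : ℤ) (T : ℤ),
    (gWeight ψ T r₁ k₁ : ℂ) * (gWeight ψ T r₂ k₂ : ℂ) *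
      (F2 ψ T (-k₁ + k₂) (-freq T k₁) * F2 ψ T (k₁ + r₁ - k₂ - r₂) (freq T (k₁ + r₁)) +
       F2 ψ T (-k₁ - k₂ - r₂) (-freq T k₁) * F2 ψ T (k₁ + r₁ + k₂) (freq T (k₁ + r₁))) +
  2 * (Real.pi : ℂ) / (T : ℂ) ^ 2 *
    ∑ k₁ ∈ Finset.Icc (1 : ℤ) (T : ℤ), ∑ k₂ ∈ Finset.Icc (1 : ℤ) (T : ℤ),
      (gWeight ψ T r₁ k₁ : ℂ) * (gWeight ψ T r₂ k₂ : ℂ) *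
        F4 κ₄ ψ T (r₁ - r₂) (-freq T k₁) (freq T (k₁ + r₁)) (-freq T k₂)

/-- Main term of the covariance of the real parts. -/
def Sigma11 (κ₄ : ℝ) (ψ : ℕ → ℝ → ℝ) (T : ℕ) (r₁ r₂ : ℤ) : ℂ :=
  1 / 4 * (Gamma1 κ₄ ψ T r₁ r₂ + Gamma2 κ₄ ψ T r₁ r₂ +
    (starRingEnd ℂ) (Gamma2 κ₄ ψ T r₂ r₁) + Gamma3 κ₄ ψ T r₁ r₂)

/-- Main term of the covariance of a real part (lag `r₁`) and an imaginary part (lag `r₂`). -/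
def Sigma12 (κ₄ : ℝ) (ψ : ℕ → ℝ → ℝ) (T : ℕ) (r₁ r₂ : ℤ) : ℂ :=
  Complex.I / 4 * (Gamma1 κ₄ ψ T r₁ r₂ - Gamma2 κ₄ ψ T r₁ r₂ +
    (starRingEnd ℂ) (Gamma2 κ₄ ψ T r₂ r₁) - Gamma3 κ₄ ψ T r₁ r₂)

/-- Main term of the covariance of the imaginary parts. -/
def Sigma22 (κ₄ : ℝ) (ψ : ℕ → ℝ → ℝ) (T : ℕ) (r₁ r₂ : ℤ) : ℂ :=
  1 / 4 * (Gamma1 κ₄ ψ T r₁ r₂ - Gamma2 κ₄ ψ T r₁ r₂ -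
    (starRingEnd ℂ) (Gamma2 κ₄ ψ T r₂ r₁) + Gamma3 κ₄ ψ T r₁ r₂)

end LocStat

end

/-! Every $J_T(\omega)$ is almost surely an absolutely dominated linear series in the i.i.d.
innovations, so second and fourth moments of DFTs are exact sums over the coefficients: the fourth
moment is the sum over the three pairings of second moments plus $\kappa_4$ times a diagonal sum
(`IsLinearForm.integral_four`, by dominated convergence from finite sums). Since $X_{t,T}$ is real,
conjugating $J_T$ at a canonical frequency changes the sign of the frequency, so all three
statistics are weighted sums of products of DFTs without conjugates.

Three estimates drive the asymptotics.

Replacing the coefficient of $\varepsilon_s$ in $\sum_t X_{t,T}e^{it\omega}$ by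
$e^{is\omega}\sum_j\psi_j(s/T)e^{ij\omega}$ costs $O(1)$ in $\ell^1$, uniformly in $T$ and $\omega$
(`exists_isClose`). After the normalisation $1/(2\pi T)$, $\mathbb E J_T(\omega_m)J_T(\omega_n)$ is,
up to $O(1/T)$, the discrete Fourier coefficient at $m+n$ of $u\mapsto A(u,\omega_m)A(u,\omega_n)$.

By Abel summation the discrete Fourier coefficient at $s$ of a function with sup bound and Lipschitz
constant $B$ is at most $3B/(T|e^{i\omega_s}-1|)$. This gives the majorant `decay`, whose sum over a
period is $O(\log T)$ and whose sum of squares is $O(1)$.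

Replacing $A(u,\omega_n)$ by $A(u,-\omega_m)$ changes the function, and its Lipschitz constant, by
$O(|e^{i\omega_{m+n}}-1|)$, exactly the denominator just lost. Hence $\mathbb E
J_T(\omega_m)J_T(\omega_n)=F_2(m+n;\omega_m)+O(1/T)$ for all $m,n$ (`exists_momTwo_sub_F2`).

For claim 1, the bias is $O(b+1/(bT))$ by Lipschitz continuity of $f$ and a Riemann sum for $K$; the
variance is $O(1/(bT))$, because periodogram covariances are $O(\text{decay}^2+1/T)$ and squares of
`decay` are summable. Claim 2 is a Riemann sum in $\omega$. For claim 3, expanding the fourth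
moments cancels the pairing belonging to the product of means. Replacing moments by $F_2$ in the
other two pairings costs $T^{-1}$ times `decay`, hence $O(\log T/T)$ after summation, and the
cumulant part costs only $O(1/T)$. Real and imaginary parts follow by bilinearity. -/

noncomputable section

namespace LocStat

/-! ### Second and fourth moments of linear forms in i.i.d. innovations -/

section Moments

variable {Ω : Type*} [MeasurableSpace Ω] {μ : Measure Ω} {ε : ℤ → Ω → ℝ}

lemma IIDInnovations.memLp [IsProbabilityMeasure μ] (h : IIDInnovations μ ε) (i : ℤ) :
    MemLp (ε i) 4 μ :=
  (((h.identDistrib i).memLp_iff).2 h.moment).mono_exponent (by norm_num)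

lemma memLp_mul_four [IsProbabilityMeasure μ] {f g : Ω → ℂ}
    (hf : MemLp f 4 μ) (hg : MemLp g 4 μ) : MemLp (fun w => f w * g w) 2 μ := by
  have : ENNReal.HolderTriple 4 4 2 := ⟨by
    rw [← two_mul, show (4 : ENNReal) = 2 * 2 by norm_num,
      ENNReal.mul_inv (by norm_num) (by norm_num), ← mul_assoc,
      ENNReal.mul_inv_cancel (by norm_num) (by norm_num), one_mul]⟩
  exact hg.mul hf

lemma memLp_mul_four_real [IsProbabilityMeasure μ] {f g : Ω → ℝ}
    (hf : MemLp f 4 μ) (hg : MemLp g 4 μ) : MemLp (fun w => f w * g w) 2 μ := by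
  have : ENNReal.HolderTriple 4 4 2 := ⟨by
    rw [← two_mul, show (4 : ENNReal) = 2 * 2 by norm_num,
      ENNReal.mul_inv (by norm_num) (by norm_num), ← mul_assoc,
      ENNReal.mul_inv_cancel (by norm_num) (by norm_num), one_mul]⟩
  exact hg.mul hf

lemma IIDInnovations.integrable_four [IsProbabilityMeasure μ] (h : IIDInnovations μ ε)
    (i j k l : ℤ) : Integrable (fun w => ε i w * ε j w * (ε k w * ε l w)) μ :=
  (memLp_mul_four_real (h.memLp i) (h.memLp j)).integrable_mul
    (memLp_mul_four_real (h.memLp k) (h.memLp l))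

lemma IIDInnovations.integrable_two [IsProbabilityMeasure μ] (h : IIDInnovations μ ε)
    (i j : ℤ) : Integrable (fun w => ε i w * ε j w) μ :=
  (memLp_mul_four_real (h.memLp i) (h.memLp j)).integrable (by norm_num)

lemma IIDInnovations.integral_comp (h : IIDInnovations μ ε) {g : ℝ → ℝ} (hg : Measurable g)
    (i : ℤ) : ∫ w, g (ε i w) ∂μ = ∫ w, g (ε 0 w) ∂μ :=
  ((h.identDistrib i).comp hg).integral_eq

lemma IIDInnovations.integral_mul [IsProbabilityMeasure μ] (h : IIDInnovations μ ε) (i j : ℤ) :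
    ∫ w, ε i w * ε j w ∂μ = if i = j then 1 else 0 := by
  split_ifs with hij
  · subst hij
    simp_rw [← pow_two]
    rw [h.integral_comp (g := fun x => x ^ 2) (by fun_prop), h.var_one]
  · rw [(h.indep.indepFun hij).integral_fun_mul_eq_mul_integral
      (h.measurable i).aestronglyMeasurable (h.measurable j).aestronglyMeasurable,
      h.integral_comp (g := fun x => x) measurable_id, h.mean_zero, zero_mul]

/-- The isolated variable is independent of the product of the other three, whatever coincidences
occur among those, and it has mean zero. -/
lemma IIDInnovations.integral_four_of_ne [IsProbabilityMeasure μ] (h : IIDInnovations μ ε)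
    {i j k l : ℤ} (hj : i ≠ j) (hk : i ≠ k) (hl : i ≠ l) :
    ∫ w, ε i w * (ε j w * ε k w * ε l w) ∂μ = 0 := by
  have hd : Disjoint ({i} : Finset ℤ) {j, k, l} := by simp [hj, hk, hl]
  have h1 := h.indep.indepFun_finset _ _ hd h.measurable
  have m1 : Measurable fun v : ({i} : Finset ℤ) → ℝ => v ⟨i, by simp⟩ := by fun_prop
  have m2 : Measurable fun v : ({j, k, l} : Finset ℤ) → ℝ =>
      v ⟨j, by simp⟩ * v ⟨k, by simp⟩ * v ⟨l, by simp⟩ := by fun_prop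
  have h2 := h1.comp m1 m2
  have h3 := h2.integral_fun_mul_eq_mul_integral (by
      exact (h.measurable i).aestronglyMeasurable) (by
      exact (((h.measurable j).mul (h.measurable k)).mul (h.measurable l)).aestronglyMeasurable)
  simp only [Function.comp_def] at h3
  rw [h3, h.integral_comp (g := fun x => x) measurable_id, h.mean_zero, zero_mul]

lemma IIDInnovations.integral_sq_mul_sq [IsProbabilityMeasure μ] (h : IIDInnovations μ ε)
    {i j : ℤ} (hj : i ≠ j) : ∫ w, ε i w ^ 2 * ε j w ^ 2 ∂μ = 1 := by
  have h2 := (h.indep.indepFun hj).comp (φ := fun v => v ^ 2) (ψ := fun v => v ^ 2)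
    (by fun_prop) (by fun_prop)
  have h3 := h2.integral_fun_mul_eq_mul_integral
    ((h.measurable i).pow_const 2).aestronglyMeasurable
    ((h.measurable j).pow_const 2).aestronglyMeasurable
  simp only [Function.comp_def] at h3
  rw [h3, h.integral_comp (g := fun x => x ^ 2) (by fun_prop),
    h.integral_comp (g := fun x => x ^ 2) (by fun_prop) j, h.var_one, one_mul]

/-- If some index is isolated the moment vanishes; otherwise the indices agree in two distinct
pairs, giving 1, or all agree. In the last case all three pairings fire, and $\mathbb
E\varepsilon^4=\kappa_4+3$. -/
lemma IIDInnovations.integral_four [IsProbabilityMeasure μ] (h : IIDInnovations μ ε)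
    (i j k l : ℤ) :
    ∫ w, ε i w * ε j w * (ε k w * ε l w) ∂μ =
      (if i = j then 1 else 0) * (if k = l then 1 else 0) +
      (if i = k then 1 else 0) * (if j = l then 1 else 0) +
      (if i = l then 1 else 0) * (if j = k then 1 else 0) +
      fourthCumulant μ (ε 0) * (if i = j ∧ i = k ∧ i = l then 1 else 0) := by
  have lone1 := fun (i j k l : ℤ) => @IIDInnovations.integral_four_of_ne _ _ _ _ _ h i j k l
  have sq := fun (i j : ℤ) => @IIDInnovations.integral_sq_mul_sq _ _ _ _ _ h i j
  have e4 : ∫ w, ε i w ^ 4 ∂μ = fourthCumulant μ (ε 0) + 3 := by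
    rw [h.integral_comp (g := fun x => x ^ 4) (by fun_prop), fourthCumulant, h.var_one]; ring
  by_cases hij : i = j
  · subst hij
    by_cases hkl : k = l
    · subst hkl
      by_cases hik : i = k
      · subst hik
        simp only [if_true, and_self]
        rw [show (fun w => ε i w * ε i w * (ε i w * ε i w)) = fun w => ε i w ^ 4 by
          funext w; ring, e4]; ring
      · simp only [if_true, hik, if_false, and_false]
        rw [show (fun w => ε i w * ε i w * (ε k w * ε k w)) = fun w => ε i w ^ 2 * ε k w ^ 2 by
          funext w; ring, sq _ _ hik]; ring
    · by_cases hik : i = k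
      · subst hik
        rw [show (fun w => ε i w * ε i w * (ε i w * ε l w)) =
          fun w => ε l w * (ε i w * ε i w * ε i w) by funext w; ring,
          lone1 _ _ _ _ (Ne.symm hkl) (Ne.symm hkl) (Ne.symm hkl)]
        simp [hkl]
      · rw [show (fun w => ε i w * ε i w * (ε k w * ε l w)) =
          fun w => ε k w * (ε i w * ε i w * ε l w) by funext w; ring,
          lone1 _ _ _ _ (Ne.symm hik) (Ne.symm hik) hkl]
        simp [hkl, hik]
  · by_cases hik : i = k
    · subst hik
      by_cases hjl : j = l
      · subst hjl
        rw [show (fun w => ε i w * ε j w * (ε i w * ε j w)) = fun w => ε i w ^ 2 * ε j w ^ 2 by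
          funext w; ring, sq _ _ hij]
        simp [hij]
      · rw [show (fun w => ε i w * ε j w * (ε i w * ε l w)) =
          fun w => ε j w * (ε i w * ε i w * ε l w) by funext w; ring,
          lone1 _ _ _ _ (Ne.symm hij) (Ne.symm hij) hjl]
        simp [hij, hjl, Ne.symm hij]
    · by_cases hil : i = l
      · subst hil
        by_cases hjk : j = k
        · subst hjk
          rw [show (fun w => ε i w * ε j w * (ε j w * ε i w)) = fun w => ε i w ^ 2 * ε j w ^ 2 by
            funext w; ring, sq _ _ hij]
          simp [hij]
        · rw [show (fun w => ε i w * ε j w * (ε k w * ε i w)) =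
            fun w => ε j w * (ε i w * ε k w * ε i w) by funext w; ring,
            lone1 _ _ _ _ (Ne.symm hij) hjk (Ne.symm hij)]
          simp [hij, hik, hjk]
      · rw [show (fun w => ε i w * ε j w * (ε k w * ε l w)) =
          fun w => ε i w * (ε j w * ε k w * ε l w) by funext w; ring, lone1 _ _ _ _ hij hik hil]
        simp [hij, hik, hil]

/-- A series of nonnegative functions with summable integrals converges almost everywhere, to an
integrable function. -/
lemma integrable_tsum_of_nonneg {F : ℤ → Ω → ℝ} (hF : ∀ i, Integrable (F i) μ)
    (h0 : ∀ i w, 0 ≤ F i w) (hs : Summable fun i => ∫ w, F i w ∂μ) :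
    Integrable (fun w => ∑' i, F i w) μ ∧ ∀ᵐ w ∂μ, Summable fun i => F i w := by
  have hm : ∀ i, AEMeasurable (fun w => ENNReal.ofReal (F i w)) μ := fun i =>
    (hF i).aestronglyMeasurable.aemeasurable.ennreal_ofReal
  have hlt : ∫⁻ w, ∑' i, ENNReal.ofReal (F i w) ∂μ < ⊤ := by
    rw [lintegral_tsum hm]
    simp_rw [← ofReal_integral_eq_lintegral_ofReal (hF _) (Eventually.of_forall (h0 _))]
    rw [← ENNReal.ofReal_tsum_of_nonneg (fun i => integral_nonneg (h0 i)) hs]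
    exact ENNReal.ofReal_lt_top
  have hae : ∀ᵐ w ∂μ, Summable fun i => F i w := by
    filter_upwards [ae_lt_top' (AEMeasurable.tsum hm) hlt.ne] with w hw
    have := ENNReal.summable_toReal hw.ne
    simpa [ENNReal.toReal_ofReal (h0 _ w)] using this
  have hmeas : AEStronglyMeasurable (fun w => ∑' i, F i w) μ := by
    refine aestronglyMeasurable_of_tendsto_ae (atTop : Filter (Finset ℤ))
      (f := fun N w => ∑ i ∈ N, F i w) (fun N => ?_) ?_
    · exact (integrable_finsetSum N fun i _ => hF i).aestronglyMeasurable
    · filter_upwards [hae] with w hw using hw.hasSum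
  refine ⟨⟨hmeas, ?_⟩, hae⟩
  rw [hasFiniteIntegral_iff_ofReal (Eventually.of_forall fun w => tsum_nonneg fun i => h0 i w)]
  refine lt_of_le_of_lt (le_of_eq (lintegral_congr_ae ?_)) hlt
  filter_upwards [hae] with w hw
  exact ENNReal.ofReal_tsum_of_nonneg (fun i => h0 i w) hw

/-- Cauchy–Schwarz applied twice, that is, Jensen's inequality for $x^4$ with weights $v$. -/
lemma sum_mul_pow_four_le (N : Finset ℤ) {v x : ℤ → ℝ} (hv : ∀ s, 0 ≤ v s) {V : ℝ}
    (hV : ∑ s ∈ N, v s ≤ V) :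
    (∑ s ∈ N, v s * x s) ^ 4 ≤ V ^ 3 * ∑ s ∈ N, v s * x s ^ 4 := by
  have h0 : 0 ≤ ∑ s ∈ N, v s := Finset.sum_nonneg fun s _ => hv s
  have h1 : (∑ s ∈ N, v s * x s) ^ 2 ≤ (∑ s ∈ N, v s) * ∑ s ∈ N, v s * x s ^ 2 :=
    Finset.sum_sq_le_sum_mul_sum_of_sq_le_mul N (fun s _ => hv s)
      (fun s _ => mul_nonneg (hv s) (sq_nonneg _)) (fun s _ => le_of_eq (by ring))
  have h2 : (∑ s ∈ N, v s * x s ^ 2) ^ 2 ≤ (∑ s ∈ N, v s) * ∑ s ∈ N, v s * x s ^ 4 :=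
    Finset.sum_sq_le_sum_mul_sum_of_sq_le_mul N (fun s _ => hv s)
      (fun s _ => mul_nonneg (hv s) (by positivity)) (fun s _ => le_of_eq (by ring))
  have h4 : 0 ≤ ∑ s ∈ N, v s * x s ^ 4 :=
    Finset.sum_nonneg fun s _ => mul_nonneg (hv s) (by positivity)
  calc (∑ s ∈ N, v s * x s) ^ 4 = ((∑ s ∈ N, v s * x s) ^ 2) ^ 2 := by ring
    _ ≤ ((∑ s ∈ N, v s) * ∑ s ∈ N, v s * x s ^ 2) ^ 2 := by gcongr
    _ = (∑ s ∈ N, v s) ^ 2 * (∑ s ∈ N, v s * x s ^ 2) ^ 2 := by ring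
    _ ≤ (∑ s ∈ N, v s) ^ 2 * ((∑ s ∈ N, v s) * ∑ s ∈ N, v s * x s ^ 4) := by gcongr
    _ = (∑ s ∈ N, v s) ^ 3 * ∑ s ∈ N, v s * x s ^ 4 := by ring
    _ ≤ _ := by gcongr

/-- `L` is almost surely the sum of the linear series in the innovations with coefficients `a`,
dominated by `v`. -/
structure IsLinearForm (μ : Measure Ω) (ε : ℤ → Ω → ℝ) (v : ℤ → ℝ) (a : ℤ → ℂ) (L : Ω → ℂ) :
    Prop where
  norm_le : ∀ s, ‖a s‖ ≤ v s
  hasSum : ∀ᵐ w ∂μ, HasSum (fun s => a s * (ε s w : ℂ)) (L w)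

/-- The dominating function `1 + V³ ∑ v_s ε_s⁴` of fourth powers of linear forms. -/
def domFun (v : ℤ → ℝ) (ε : ℤ → Ω → ℝ) (w : Ω) : ℝ :=
  1 + (∑' s, v s) ^ 3 * ∑' s, v s * ε s w ^ 4

variable [IsProbabilityMeasure μ] (h : IIDInnovations μ ε) {v : ℤ → ℝ} (hv : Summable v)
  (hv0 : ∀ s, 0 ≤ v s)

include h hv hv0

lemma domFun_aux :
    Integrable (domFun v ε) μ ∧ ∀ᵐ w ∂μ, Summable fun s => v s * ε s w ^ 4 := by
  have hi : ∀ s, Integrable (fun w => v s * ε s w ^ 4) μ := fun s => by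
    have := (h.integrable_four s s s s).const_mul (v s)
    refine this.congr (Eventually.of_forall fun w => ?_)
    simp only; ring
  have hs : Summable fun s => ∫ w, v s * ε s w ^ 4 ∂μ := by
    have e4 : ∀ s, ∫ w, v s * ε s w ^ 4 ∂μ = v s * ∫ w, ε 0 w ^ 4 ∂μ := fun s => by
      rw [integral_const_mul, h.integral_comp (g := fun x => x ^ 4) (by fun_prop)]
    simp_rw [e4]
    exact hv.mul_right _
  obtain ⟨h1, h2⟩ := integrable_tsum_of_nonneg hi
    (fun s w => mul_nonneg (hv0 s) (by positivity)) hs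
  exact ⟨(integrable_const 1).add (h1.const_mul _), h2⟩

/-- The exceptional null set and the majorant depend neither on the coefficients nor on the finite
set. This is what permits dominated convergence along finite sets for several forms at once. -/
lemma norm_partial_pow_four_le : ∀ᵐ w ∂μ, ∀ (a : ℤ → ℂ), (∀ s, ‖a s‖ ≤ v s) →
    ∀ N : Finset ℤ, ‖∑ s ∈ N, a s * (ε s w : ℂ)‖ ^ 4 ≤ domFun v ε w := by
  filter_upwards [(domFun_aux h hv hv0).2] with w hw a ha N
  have h1 : ‖∑ s ∈ N, a s * (ε s w : ℂ)‖ ≤ ∑ s ∈ N, v s * |ε s w| := by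
    refine (norm_sum_le _ _).trans (Finset.sum_le_sum fun s _ => ?_)
    rw [norm_mul, Complex.norm_real, Real.norm_eq_abs]
    gcongr
    exact ha s
  have h2 := sum_mul_pow_four_le N (x := fun s => |ε s w|) hv0
    (hv.sum_le_tsum N fun s _ => hv0 s)
  have h3 : ∑ s ∈ N, v s * |ε s w| ^ 4 ≤ ∑' s, v s * ε s w ^ 4 := by
    refine le_trans (le_of_eq ?_) (hw.sum_le_tsum N fun s _ => mul_nonneg (hv0 s) (by positivity))
    refine Finset.sum_congr rfl fun s _ => ?_
    rw [show |ε s w| ^ 4 = ε s w ^ 4 from Even.pow_abs (by decide) _]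
  have hV : 0 ≤ ∑' s, v s := tsum_nonneg hv0
  calc _ ≤ (∑ s ∈ N, v s * |ε s w|) ^ 4 := by gcongr
    _ ≤ (∑' s, v s) ^ 3 * ∑' s, v s * ε s w ^ 4 := h2.trans (by gcongr)
    _ ≤ _ := by rw [domFun]; linarith

omit hv hv0 [IsProbabilityMeasure μ] in
lemma aestronglyMeasurable_partial (a : ℤ → ℂ) (N : Finset ℤ) :
    AEStronglyMeasurable (fun w => ∑ s ∈ N, a s * (ε s w : ℂ)) μ := by
  have := h.measurable
  exact Measurable.aestronglyMeasurable (by fun_prop)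

omit hv hv0 [IsProbabilityMeasure μ] in
lemma IsLinearForm.aestronglyMeasurable {a : ℤ → ℂ} {L : Ω → ℂ} (hL : IsLinearForm μ ε v a L) :
    AEStronglyMeasurable L μ :=
  aestronglyMeasurable_of_tendsto_ae (atTop : Filter (Finset ℤ))
    (fun N => aestronglyMeasurable_partial h a N) hL.hasSum

lemma IsLinearForm.memLp {a : ℤ → ℂ} {L : Ω → ℂ} (hL : IsLinearForm μ ε v a L) :
    MemLp L 4 μ := by
  have hm := hL.aestronglyMeasurable h
  rw [← integrable_norm_rpow_iff hm (by norm_num) (by norm_num),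
    show ENNReal.toReal 4 = ((4 : ℕ) : ℝ) by norm_num]
  simp_rw [Real.rpow_natCast]
  refine (domFun_aux h hv hv0).1.mono' (hm.norm.pow 4) ?_
  filter_upwards [norm_partial_pow_four_le h hv hv0, hL.hasSum] with w hw hw2
  rw [norm_pow, norm_norm]
  exact le_of_tendsto (hw2.norm.pow 4) (Eventually.of_forall fun N => hw a hL.norm_le N)

omit h hv hv0 in
lemma mul_four_le {a b c d M : ℝ}
    (ha' : a ^ 4 ≤ M) (hb' : b ^ 4 ≤ M) (hc' : c ^ 4 ≤ M) (hd' : d ^ 4 ≤ M) :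
    a * b * (c * d) ≤ M := by
  nlinarith [sq_nonneg (a * b - c * d), sq_nonneg (a ^ 2 - b ^ 2), sq_nonneg (c ^ 2 - d ^ 2)]

omit hv hv0 in
-- For finite sums the identity is `IIDInnovations.integral_four` summed over four indices, the
-- Kronecker deltas collapsing the quadruple sum.
lemma integral_partial_four (a b c d : ℤ → ℂ) (N : Finset ℤ) :
    ∫ w, (∑ s ∈ N, a s * (ε s w : ℂ)) * (∑ s ∈ N, b s * (ε s w : ℂ)) *
      ((∑ s ∈ N, c s * (ε s w : ℂ)) * (∑ s ∈ N, d s * (ε s w : ℂ))) ∂μ =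
    (∑ s ∈ N, a s * b s) * (∑ s ∈ N, c s * d s) + (∑ s ∈ N, a s * c s) * (∑ s ∈ N, b s * d s) +
    (∑ s ∈ N, a s * d s) * (∑ s ∈ N, b s * c s) +
    (fourthCumulant μ (ε 0) : ℂ) * ∑ s ∈ N, a s * b s * (c s * d s) := by
  have hint : ∀ i j k l : ℤ, Integrable (fun w => a i * b j * (c k * d l) *
      ((ε i w * ε j w * (ε k w * ε l w) : ℝ) : ℂ)) μ := fun i j k l =>
    ((h.integrable_four i j k l).ofReal).const_mul _
  have e : ∀ w, (∑ s ∈ N, a s * (ε s w : ℂ)) * (∑ s ∈ N, b s * (ε s w : ℂ)) *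
      ((∑ s ∈ N, c s * (ε s w : ℂ)) * (∑ s ∈ N, d s * (ε s w : ℂ))) =
      ∑ i ∈ N, ∑ j ∈ N, ∑ k ∈ N, ∑ l ∈ N, a i * b j * (c k * d l) *
        ((ε i w * ε j w * (ε k w * ε l w) : ℝ) : ℂ) := by
    intro w
    rw [Finset.sum_mul_sum, Finset.sum_mul_sum, Finset.sum_mul]
    refine Finset.sum_congr rfl fun i _ => ?_
    rw [Finset.sum_mul]
    refine Finset.sum_congr rfl fun j _ => ?_
    rw [Finset.mul_sum]
    refine Finset.sum_congr rfl fun k _ => ?_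
    rw [Finset.mul_sum]
    refine Finset.sum_congr rfl fun l _ => ?_
    push_cast; ring
  simp_rw [e]
  rw [integral_finsetSum _ fun i _ => integrable_finsetSum _ fun j _ =>
    integrable_finsetSum _ fun k _ => integrable_finsetSum _ fun l _ => hint i j k l]
  -- Absorbing the coefficients into the indicators gives each pairing a product form in which
  -- `simp` can evaluate the delta sums.
  have e2 : ∀ i j k l : ℤ, ∫ w, a i * b j * (c k * d l) *
        ((ε i w * ε j w * (ε k w * ε l w) : ℝ) : ℂ) ∂μ =
      (if i = j then a i * b j else 0) * (if k = l then c k * d l else 0) +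
      (if i = k then a i * c k else 0) * (if j = l then b j * d l else 0) +
      (if i = l then a i * d l else 0) * (if j = k then b j * c k else 0) +
      (fourthCumulant μ (ε 0) : ℂ) *
        (if i = j then if i = k then if i = l then a i * b i * (c i * d i) else 0 else 0 else 0)
      := by
    intro i j k l
    rw [integral_const_mul, integral_complex_ofReal, h.integral_four]
    by_cases hij : i = j <;> by_cases hik : i = k <;> by_cases hil : i = l <;>
      by_cases hjk : j = k <;> by_cases hjl : j = l <;> by_cases hkl : k = l <;>
      simp [hij, hik, hil, hjk, hjl, hkl] <;> first | omega | (subst_vars; try simp_all) <;> ring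
  have e3 : ∀ i j k, ∫ w, ∑ l ∈ N, a i * b j * (c k * d l) *
        ((ε i w * ε j w * (ε k w * ε l w) : ℝ) : ℂ) ∂μ = ∑ l ∈ N, ∫ w, a i * b j * (c k * d l) *
        ((ε i w * ε j w * (ε k w * ε l w) : ℝ) : ℂ) ∂μ := fun i j k =>
    integral_finsetSum _ fun l _ => hint i j k l
  have e4 : ∀ i j, ∫ w, ∑ k ∈ N, ∑ l ∈ N, a i * b j * (c k * d l) *
        ((ε i w * ε j w * (ε k w * ε l w) : ℝ) : ℂ) ∂μ = ∑ k ∈ N, ∫ w, ∑ l ∈ N,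
        a i * b j * (c k * d l) * ((ε i w * ε j w * (ε k w * ε l w) : ℝ) : ℂ) ∂μ := fun i j =>
    integral_finsetSum _ fun k _ => integrable_finsetSum _ fun l _ => hint i j k l
  have e5 : ∀ i, ∫ w, ∑ j ∈ N, ∑ k ∈ N, ∑ l ∈ N, a i * b j * (c k * d l) *
        ((ε i w * ε j w * (ε k w * ε l w) : ℝ) : ℂ) ∂μ = ∑ j ∈ N, ∫ w, ∑ k ∈ N, ∑ l ∈ N,
        a i * b j * (c k * d l) * ((ε i w * ε j w * (ε k w * ε l w) : ℝ) : ℂ) ∂μ := fun i =>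
    integral_finsetSum _ fun j _ => integrable_finsetSum _ fun k _ =>
      integrable_finsetSum _ fun l _ => hint i j k l
  simp_rw [e5, e4, e3, e2, Finset.sum_add_distrib]
  congr 1
  · congr 1
    · congr 1
      · rw [Finset.sum_mul]
        refine Finset.sum_congr rfl fun i hi => ?_
        simp [← Finset.mul_sum, hi]
      · rw [Finset.sum_mul_sum]
        refine Finset.sum_congr rfl fun i hi => Finset.sum_congr rfl fun j hj => ?_
        simp [hi, hj]
    · rw [Finset.sum_mul_sum]
      refine Finset.sum_congr rfl fun i hi => Finset.sum_congr rfl fun j hj => ?_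
      simp [hi, hj]
  · simp_rw [← Finset.mul_sum]
    congr 1
    refine Finset.sum_congr rfl fun i hi => ?_
    simp [hi]

/-- Both sides are limits along finite index sets: the left by dominated convergence with `domFun`,
the right because the products of coefficients are dominated by powers of the summable `v`. -/
lemma IsLinearForm.integral_four {a b c d : ℤ → ℂ} {A B C D : Ω → ℂ}
    (hA : IsLinearForm μ ε v a A) (hB : IsLinearForm μ ε v b B)
    (hC : IsLinearForm μ ε v c C) (hD : IsLinearForm μ ε v d D) :
    ∫ w, A w * B w * (C w * D w) ∂μ =
      (∑' s, a s * b s) * (∑' s, c s * d s) + (∑' s, a s * c s) * (∑' s, b s * d s) +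
      (∑' s, a s * d s) * (∑' s, b s * c s) +
      (fourthCumulant μ (ε 0) : ℂ) * ∑' s, a s * b s * (c s * d s) := by
  have hsq : Summable fun s => v s * v s :=
    (hv.mul_of_nonneg hv hv0 hv0).comp_injective (i := fun s => (s, s)) fun x y hxy => by
      simpa using hxy
  have hvsq0 : ∀ s, 0 ≤ v s * v s := fun s => mul_nonneg (hv0 s) (hv0 s)
  have hs2 : ∀ {f g : ℤ → ℂ}, (∀ s, ‖f s‖ ≤ v s) → (∀ s, ‖g s‖ ≤ v s) →
      Summable fun s => f s * g s := fun {f g} hf hg =>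
    Summable.of_norm_bounded hsq fun s => by
      rw [norm_mul]; exact mul_le_mul (hf s) (hg s) (norm_nonneg _) (hv0 s)
  have hs4 : Summable fun s => a s * b s * (c s * d s) :=
    Summable.of_norm_bounded ((hsq.mul_of_nonneg hsq hvsq0 hvsq0).comp_injective
      (i := fun s => (s, s)) fun x y hxy => by simpa using hxy) fun s => by
      simp only [norm_mul, Function.comp_apply]
      have := hv0 s
      gcongr
      exacts [hA.norm_le s, hB.norm_le s, hC.norm_le s, hD.norm_le s]
  have lim1 := tendsto_integral_filter_of_dominated_convergence (μ := μ)
    (l := (atTop : Filter (Finset ℤ))) (F := fun N w =>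
      (∑ s ∈ N, a s * (ε s w : ℂ)) * (∑ s ∈ N, b s * (ε s w : ℂ)) *
      ((∑ s ∈ N, c s * (ε s w : ℂ)) * (∑ s ∈ N, d s * (ε s w : ℂ))))
    (f := fun w => A w * B w * (C w * D w)) (domFun v ε)
    (Eventually.of_forall fun N => ((aestronglyMeasurable_partial h a N).mul
      (aestronglyMeasurable_partial h b N)).mul ((aestronglyMeasurable_partial h c N).mul
      (aestronglyMeasurable_partial h d N)))
    (Eventually.of_forall fun N => by
      filter_upwards [norm_partial_pow_four_le h hv hv0] with w hw
      simp only [norm_mul]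
      exact mul_four_le
        (hw a hA.norm_le N) (hw b hB.norm_le N) (hw c hC.norm_le N) (hw d hD.norm_le N))
    (domFun_aux h hv hv0).1
    (by
      filter_upwards [hA.hasSum, hB.hasSum, hC.hasSum, hD.hasSum] with w h1 h2 h3 h4
      exact (Tendsto.mul h1 h2).mul (Tendsto.mul h3 h4))
  simp_rw [integral_partial_four h a b c d] at lim1
  refine tendsto_nhds_unique lim1 ?_
  exact (((Tendsto.mul (hs2 hA.norm_le hB.norm_le).hasSum (hs2 hC.norm_le hD.norm_le).hasSum).add
    (Tendsto.mul (hs2 hA.norm_le hC.norm_le).hasSum (hs2 hB.norm_le hD.norm_le).hasSum)).add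
    (Tendsto.mul (hs2 hA.norm_le hD.norm_le).hasSum (hs2 hB.norm_le hC.norm_le).hasSum)).add
    (Tendsto.const_mul _ hs4.hasSum)

omit hv hv0 in
lemma integral_partial_two (a b : ℤ → ℂ) (N : Finset ℤ) :
    ∫ w, (∑ s ∈ N, a s * (ε s w : ℂ)) * (∑ s ∈ N, b s * (ε s w : ℂ)) ∂μ =
      ∑ s ∈ N, a s * b s := by
  have hint : ∀ i j : ℤ, Integrable (fun w => a i * b j * ((ε i w * ε j w : ℝ) : ℂ)) μ :=
    fun i j => ((h.integrable_two i j).ofReal).const_mul _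
  have e : ∀ w, (∑ s ∈ N, a s * (ε s w : ℂ)) * (∑ s ∈ N, b s * (ε s w : ℂ)) =
      ∑ i ∈ N, ∑ j ∈ N, a i * b j * ((ε i w * ε j w : ℝ) : ℂ) := by
    intro w
    simp_rw [Finset.sum_mul_sum]
    refine Finset.sum_congr rfl fun i _ => Finset.sum_congr rfl fun j _ => ?_
    push_cast; ring
  simp_rw [e]
  rw [integral_finsetSum _ fun i _ => integrable_finsetSum _ fun j _ => hint i j]
  refine Finset.sum_congr rfl fun i hi => ?_
  rw [integral_finsetSum _ fun j _ => hint i j]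
  have e2 : ∀ j, ∫ w, a i * b j * ((ε i w * ε j w : ℝ) : ℂ) ∂μ =
      if i = j then a i * b j else 0 := fun j => by
    rw [integral_const_mul, integral_complex_ofReal, h.integral_mul]
    split_ifs <;> simp
  rw [Finset.sum_congr rfl fun j _ => e2 j]
  simp [hi]

lemma IsLinearForm.integral_two {a b : ℤ → ℂ} {A B : Ω → ℂ}
    (hA : IsLinearForm μ ε v a A) (hB : IsLinearForm μ ε v b B) :
    ∫ w, A w * B w ∂μ = ∑' s, a s * b s := by
  have hsq : Summable fun s => v s * v s :=
    (hv.mul_of_nonneg hv hv0 hv0).comp_injective (i := fun s => (s, s)) fun x y hxy => by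
      simpa using hxy
  have hs : Summable fun s => a s * b s := Summable.of_norm_bounded hsq fun s => by
    rw [norm_mul]; exact mul_le_mul (hA.norm_le s) (hB.norm_le s) (norm_nonneg _) (hv0 s)
  have lim1 := tendsto_integral_filter_of_dominated_convergence (μ := μ)
    (l := (atTop : Filter (Finset ℤ))) (F := fun N w =>
      (∑ s ∈ N, a s * (ε s w : ℂ)) * (∑ s ∈ N, b s * (ε s w : ℂ)))
    (f := fun w => A w * B w) (domFun v ε)
    (Eventually.of_forall fun N => (aestronglyMeasurable_partial h a N).mul
      (aestronglyMeasurable_partial h b N))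
    (Eventually.of_forall fun N => by
      filter_upwards [norm_partial_pow_four_le h hv hv0] with w hw
      have h1 : (1 : ℝ) ≤ domFun v ε w := by
        have : 0 ≤ (∑' s, v s) ^ 3 * ∑' s, v s * ε s w ^ 4 :=
          mul_nonneg (pow_nonneg (tsum_nonneg hv0) 3)
            (tsum_nonneg fun s => mul_nonneg (hv0 s) (by positivity))
        rw [domFun]; linarith
      -- The summand 1 in `domFun` makes it dominate the constant 1, which takes the place of the
      -- two missing factors.
      have := mul_four_le (c := 1) (d := 1)
        (hw a hA.norm_le N) (hw b hB.norm_le N) (by simpa using h1) (by simpa using h1)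
      simpa using this)
    (domFun_aux h hv hv0).1
    (by
      filter_upwards [hA.hasSum, hB.hasSum] with w h1 h2
      exact Tendsto.mul h1 h2)
  simp only [integral_partial_two h a b] at lim1
  exact tendsto_nhds_unique lim1 hs.hasSum

end Moments

end LocStat

end

noncomputable section

namespace LocStat

/-! ### Lipschitz bounds for power series on the unit circle -/

section Coefficients

lemma exp_I_mul_nat (j : ℕ) (ω : ℝ) :
    Complex.exp (Complex.I * (j : ℂ) * (ω : ℂ)) = Complex.exp (Complex.I * (ω : ℂ)) ^ j := by
  rw [← Complex.exp_nat_mul]; ring_nf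

lemma norm_exp_I_mul (x : ℝ) : ‖Complex.exp (Complex.I * (x : ℂ))‖ = 1 := by
  rw [mul_comm]; exact Complex.norm_exp_ofReal_mul_I x

lemma norm_exp_I_mul_int (s : ℤ) (ω : ℝ) :
    ‖Complex.exp (Complex.I * (s : ℂ) * (ω : ℂ))‖ = 1 := by
  rw [mul_assoc]; exact_mod_cast norm_exp_I_mul (s * ω)

lemma norm_exp_I_mul_nat (s : ℕ) (ω : ℝ) :
    ‖Complex.exp (Complex.I * (s : ℂ) * (ω : ℂ))‖ = 1 := by
  rw [mul_assoc]; exact_mod_cast norm_exp_I_mul (s * ω)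

lemma norm_pow_sub_pow_le {z w : ℂ} (hz : ‖z‖ = 1) (hw : ‖w‖ = 1) (j : ℕ) :
    ‖z ^ j - w ^ j‖ ≤ j * ‖z - w‖ := by
  induction j with
  | zero => simp
  | succ j ih =>
    rw [show z ^ (j + 1) - w ^ (j + 1) = z * (z ^ j - w ^ j) + (z - w) * w ^ j by ring]
    refine (norm_add_le _ _).trans ?_
    rw [norm_mul, norm_mul, norm_pow, hz, hw]
    push_cast
    rw [one_pow]
    linarith [ih]

/-- The power series `∑ x_j e^{ijω}`. -/
def amp (x : ℕ → ℝ) (ω : ℝ) : ℂ :=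
  ∑' j : ℕ, (x j : ℂ) * Complex.exp (Complex.I * (j : ℂ) * (ω : ℂ))

variable {p x y : ℕ → ℝ} {M W : ℝ}

lemma summable_amp (hp : Summable p) (hx : ∀ j, |x j| ≤ M * p j) (ω : ℝ) :
    Summable fun j : ℕ => (x j : ℂ) * Complex.exp (Complex.I * (j : ℂ) * (ω : ℂ)) :=
  Summable.of_norm_bounded (hp.mul_left M) fun j => by
    rw [norm_mul, norm_exp_I_mul_nat, mul_one, Complex.norm_real]; exact hx j

lemma norm_amp_le (hp : Summable fun j : ℕ => (1 + j : ℝ) * p j) (hp0 : ∀ j, 0 ≤ p j)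
    (hM : 0 ≤ M) (hx : ∀ j, |x j| ≤ M * p j) (ω : ℝ) :
    ‖amp x ω‖ ≤ M * ∑' j : ℕ, (1 + j : ℝ) * p j := by
  rw [← tsum_mul_left]
  refine tsum_of_norm_bounded (hp.mul_left M).hasSum fun j => ?_
  rw [norm_mul, norm_exp_I_mul_nat, mul_one, Complex.norm_real]
  refine (hx j).trans (mul_le_mul_of_nonneg_left ?_ hM)
  nlinarith [hp0 j, mul_nonneg (Nat.cast_nonneg (α := ℝ) j) (hp0 j)]

/-- A $j$-th power is $j$-Lipschitz on the unit circle, which accounts for the weight $1+j$. The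
bound uses the chord $|e^{i\omega}-e^{i\omega'}|$ and not $|\omega-\omega'|$, so that frequencies
count modulo $2\pi$. -/
lemma norm_amp_sub_le (hps : Summable p) (hp : Summable fun j : ℕ => (1 + j : ℝ) * p j)
    (hp0 : ∀ j, 0 ≤ p j) (hM : 0 ≤ M) (hx : ∀ j, |x j| ≤ M * p j) (ω ω' : ℝ) :
    ‖amp x ω - amp x ω'‖ ≤ M * (∑' j : ℕ, (1 + j : ℝ) * p j) *
      ‖Complex.exp (Complex.I * (ω : ℂ)) - Complex.exp (Complex.I * (ω' : ℂ))‖ := by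
  rw [amp, amp, ← (summable_amp hps hx ω).tsum_sub (summable_amp hps hx ω'), ← tsum_mul_left,
    ← tsum_mul_right]
  refine tsum_of_norm_bounded ((hp.mul_left M).mul_right _).hasSum fun j => ?_
  rw [exp_I_mul_nat, exp_I_mul_nat, ← mul_sub, norm_mul, Complex.norm_real]
  have h1 := norm_pow_sub_pow_le (norm_exp_I_mul ω) (norm_exp_I_mul ω') j
  have h2 := norm_nonneg (Complex.exp (Complex.I * (ω : ℂ)) - Complex.exp (Complex.I * (ω' : ℂ)))
  calc _ ≤ M * p j * (j * ‖Complex.exp (Complex.I * (ω : ℂ)) -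
        Complex.exp (Complex.I * (ω' : ℂ))‖) :=
        mul_le_mul (hx j) h1 (norm_nonneg _) (mul_nonneg hM (hp0 j))
    _ ≤ _ := by
        have := mul_nonneg (mul_nonneg hM (hp0 j)) h2
        linarith

end Coefficients

/-! ### Transfer function and coefficients of the Fourier sums -/

section Transfer

variable {Ω : Type*} [MeasurableSpace Ω] {μ : Measure Ω} {ε : ℤ → Ω → ℝ} {X : ℕ → ℕ → Ω → ℝ}
  {ψT : ℕ → ℕ → ℕ → ℝ} {ψ : ℕ → ℝ → ℝ} {ℓ : ℕ → ℝ}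

namespace LocallyStationary

lemma inv_nonneg (H : LocallyStationary μ ε X ψT ψ ℓ) (j : ℕ) : 0 ≤ (ℓ j)⁻¹ :=
  (inv_pos.2 (H.ell_pos j)).le

lemma summable_weight (H : LocallyStationary μ ε X ψT ψ ℓ) :
    Summable fun j : ℕ => (1 + j : ℝ) * (ℓ j)⁻¹ := by
  -- The comparison $1+j\le 2j^2$ holds only from $j=1$ on, so the term $j=0$ is dropped.
  rw [← summable_nat_add_iff 1]
  refine Summable.of_nonneg_of_le (fun j => mul_nonneg (by positivity) (H.inv_nonneg _))
    (fun j => ?_) (((summable_nat_add_iff 1).2 H.ell_summable).mul_left 2)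
  rw [← mul_assoc]
  refine mul_le_mul_of_nonneg_right ?_ (H.inv_nonneg _)
  push_cast
  nlinarith [Nat.cast_nonneg (α := ℝ) j]

lemma summable_inv (H : LocallyStationary μ ε X ψT ψ ℓ) : Summable fun j : ℕ => (ℓ j)⁻¹ :=
  Summable.of_nonneg_of_le H.inv_nonneg (fun j => by
    nlinarith [mul_nonneg (Nat.cast_nonneg (α := ℝ) j) (H.inv_nonneg j)]) H.summable_weight

lemma exists_lipschitz (H : LocallyStationary μ ε X ψT ψ ℓ) :
    ∃ L : ℝ, 0 ≤ L ∧ ∀ j, ∀ u ∈ Icc (0 : ℝ) 1, ∀ v ∈ Icc (0 : ℝ) 1,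
      |ψ j u - ψ j v| ≤ L * (ℓ j)⁻¹ * |u - v| := by
  obtain ⟨L, hL⟩ := H.lipschitz
  refine ⟨|L|, abs_nonneg _, fun j u hu v hv => (hL j u hu v hv).trans ?_⟩
  have := H.inv_nonneg j
  gcongr
  exact le_abs_self L

/-- The last, mixed difference is the one that matters for `exists_twisted_sub_F2`: it says that
$u\mapsto A(u,\omega)-A(u,\omega')$ has a Lipschitz constant proportional to the chord between the
frequencies. -/
lemma exists_transfer_bounds (H : LocallyStationary μ ε X ψT ψ ℓ) : ∃ C : ℝ, 1 ≤ C ∧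
    (∀ u ∈ Icc (0 : ℝ) 1, ∀ ω, ‖transfer ψ u ω‖ ≤ C) ∧
    (∀ u ∈ Icc (0 : ℝ) 1, ∀ v ∈ Icc (0 : ℝ) 1, ∀ ω,
      ‖transfer ψ u ω - transfer ψ v ω‖ ≤ C * |u - v|) ∧
    (∀ u ∈ Icc (0 : ℝ) 1, ∀ ω ω', ‖transfer ψ u ω - transfer ψ u ω'‖ ≤
      C * ‖Complex.exp (Complex.I * (ω : ℂ)) - Complex.exp (Complex.I * (ω' : ℂ))‖) ∧
    (∀ u ∈ Icc (0 : ℝ) 1, ∀ v ∈ Icc (0 : ℝ) 1, ∀ ω ω',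
      ‖(transfer ψ u ω - transfer ψ u ω') - (transfer ψ v ω - transfer ψ v ω')‖ ≤
      C * ‖Complex.exp (Complex.I * (ω : ℂ)) - Complex.exp (Complex.I * (ω' : ℂ))‖ * |u - v|) := by
  obtain ⟨L, hL0, hL⟩ := H.exists_lipschitz
  set W := ∑' j : ℕ, (1 + j : ℝ) * (ℓ j)⁻¹ with hW
  have hW0 : 0 ≤ W := tsum_nonneg fun j => mul_nonneg (by positivity) (H.inv_nonneg j)
  have hb : ∀ u ∈ Icc (0 : ℝ) 1, ∀ j, |ψ j u| ≤ 1 * (ℓ j)⁻¹ := fun u hu j => by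
    rw [one_mul]; exact H.bound j u hu
  have hl : ∀ u ∈ Icc (0 : ℝ) 1, ∀ v ∈ Icc (0 : ℝ) 1, ∀ j,
      |ψ j u - ψ j v| ≤ L * |u - v| * (ℓ j)⁻¹ := fun u hu v hv j => by
    have := hL j u hu v hv; linarith
  have hc : ‖(((Real.sqrt (2 * Real.pi))⁻¹ : ℝ) : ℂ)‖ ≤ 1 := by
    rw [Complex.norm_real, Real.norm_of_nonneg (by positivity)]
    refine inv_le_one_of_one_le₀ (Real.one_le_sqrt.2 ?_)
    linarith [Real.pi_gt_three]
  have hle : ∀ {z : ℂ} {B : ℝ}, ‖z‖ ≤ B →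
      ‖(((Real.sqrt (2 * Real.pi))⁻¹ : ℝ) : ℂ) * z‖ ≤ B := fun {z B} hz => by
    rw [norm_mul]
    exact (mul_le_of_le_one_left (norm_nonneg _) hc).trans hz
  have tr : ∀ u ω, transfer ψ u ω =
      (((Real.sqrt (2 * Real.pi))⁻¹ : ℝ) : ℂ) * amp (fun j => ψ j u) ω := fun _ _ => rfl
  have sub : ∀ u ∈ Icc (0 : ℝ) 1, ∀ v ∈ Icc (0 : ℝ) 1, ∀ ω,
      amp (fun j => ψ j u) ω - amp (fun j => ψ j v) ω = amp (fun j => ψ j u - ψ j v) ω :=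
    fun u hu v hv ω => by
      rw [amp, amp, ← (summable_amp H.summable_inv (hb u hu) ω).tsum_sub
        (summable_amp H.summable_inv (hb v hv) ω), amp]
      refine tsum_congr fun j => ?_
      push_cast; ring
  refine ⟨1 + W + L * W, by nlinarith [mul_nonneg hL0 hW0], ?_, ?_, ?_, ?_⟩
  · intro u hu ω
    rw [tr]
    refine (hle (norm_amp_le H.summable_weight H.inv_nonneg zero_le_one (hb u hu) ω)).trans ?_
    nlinarith [mul_nonneg hL0 hW0]
  · intro u hu v hv ω
    rw [tr, tr, ← mul_sub, sub u hu v hv]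
    refine (hle (norm_amp_le H.summable_weight H.inv_nonneg
      (mul_nonneg hL0 (abs_nonneg (u - v))) (hl u hu v hv) ω)).trans ?_
    nlinarith [mul_nonneg hW0 (abs_nonneg (u - v)), abs_nonneg (u - v)]
  · intro u hu ω ω'
    rw [tr, tr, ← mul_sub]
    refine (hle (norm_amp_sub_le H.summable_inv H.summable_weight H.inv_nonneg zero_le_one
      (hb u hu) ω ω')).trans (mul_le_mul_of_nonneg_right ?_ (norm_nonneg _))
    nlinarith [mul_nonneg hL0 hW0]
  · intro u hu v hv ω ω'
    rw [tr, tr, tr, tr, ← mul_sub, ← mul_sub, ← mul_sub, sub_sub_sub_comm, sub u hu v hv,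
      sub u hu v hv]
    refine (hle (norm_amp_sub_le H.summable_inv H.summable_weight H.inv_nonneg
      (mul_nonneg hL0 (abs_nonneg (u - v))) (hl u hu v hv) ω ω')).trans ?_
    rw [mul_right_comm (1 + W + L * W)]
    refine mul_le_mul_of_nonneg_right ?_ (norm_nonneg _)
    nlinarith [mul_nonneg hW0 (abs_nonneg (u - v)), abs_nonneg (u - v)]

lemma abs_psiT_le (H : LocallyStationary μ ε X ψT ψ ℓ) {T t : ℕ} (h1 : 1 ≤ t) (hT : t ≤ T)
    (j : ℕ) : |ψT T t j| ≤ 2 * (ℓ j)⁻¹ := by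
  have hT0 : (0 : ℝ) < T := by exact_mod_cast (by omega : 0 < T)
  have ha := H.approx T t j h1 hT
  have hb := H.bound j ((t : ℝ) / T) ⟨by positivity, by
    rw [div_le_one hT0]; exact_mod_cast hT⟩
  have hi : (T : ℝ)⁻¹ ≤ 1 := inv_le_one_of_one_le₀ (by exact_mod_cast (by omega : 1 ≤ T))
  have h3 : (T : ℝ)⁻¹ * (ℓ j)⁻¹ ≤ (ℓ j)⁻¹ := mul_le_of_le_one_left (H.inv_nonneg j) hi
  rw [abs_le] at *
  constructor <;> linarith [ha.1, ha.2, hb.1, hb.2]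

end LocallyStationary

/-- The coefficient of `ε_s` in `X_{t,T}`. -/
def coef (ψT : ℕ → ℕ → ℕ → ℝ) (T t : ℕ) (s : ℤ) : ℝ :=
  if s ≤ t then ψT T t ((t : ℤ) - s).toNat else 0

/-- The coefficient of `ε_s` in `∑_{t=1}^T X_{t,T} e^{itω}`. -/
def linCoef (ψT : ℕ → ℕ → ℕ → ℝ) (T : ℕ) (ω : ℝ) (s : ℤ) : ℂ :=
  ∑ t ∈ Finset.Icc 1 T, (coef ψT T t s : ℂ) * Complex.exp (Complex.I * (t : ℂ) * (ω : ℂ))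

/-- A frequency-free majorant of `linCoef`. -/
def coefBound (ψT : ℕ → ℕ → ℕ → ℝ) (T : ℕ) (s : ℤ) : ℝ :=
  ∑ t ∈ Finset.Icc 1 T, |coef ψT T t s|

/-- The approximation of `linCoef` by the transfer function of the stationary process at `s/T`. -/
def mainCoef (ψ : ℕ → ℝ → ℝ) (T : ℕ) (ω : ℝ) (s : ℤ) : ℂ :=
  if 1 ≤ s ∧ s ≤ T then
    Complex.exp (Complex.I * (s : ℂ) * (ω : ℂ)) * amp (fun j => ψ j ((s : ℝ) / (T : ℝ))) ω else 0

/-- The unnormalised discrete Fourier transform. -/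
def dftSum (X : ℕ → ℕ → Ω → ℝ) (T : ℕ) (ω : ℝ) (w : Ω) : ℂ :=
  ∑ t ∈ Finset.Icc 1 T, (X T t w : ℂ) * Complex.exp (Complex.I * (t : ℂ) * (ω : ℂ))

namespace LocallyStationary

lemma coefBound_nonneg (T : ℕ) (s : ℤ) : 0 ≤ coefBound ψT T s :=
  Finset.sum_nonneg fun _ _ => abs_nonneg _

lemma injective_sub_nat (t : ℕ) : Function.Injective fun j : ℕ => (t : ℤ) - (j : ℤ) :=
  fun a b hab => by simp only at hab; omega

lemma coef_eq_zero {T t : ℕ} {s : ℤ} (hs : s ∉ Set.range fun j : ℕ => (t : ℤ) - (j : ℤ)) :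
    coef ψT T t s = 0 := by
  rw [coef, if_neg]
  intro hst
  exact hs ⟨((t : ℤ) - s).toNat, by simp only; omega⟩

lemma coef_sub (T t j : ℕ) : coef ψT T t ((t : ℤ) - j) = ψT T t j := by
  rw [coef, if_pos (by omega)]
  congr 1
  omega

lemma summable_coefBound (H : LocallyStationary μ ε X ψT ψ ℓ) (T : ℕ) :
    Summable (coefBound ψT T) := by
  refine summable_sum fun t ht => ?_
  rw [Finset.mem_Icc] at ht
  rw [← (injective_sub_nat t).summable_iff (fun s hs => by rw [coef_eq_zero hs, abs_zero])]
  refine Summable.of_nonneg_of_le (fun j => abs_nonneg _) (fun j => ?_)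
    (H.summable_inv.mul_left 2)
  simp only [Function.comp_apply, coef_sub]
  exact H.abs_psiT_le ht.1 ht.2 j

/-- The substitution $s=t-j$ turns each moving average into a series over all innovations, with zero
coefficients for $s>t$. The majorant does not involve $\omega$, so DFTs at different frequencies can
be multiplied within the moment formulas. -/
lemma isLinearForm (H : LocallyStationary μ ε X ψT ψ ℓ) (T : ℕ) (ω : ℝ) :
    IsLinearForm μ ε (coefBound ψT T) (linCoef ψT T ω) (dftSum X T ω) := by
  refine ⟨fun s => (norm_sum_le _ _).trans (Finset.sum_le_sum fun t _ => ?_), ?_⟩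
  · rw [norm_mul, norm_exp_I_mul_nat, mul_one, Complex.norm_real, Real.norm_eq_abs]
  · have hall : ∀ᵐ w ∂μ, ∀ t : ℕ, 1 ≤ t → t ≤ T →
        HasSum (fun j : ℕ => ψT T t j * ε ((t : ℤ) - (j : ℤ)) w) (X T t w) := by
      rw [ae_all_iff]; intro t
      by_cases ht : 1 ≤ t ∧ t ≤ T
      · filter_upwards [H.linear T t ht.1 ht.2] with w hw _ _ using hw
      · exact Eventually.of_forall fun w h1 h2 => absurd ⟨h1, h2⟩ ht
    filter_upwards [hall] with w hw
    simp only [linCoef, dftSum, Finset.sum_mul]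
    refine hasSum_sum fun t ht => ?_
    rw [Finset.mem_Icc] at ht
    have h1 : HasSum (fun s => coef ψT T t s * ε s w) (X T t w) := by
      rw [← (injective_sub_nat t).hasSum_iff (fun s hs => by rw [coef_eq_zero hs, zero_mul])]
      simpa only [Function.comp_def, coef_sub] using hw t ht.1 ht.2
    have h2 : HasSum (fun s => ((coef ψT T t s * ε s w : ℝ) : ℂ)) (X T t w : ℂ) :=
      Complex.hasSum_ofReal.2 h1
    have h3 := h2.mul_right (Complex.exp (Complex.I * (t : ℂ) * (ω : ℂ)))
    refine h3.congr_fun fun s => ?_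
    push_cast; ring

end LocallyStationary

/-- Two bounded sequences at a finite distance in `ℓ¹`. -/
structure IsClose (C D : ℝ) (a a' : ℤ → ℂ) : Prop where
  left : ∀ s, ‖a s‖ ≤ C
  right : ∀ s, ‖a' s‖ ≤ C
  sum_le : ∀ N : Finset ℤ, ∑ s ∈ N, ‖a s - a' s‖ ≤ D

/-- From $ab-a'b'=a(b-b')+b'(a-a')$. Products of two or four coefficient sequences therefore stay at
a bounded $\ell^1$ distance from their approximations. -/
lemma IsClose.mul {C D C' D' : ℝ} {a a' b b' : ℤ → ℂ} (h : IsClose C D a a')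
    (h' : IsClose C' D' b b') :
    IsClose (C * C') (C * D' + C' * D) (fun s => a s * b s) (fun s => a' s * b' s) := by
  have hC : 0 ≤ C := (norm_nonneg _).trans (h.left 0)
  have hC' : 0 ≤ C' := (norm_nonneg _).trans (h'.left 0)
  refine ⟨fun s => ?_, fun s => ?_, fun N => ?_⟩
  · rw [norm_mul]; exact mul_le_mul (h.left s) (h'.left s) (norm_nonneg _) hC
  · rw [norm_mul]; exact mul_le_mul (h.right s) (h'.right s) (norm_nonneg _) hC
  · calc ∑ s ∈ N, ‖a s * b s - a' s * b' s‖
        ≤ ∑ s ∈ N, (C * ‖b s - b' s‖ + C' * ‖a s - a' s‖) := Finset.sum_le_sum fun s _ => by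
          rw [show a s * b s - a' s * b' s = a s * (b s - b' s) + b' s * (a s - a' s) by ring]
          refine (norm_add_le _ _).trans ?_
          rw [norm_mul, norm_mul]
          gcongr
          exacts [h.left s, h'.right s]
      _ = C * ∑ s ∈ N, ‖b s - b' s‖ + C' * ∑ s ∈ N, ‖a s - a' s‖ := by
          rw [Finset.sum_add_distrib, Finset.mul_sum, Finset.mul_sum]
      _ ≤ _ := by
          gcongr
          exacts [h'.sum_le N, h.sum_le N]

lemma IsClose.norm_tsum_sub_le {C D : ℝ} {a a' : ℤ → ℂ} (h : IsClose C D a a')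
    (ha : Summable a') : Summable a ∧ ‖∑' s, a s - ∑' s, a' s‖ ≤ D := by
  have hs : Summable fun s => ‖a s - a' s‖ := summable_of_sum_le (fun s => norm_nonneg _) h.sum_le
  have ha' : Summable a := by simpa using hs.of_norm.add ha
  refine ⟨ha', ?_⟩
  rw [← ha'.tsum_sub ha]
  exact (norm_tsum_le_tsum_norm hs).trans (Real.tsum_le_of_sum_le (fun s => norm_nonneg _) h.sum_le)

/-- Summing over the lag $j=t-s$ makes the sequence comparable, term by term, with
`mainCoef_eq_tsum`: only the index range and the time at which the coefficient is read differ. -/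
lemma linCoef_eq_tsum (T : ℕ) (ω : ℝ) (s : ℤ) :
    linCoef ψT T ω s = ∑' j : ℕ, if 1 ≤ s + j ∧ s + j ≤ T then
      (ψT T (s + j).toNat j : ℂ) * Complex.exp (Complex.I * ((s + j : ℤ) : ℂ) * (ω : ℂ)) else 0 := by
  have h1 : ∀ t ∈ Finset.Icc 1 T, HasSum (fun j : ℕ => if s + j = t then
      (ψT T t j : ℂ) * Complex.exp (Complex.I * (t : ℂ) * (ω : ℂ)) else 0)
      ((coef ψT T t s : ℂ) * Complex.exp (Complex.I * (t : ℂ) * (ω : ℂ))) := by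
    intro t _
    by_cases hst : s ≤ t
    · have := hasSum_single (f := fun j : ℕ => if s + j = t then
        (ψT T t j : ℂ) * Complex.exp (Complex.I * (t : ℂ) * (ω : ℂ)) else 0) ((t : ℤ) - s).toNat
        (fun j hj => if_neg (by omega))
      rw [if_pos (by omega)] at this
      rwa [coef, if_pos hst]
    · rw [coef, if_neg hst, Complex.ofReal_zero, zero_mul]
      refine (hasSum_zero).congr_fun fun j => if_neg (by omega)
  rw [linCoef, ← (hasSum_sum h1).tsum_eq]
  refine tsum_congr fun j => ?_
  split_ifs with hj
  · rw [Finset.sum_eq_single (s + j).toNat (fun t _ ht => if_neg (by omega))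
      (fun hn => absurd (Finset.mem_Icc.2 (by omega)) hn), if_pos (by omega)]
    congr 4
    have : (((s + j).toNat : ℤ) : ℂ) = ((s + j : ℤ) : ℂ) := by
      rw [Int.toNat_of_nonneg (by omega)]
    exact_mod_cast this
  · refine Finset.sum_eq_zero fun t ht => if_neg ?_
    rw [Finset.mem_Icc] at ht
    omega

lemma mainCoef_eq_tsum (T : ℕ) (ω : ℝ) (s : ℤ) :
    mainCoef ψ T ω s = ∑' j : ℕ, if 1 ≤ s ∧ s ≤ T then
      (ψ j ((s : ℝ) / T) : ℂ) * Complex.exp (Complex.I * ((s + j : ℤ) : ℂ) * (ω : ℂ)) else 0 := by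
  rw [mainCoef]
  split_ifs with hs
  · rw [amp, ← tsum_mul_left]
    refine tsum_congr fun j => ?_
    rw [mul_left_comm, ← Complex.exp_add]
    push_cast; ring_nf
  · rw [tsum_zero]

lemma sum_ite_mem_le (N A : Finset ℤ) {c : ℝ} (hc : 0 ≤ c) :
    ∑ s ∈ N, (if s ∈ A then c else 0) ≤ A.card * c := by
  rw [← Finset.sum_filter, Finset.sum_const, nsmul_eq_mul]
  refine mul_le_mul_of_nonneg_right ?_ hc
  exact_mod_cast Finset.card_le_card fun s hs => (Finset.mem_filter.1 hs).2

lemma div_mem_Icc {T : ℕ} {s : ℤ} (h1 : 1 ≤ s) (hT : s ≤ T) :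
    (s : ℝ) / (T : ℝ) ∈ Icc (0 : ℝ) 1 := by
  have hT0 : (0 : ℝ) < T := by exact_mod_cast (by omega : (0 : ℤ) < T)
  have : (1 : ℝ) ≤ s := by exact_mod_cast h1
  refine ⟨by positivity, ?_⟩
  rw [div_le_one hT0]; exact_mod_cast hT

/-- Fix a lag $j$. For the at most $T$ indices with both $s$ and $s+j$ in $[1,T]$, the approximation
hypothesis at time $s+j$ and the move from $(s+j)/T$ to $s/T$ cost $\ell(j)^{-1}(1+Lj)/T$ each.
Otherwise $s$ lies in one of two boundary strips of $j$ indices, with error at most $2\ell(j)^{-1}$.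
The total is $O((1+j)\ell(j)^{-1})$, summable in $j$ and free of $T$ and $\omega$. -/
lemma LocallyStationary.exists_isClose (H : LocallyStationary μ ε X ψT ψ ℓ) :
    ∃ C : ℝ, 1 ≤ C ∧ ∀ T : ℕ, 1 ≤ T → ∀ ω,
      IsClose C C (linCoef ψT T ω) (mainCoef ψ T ω) := by
  obtain ⟨L, hL0, hL⟩ := H.exists_lipschitz
  set W := ∑' j : ℕ, (1 + j : ℝ) * (ℓ j)⁻¹ with hW
  have hW0 : 0 ≤ W := tsum_nonneg fun j => mul_nonneg (by positivity) (H.inv_nonneg j)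
  have hpW : ∑' j : ℕ, (ℓ j)⁻¹ ≤ W := H.summable_inv.tsum_le_tsum (fun j => by
    nlinarith [mul_nonneg (Nat.cast_nonneg (α := ℝ) j) (H.inv_nonneg j)]) H.summable_weight
  -- $2W$ bounds the coefficients and $(5+L)W$ the $\ell^1$ distance; one constant serves both
  -- purposes.
  refine ⟨1 + 2 * W + (5 + L) * W, by nlinarith [mul_nonneg hL0 hW0], fun T hT ω => ?_⟩
  have hT0 : (0 : ℝ) < T := by exact_mod_cast hT
  set α : ℤ → ℕ → ℂ := fun s j => if 1 ≤ s + j ∧ s + j ≤ T then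
      (ψT T (s + j).toNat j : ℂ) * Complex.exp (Complex.I * ((s + j : ℤ) : ℂ) * (ω : ℂ)) else 0
    with hα
  set β : ℤ → ℕ → ℂ := fun s j => if 1 ≤ s ∧ s ≤ T then
      (ψ j ((s : ℝ) / T) : ℂ) * Complex.exp (Complex.I * ((s + j : ℤ) : ℂ) * (ω : ℂ)) else 0
    with hβ
  have hαn : ∀ s j, ‖α s j‖ ≤ 2 * (ℓ j)⁻¹ := fun s j => by
    simp only [hα]
    split_ifs with hs
    · rw [norm_mul, norm_exp_I_mul_int, mul_one, Complex.norm_real]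
      exact H.abs_psiT_le (by omega) (by omega) j
    · rw [norm_zero]; exact mul_nonneg zero_le_two (H.inv_nonneg j)
  have hβn : ∀ s j, ‖β s j‖ ≤ 2 * (ℓ j)⁻¹ := fun s j => by
    have := H.inv_nonneg j
    simp only [hβ]
    split_ifs with hs
    · rw [norm_mul, norm_exp_I_mul_int, mul_one, Complex.norm_real]
      exact (H.bound j _ (div_mem_Icc hs.1 hs.2)).trans (by linarith)
    · rw [norm_zero]; linarith
  have hαs : ∀ s, Summable (α s) := fun s =>
    Summable.of_norm_bounded (H.summable_inv.mul_left 2) (hαn s)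
  have hβs : ∀ s, Summable (β s) := fun s =>
    Summable.of_norm_bounded (H.summable_inv.mul_left 2) (hβn s)
  have hsum2 : ∀ {f : ℕ → ℂ}, (∀ j, ‖f j‖ ≤ 2 * (ℓ j)⁻¹) →
      ‖∑' j, f j‖ ≤ 1 + 2 * W + (5 + L) * W := fun {f} hf => by
    refine (tsum_of_norm_bounded (H.summable_inv.mul_left 2).hasSum hf).trans ?_
    rw [tsum_mul_left]
    nlinarith [mul_nonneg hL0 hW0]
  refine ⟨fun s => ?_, fun s => ?_, fun N => ?_⟩
  · rw [linCoef_eq_tsum]; exact hsum2 (hαn s)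
  · rw [mainCoef_eq_tsum]; exact hsum2 (hβn s)
  have hd : ∀ s j, ‖α s j - β s j‖ ≤
      (if s ∈ Finset.Icc (1 : ℤ) T then (ℓ j)⁻¹ * (1 + L * j) / T else 0) +
      (if s ∈ Finset.Icc (1 - j : ℤ) 0 then 2 * (ℓ j)⁻¹ else 0) +
      (if s ∈ Finset.Icc (T - j + 1 : ℤ) T then 2 * (ℓ j)⁻¹ else 0) := by
    intro s j
    have hp := H.inv_nonneg j
    have n1 : 0 ≤ (if s ∈ Finset.Icc (1 : ℤ) T then (ℓ j)⁻¹ * (1 + L * j) / T else 0) := by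
      split_ifs <;> positivity
    have n2 : 0 ≤ (if s ∈ Finset.Icc (1 - j : ℤ) 0 then 2 * (ℓ j)⁻¹ else 0) := by
      split_ifs <;> positivity
    have n3 : 0 ≤ (if s ∈ Finset.Icc (T - j + 1 : ℤ) T then 2 * (ℓ j)⁻¹ else 0) := by
      split_ifs <;> positivity
    by_cases h1 : 1 ≤ s ∧ s ≤ T
    · by_cases h2 : s + j ≤ T
      · have e1 : α s j - β s j = ((ψT T (s + j).toNat j - ψ j ((s : ℝ) / T) : ℝ) : ℂ) *
            Complex.exp (Complex.I * ((s + j : ℤ) : ℂ) * (ω : ℂ)) := by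
          simp only [hα, hβ]
          rw [if_pos ⟨by omega, h2⟩, if_pos h1]; push_cast; ring
        rw [e1, norm_mul, norm_exp_I_mul_int, mul_one, Complex.norm_real, Real.norm_eq_abs]
        rw [if_pos (Finset.mem_Icc.2 h1)] at n1 ⊢
        have hc : (((s + j).toNat : ℕ) : ℝ) = s + j := by
          have : (((s + j).toNat : ℤ) : ℝ) = ((s + j : ℤ) : ℝ) := by
            rw [Int.toNat_of_nonneg (by omega)]
          rw [← Int.cast_natCast, this]; push_cast; rfl
        have ha := H.approx T (s + j).toNat j (by omega) (by omega)
        have hm : (((s + j).toNat : ℕ) : ℝ) / T ∈ Icc (0 : ℝ) 1 := by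
          have := div_mem_Icc (T := T) (s := s + j) (by omega) h2
          rw [hc]; exact_mod_cast this
        have hl := hL j _ hm _ (div_mem_Icc h1.1 h1.2)
        have hq : (((s + j).toNat : ℕ) : ℝ) / T - (s : ℝ) / T = j / T := by rw [hc]; ring
        rw [hq, abs_of_nonneg (by positivity : (0 : ℝ) ≤ (j : ℝ) / T)] at hl
        have key : |ψT T (s + j).toNat j - ψ j ((s : ℝ) / T)| ≤ (ℓ j)⁻¹ * (1 + L * j) / T := by
          calc _ = |-(ψ j ((((s + j).toNat : ℕ) : ℝ) / T) - ψT T (s + j).toNat j) +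
                (ψ j ((((s + j).toNat : ℕ) : ℝ) / T) - ψ j ((s : ℝ) / T))| := by ring_nf
            _ ≤ (T : ℝ)⁻¹ * (ℓ j)⁻¹ + L * (ℓ j)⁻¹ * (j / T) := by
                refine (abs_add_le _ _).trans (add_le_add ?_ hl)
                rwa [abs_neg]
            _ = _ := by ring
        linarith
      · have e1 : α s j = 0 := if_neg (by omega)
        rw [e1, zero_sub, norm_neg]
        rw [if_pos (c := s ∈ Finset.Icc (T - j + 1 : ℤ) T) (Finset.mem_Icc.2 (by omega))]
        linarith [hβn s j]
    · have e1 : β s j = 0 := if_neg h1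
      rw [e1, sub_zero]
      by_cases h2 : 1 ≤ s + j ∧ s + j ≤ T
      · rw [if_pos (c := s ∈ Finset.Icc (1 - j : ℤ) 0) (Finset.mem_Icc.2 (by omega))]
        linarith [hαn s j]
      · have e2 : α s j = 0 := if_neg h2
        rw [e2, norm_zero]
        linarith
  -- The interior contributes $1+Lj$ and each boundary strip $2j$, all times $\ell(j)^{-1}$; and
  -- $1+(4+L)j\le(5+L)(1+j)$.
  have hj : ∀ j, ∑ s ∈ N, ‖α s j - β s j‖ ≤ (5 + L) * ((1 + j) * (ℓ j)⁻¹) := fun j => by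
    have hp := H.inv_nonneg j
    refine (Finset.sum_le_sum fun s _ => hd s j).trans ?_
    rw [Finset.sum_add_distrib, Finset.sum_add_distrib]
    have a1 := sum_ite_mem_le N (Finset.Icc (1 : ℤ) T)
      (c := (ℓ j)⁻¹ * (1 + L * j) / T) (by positivity)
    have a2 := sum_ite_mem_le N (Finset.Icc (1 - j : ℤ) 0) (c := 2 * (ℓ j)⁻¹) (by positivity)
    have a3 := sum_ite_mem_le N (Finset.Icc (T - j + 1 : ℤ) T) (c := 2 * (ℓ j)⁻¹) (by positivity)
    rw [Int.card_Icc, show ((T : ℤ) + 1 - 1).toNat = T by omega, mul_div_cancel₀ _ hT0.ne'] at a1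
    rw [Int.card_Icc, show ((0 : ℤ) + 1 - (1 - j)).toNat = j by omega] at a2
    rw [Int.card_Icc, show ((T : ℤ) + 1 - (T - j + 1)).toNat = j by omega] at a3
    have : 0 ≤ (ℓ j)⁻¹ * j := by positivity
    nlinarith [mul_nonneg hL0 hp]
  have hsd : ∀ s, Summable fun j => ‖α s j - β s j‖ := fun s => ((hαs s).sub (hβs s)).norm
  calc ∑ s ∈ N, ‖linCoef ψT T ω s - mainCoef ψ T ω s‖
      ≤ ∑ s ∈ N, ∑' j, ‖α s j - β s j‖ := Finset.sum_le_sum fun s _ => by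
        rw [linCoef_eq_tsum, mainCoef_eq_tsum, ← (hαs s).tsum_sub (hβs s)]
        exact norm_tsum_le_tsum_norm (hsd s)
    _ = ∑' j, ∑ s ∈ N, ‖α s j - β s j‖ := (Summable.tsum_finsetSum fun s _ => hsd s).symm
    _ ≤ ∑' j : ℕ, (5 + L) * ((1 + j) * (ℓ j)⁻¹) :=
        (summable_sum fun s _ => hsd s).tsum_le_tsum hj (H.summable_weight.mul_left _)
    _ = (5 + L) * W := tsum_mul_left
    _ ≤ _ := by linarith

end Transfer

end LocStat

end

noncomputable section

namespace LocStat

/-! ### Canonical frequencies and the periodic majorant -/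

section Frequencies

lemma freq_add (T : ℕ) (m n : ℤ) : freq T (m + n) = freq T m + freq T n := by
  rw [freq, freq, freq]; push_cast; ring

lemma freq_neg (T : ℕ) (m : ℤ) : freq T (-m) = -freq T m := by
  rw [freq, freq]; push_cast; ring

lemma exp_I_freq_add_mul {T : ℕ} (hT : 1 ≤ T) (r k : ℤ) :
    Complex.exp (Complex.I * (freq T (r + T * k) : ℂ)) =
      Complex.exp (Complex.I * (freq T r : ℂ)) := by
  have hT0 : (T : ℂ) ≠ 0 := by exact_mod_cast (by omega : T ≠ 0)
  rw [Complex.exp_eq_exp_iff_exists_int]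
  refine ⟨k, ?_⟩
  rw [freq, freq]
  push_cast
  field_simp

lemma exp_I_freq_emod {T : ℕ} (hT : 1 ≤ T) (s : ℤ) :
    Complex.exp (Complex.I * (freq T s : ℂ)) =
      Complex.exp (Complex.I * (freq T (s % T) : ℂ)) := by
  conv_lhs => rw [← Int.emod_add_mul_ediv s T]
  exact exp_I_freq_add_mul hT _ _

/-- A `T`-periodic majorant of the Fourier coefficients of Lipschitz functions. -/
def decay (T : ℕ) (s : ℤ) : ℝ :=
  1 / (1 + ((s % T : ℤ) : ℝ)) + 1 / (1 + (((-s) % T : ℤ) : ℝ))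

lemma decay_neg (T : ℕ) (s : ℤ) : decay T (-s) = decay T s := by
  rw [decay, decay, neg_neg, add_comm]

lemma emod_cast_nonneg {T : ℕ} (hT : 1 ≤ T) (s : ℤ) : (0 : ℝ) ≤ ((s % T : ℤ) : ℝ) := by
  exact_mod_cast Int.emod_nonneg s (by omega)

lemma decay_nonneg {T : ℕ} (hT : 1 ≤ T) (s : ℤ) : 0 ≤ decay T s := by
  have h1 := emod_cast_nonneg hT s
  have h2 := emod_cast_nonneg hT (-s)
  rw [decay]; positivity

/-- Residues are at most $T-1$. Errors of order $1/T$ can thus be absorbed into `decay`. -/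
lemma inv_le_decay {T : ℕ} (hT : 1 ≤ T) (s : ℤ) : (T : ℝ)⁻¹ ≤ decay T s := by
  have h1 := emod_cast_nonneg hT s
  have h2 := emod_cast_nonneg hT (-s)
  have h3 : ((s % T : ℤ) : ℝ) + 1 ≤ T := by
    exact_mod_cast Int.emod_lt_of_pos s (by omega : (0 : ℤ) < T)
  have hT0 : (0 : ℝ) < T := by exact_mod_cast hT
  have h4 : 1 / (T : ℝ) ≤ 1 / (1 + ((s % T : ℤ) : ℝ)) :=
    one_div_le_one_div_of_le (by positivity) (by linarith)
  have h5 : 0 ≤ 1 / (1 + (((-s) % T : ℤ) : ℝ)) := by positivity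
  rw [decay, inv_eq_one_div]; linarith

/-- $|e^{ix}-1|=2|\sin(x/2)|$ and Jordan's inequality $\sin y\ge 2y/\pi$; the condition $2r\le T$
places $y=\omega_r/2$ in $[0,\pi/2]$. -/
lemma le_norm_exp_freq_sub_one {T : ℕ} (hT : 1 ≤ T) {r : ℤ} (h0 : 0 ≤ r) (hr : 2 * r ≤ T) :
    4 * (r : ℝ) / T ≤ ‖Complex.exp (Complex.I * (freq T r : ℂ)) - 1‖ := by
  have hT0 : (0 : ℝ) < T := by exact_mod_cast hT
  have h0' : (0 : ℝ) ≤ r := by exact_mod_cast h0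
  have hr' : 2 * (r : ℝ) ≤ T := by exact_mod_cast hr
  rw [Complex.norm_exp_I_mul_ofReal_sub_one]
  have h1 := Real.mul_le_sin (x := freq T r / 2) (by rw [freq]; positivity) (by
    rw [freq, div_div, div_le_div_iff₀ (by positivity) two_pos]
    nlinarith [Real.pi_pos])
  have h2 : 2 / Real.pi * (freq T r / 2) = 2 * r / T := by
    rw [freq]; field_simp
  rw [h2] at h1
  refine le_trans ?_ (Real.le_norm_self _)
  calc 4 * (r : ℝ) / T = 2 * (2 * r / T) := by ring
    _ ≤ _ := by linarith

lemma norm_exp_neg_sub_one (x : ℝ) :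
    ‖Complex.exp (Complex.I * ((-x : ℝ) : ℂ)) - 1‖ = ‖Complex.exp (Complex.I * (x : ℂ)) - 1‖ := by
  rw [Complex.norm_exp_I_mul_ofReal_sub_one, Complex.norm_exp_I_mul_ofReal_sub_one, neg_div,
    Real.sin_neg, mul_neg, norm_neg]

/-- At residue $r=0$ only the trivial bound $x\le B$ is available. For $r\ge1$ the lower bound on
the chord gives $4rx\le3B$, and $1+r\le 4r$. -/
lemma le_decay_of_emod_le {T : ℕ} (hT : 1 ≤ T) {x B : ℝ} {s : ℤ} (hx : 0 ≤ x) (hB : x ≤ B)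
    (hs : x * ‖Complex.exp (Complex.I * (freq T s : ℂ)) - 1‖ ≤ 3 * B / T)
    (hr : 2 * (s % T) ≤ T) : x ≤ 3 * B * (1 / (1 + ((s % T : ℤ) : ℝ))) := by
  have hT0 : (0 : ℝ) < T := by exact_mod_cast hT
  have h0 : 0 ≤ s % T := Int.emod_nonneg s (by omega)
  have hl := le_norm_exp_freq_sub_one hT h0 hr
  rw [exp_I_freq_emod hT s] at hs
  set r := s % T with hrdef
  have h0' : (0 : ℝ) ≤ r := by exact_mod_cast h0
  rw [mul_one_div, le_div_iff₀ (by positivity)]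
  rcases h0.eq_or_lt with h | h
  · rw [← h]; push_cast; linarith
  · have h1 : (1 : ℝ) ≤ r := by exact_mod_cast h
    have h2 : x * (4 * r / T) ≤ 3 * B / T := (mul_le_mul_of_nonneg_left hl hx).trans hs
    rw [← mul_div_assoc, div_le_div_iff_of_pos_right hT0] at h2
    nlinarith

/-- One of $s$ and $-s$ has residue at most $T/2$, and the chord is even in $s$; each of the two
summands of `decay` covers one case. -/
lemma le_decay {T : ℕ} (hT : 1 ≤ T) {x B : ℝ} {s : ℤ} (hx : 0 ≤ x) (hB : x ≤ B)
    (hs : x * ‖Complex.exp (Complex.I * (freq T s : ℂ)) - 1‖ ≤ 3 * B / T) :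
    x ≤ 3 * B * decay T s := by
  have h1 := emod_cast_nonneg hT s
  have h2 := emod_cast_nonneg hT (-s)
  have hB0 : 0 ≤ B := hx.trans hB
  have p1 : 0 ≤ 3 * B * (1 / (1 + ((s % T : ℤ) : ℝ))) := by positivity
  have p2 : 0 ≤ 3 * B * (1 / (1 + (((-s) % T : ℤ) : ℝ))) := by positivity
  rw [decay, mul_add]
  by_cases hr : 2 * (s % T) ≤ T
  · linarith [le_decay_of_emod_le hT hx hB hs hr]
  · rw [← norm_exp_neg_sub_one, ← freq_neg] at hs
    have hr2 : 2 * ((-s) % T) ≤ T := by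
      have h3 : ¬ (T : ℤ) ∣ s := fun h => by
        rw [Int.emod_eq_zero_of_dvd h] at hr; omega
      rw [Int.neg_emod, if_neg h3, Int.natAbs_natCast]
      omega
    linarith [le_decay_of_emod_le hT hx hB hs hr2]

lemma sum_emod_Ico {T : ℕ} (hT : 1 ≤ T) (n : ℤ) (g : ℤ → ℝ) :
    ∑ k ∈ Finset.Ico n (n + T), g (k % T) = ∑ j ∈ Finset.range T, g j := by
  have hinj : Set.InjOn (fun k : ℤ => k % T) (Finset.Ico n (n + T) : Set ℤ) := by
    apply Finset.injOn_of_card_image_eq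
    rw [Int.image_Ico_emod n T (by omega)]
    simp
  rw [← Finset.sum_image (f := g) hinj, Int.image_Ico_emod n T (by omega)]
  refine Finset.sum_nbij' (fun k => k.toNat) (fun k => (k : ℤ)) ?_ ?_ ?_ ?_ ?_
  · intro k hk; rw [Finset.mem_Ico] at hk; rw [Finset.mem_range]; omega
  · intro k hk; rw [Finset.mem_range] at hk; rw [Finset.mem_Ico]; omega
  · intro k hk; rw [Finset.mem_Ico] at hk; omega
  · intro k hk; simp
  · intro k hk; rw [Finset.mem_Ico] at hk; rw [Int.toNat_of_nonneg hk.1]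

lemma sum_emod_neg_Ico {T : ℕ} (hT : 1 ≤ T) (n : ℤ) (g : ℤ → ℝ) :
    ∑ k ∈ Finset.Ico n (n + T), g ((-k) % T) = ∑ j ∈ Finset.range T, g j := by
  rw [← sum_emod_Ico hT (1 - n - T) g]
  refine Finset.sum_nbij' (fun k => -k) (fun k => -k) ?_ ?_ ?_ ?_ ?_ <;> intro k hk <;>
    rw [Finset.mem_Ico] at * <;> omega

/-- Any $T$ consecutive integers form a complete residue system, so each half of `decay` sums to the
harmonic number $H_T\le1+\log T$. -/
lemma sum_decay_Ico {T : ℕ} (hT : 1 ≤ T) (n c : ℤ) :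
    ∑ k ∈ Finset.Ico n (n + T), decay T (c + k) ≤ 2 * (1 + Real.log T) := by
  have h1 : ∑ k ∈ Finset.Ico n (n + T), decay T (c + k) =
      ∑ k ∈ Finset.Ico (n + c) (n + c + T), decay T k := by
    rw [show n + c + T = n + T + c by ring, ← Finset.image_add_right_Ico,
      Finset.sum_image (fun a _ b _ hab => by simpa using hab)]
    exact Finset.sum_congr rfl fun k _ => by rw [add_comm]
  rw [h1]
  simp only [decay]
  rw [Finset.sum_add_distrib, sum_emod_Ico hT (n + c) (fun j => 1 / (1 + (j : ℝ))),
    sum_emod_neg_Ico hT (n + c) (fun j => 1 / (1 + (j : ℝ)))]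
  have h2 : ∑ j ∈ Finset.range T, 1 / (1 + (((j : ℕ) : ℤ) : ℝ)) = ((harmonic T : ℚ) : ℝ) := by
    rw [harmonic]; push_cast
    exact Finset.sum_congr rfl fun j _ => by rw [one_div, add_comm]
  rw [h2]
  linarith [harmonic_le_one_add_log T]

lemma sum_decay_sq_Ico {T : ℕ} (hT : 1 ≤ T) (n c : ℤ) :
    ∑ k ∈ Finset.Ico n (n + T), decay T (c + k) ^ 2 ≤ 8 := by
  have h1 : ∑ k ∈ Finset.Ico n (n + T), decay T (c + k) ^ 2 =
      ∑ k ∈ Finset.Ico (n + c) (n + c + T), decay T k ^ 2 := by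
    rw [show n + c + T = n + T + c by ring, ← Finset.image_add_right_Ico,
      Finset.sum_image (fun a _ b _ hab => by simpa using hab)]
    exact Finset.sum_congr rfl fun k _ => by rw [add_comm]
  rw [h1]
  -- The subtracted $1/(n+1)$ makes the induction close by telescoping. Two halves, each bounded by
  -- 2 and doubled by $(a+b)^2\le2a^2+2b^2$, give the constant 8.
  have h2 : ∀ n : ℕ, ∑ j ∈ Finset.range (n + 1), (1 / (1 + (((j : ℕ) : ℤ) : ℝ))) ^ 2 ≤
      2 - 1 / ((n : ℝ) + 1) := by
    intro n
    induction n with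
    | zero => norm_num
    | succ n ih =>
      rw [Finset.sum_range_succ]
      push_cast at ih ⊢
      have hn : (0 : ℝ) ≤ n := Nat.cast_nonneg n
      have : (1 / (1 + ((n : ℝ) + 1))) ^ 2 ≤ 1 / ((n : ℝ) + 1) - 1 / ((n : ℝ) + 1 + 1) := by
        rw [div_sub_div _ _ (by positivity) (by positivity), div_pow,
          div_le_div_iff₀ (by positivity) (by positivity)]
        nlinarith
      linarith
  obtain ⟨N, rfl⟩ : ∃ N, T = N + 1 := ⟨T - 1, by omega⟩
  have h3 : ∑ j ∈ Finset.range (N + 1), (1 / (1 + (((j : ℕ) : ℤ) : ℝ))) ^ 2 ≤ 2 :=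
    (h2 N).trans (sub_le_self _ (by positivity))
  calc _ ≤ ∑ k ∈ Finset.Ico (n + c) (n + c + (N + 1 : ℕ)),
        (2 * (1 / (1 + ((k % (N + 1 : ℕ) : ℤ) : ℝ))) ^ 2 +
          2 * (1 / (1 + (((-k) % (N + 1 : ℕ) : ℤ) : ℝ))) ^ 2) :=
        Finset.sum_le_sum fun k _ => by
          rw [decay]
          nlinarith [sq_nonneg (1 / (1 + ((k % (N + 1 : ℕ) : ℤ) : ℝ)) -
            1 / (1 + (((-k) % (N + 1 : ℕ) : ℤ) : ℝ)))]
    _ ≤ 8 := by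
        rw [Finset.sum_add_distrib, ← Finset.mul_sum, ← Finset.mul_sum,
          sum_emod_Ico hT (n + c) (fun j => (1 / (1 + (j : ℝ))) ^ 2),
          sum_emod_neg_Ico hT (n + c) (fun j => (1 / (1 + (j : ℝ))) ^ 2)]
        linarith

end Frequencies

/-! ### Discrete Fourier coefficients of Lipschitz functions -/

section Twisted

/-- The discrete Fourier coefficient `T^{-1} ∑_{t=1}^T h(t/T) e^{2πist/T}`. -/
def twisted (T : ℕ) (s : ℤ) (h : ℝ → ℂ) : ℂ :=
  (T : ℂ)⁻¹ * ∑ t ∈ Finset.Icc 1 T, h ((t : ℝ) / (T : ℝ)) *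
    Complex.exp (Complex.I * (t : ℂ) * (freq T s : ℂ))

lemma twisted_sub (T : ℕ) (s : ℤ) (g h : ℝ → ℂ) :
    twisted T s g - twisted T s h = twisted T s (fun u => g u - h u) := by
  rw [twisted, twisted, twisted, ← mul_sub, ← Finset.sum_sub_distrib]
  simp_rw [sub_mul]

lemma nat_div_mem_Icc {T t : ℕ} (ht : t ∈ Finset.Icc 1 T) :
    (t : ℝ) / (T : ℝ) ∈ Icc (0 : ℝ) 1 := by
  rw [Finset.mem_Icc] at ht
  have := div_mem_Icc (T := T) (s := t) (by omega) (by omega)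
  rwa [Int.cast_natCast] at this

lemma norm_twisted_le {T : ℕ} (hT : 1 ≤ T) (s : ℤ) {h : ℝ → ℂ} {B : ℝ}
    (hB : ∀ u ∈ Icc (0 : ℝ) 1, ‖h u‖ ≤ B) : ‖twisted T s h‖ ≤ B := by
  have hT0 : (0 : ℝ) < T := by exact_mod_cast hT
  rw [twisted, norm_mul, norm_inv, Complex.norm_natCast, inv_mul_le_iff₀ hT0]
  refine (norm_sum_le _ _).trans ?_
  calc _ ≤ ∑ t ∈ Finset.Icc 1 T, B := Finset.sum_le_sum fun t ht => by
        rw [norm_mul, norm_exp_I_mul_nat, mul_one]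
        exact hB _ (nat_div_mem_Icc ht)
    _ = T * B := by simp

lemma sum_geom_by_parts (z : ℂ) (g : ℕ → ℂ) (n : ℕ) :
    (z - 1) * ∑ i ∈ Finset.range (n + 1), g i * z ^ i =
      g n * z ^ (n + 1) - g 0 - ∑ i ∈ Finset.range n, (g (i + 1) - g i) * z ^ (i + 1) := by
  induction n with
  | zero => simp; ring
  | succ n ih =>
    rw [Finset.sum_range_succ, mul_add, ih, Finset.sum_range_succ _ n]
    ring

/-- Abel summation: the two boundary terms are at most $B$ each, and the fewer than $T$ increments,
of size $B/T$, add up to at most $B$. Keeping the factor $|e^{i\omega_s}-1|$ on the left allows it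
to vanish. -/
lemma norm_twisted_mul_le {T : ℕ} (hT : 1 ≤ T) (s : ℤ) {h : ℝ → ℂ} {B : ℝ}
    (hB : ∀ u ∈ Icc (0 : ℝ) 1, ‖h u‖ ≤ B)
    (hL : ∀ u ∈ Icc (0 : ℝ) 1, ∀ v ∈ Icc (0 : ℝ) 1, ‖h u - h v‖ ≤ B * |u - v|) :
    ‖twisted T s h‖ * ‖Complex.exp (Complex.I * (freq T s : ℂ)) - 1‖ ≤ 3 * B / T := by
  have hT0 : (0 : ℝ) < T := by exact_mod_cast hT
  have hB0 : 0 ≤ B := (norm_nonneg _).trans (hB 0 (by simp))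
  obtain ⟨n, rfl⟩ : ∃ n, T = n + 1 := ⟨T - 1, by omega⟩
  set z := Complex.exp (Complex.I * (freq (n + 1) s : ℂ)) with hz
  have hz1 : ‖z‖ = 1 := norm_exp_I_mul _
  set g : ℕ → ℂ := fun i => h (((i + 1 : ℕ) : ℝ) / ((n + 1 : ℕ) : ℝ)) with hg
  have e : ∑ t ∈ Finset.Icc 1 (n + 1), h ((t : ℝ) / ((n + 1 : ℕ) : ℝ)) *
      Complex.exp (Complex.I * (t : ℂ) * (freq (n + 1) s : ℂ)) =
      z * ∑ i ∈ Finset.range (n + 1), g i * z ^ i := by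
    rw [← Finset.Ico_add_one_right_eq_Icc, Finset.sum_Ico_eq_sum_range, Finset.mul_sum]
    refine Finset.sum_congr (by simp) fun i _ => ?_
    rw [exp_I_mul_nat, ← hz, hg, add_comm 1 i, pow_succ]
    ring
  have hm : ∀ i < n + 1, ((i + 1 : ℕ) : ℝ) / ((n + 1 : ℕ) : ℝ) ∈ Icc (0 : ℝ) 1 := fun i hi =>
    nat_div_mem_Icc (Finset.mem_Icc.2 (by omega))
  have hs : ‖∑ i ∈ Finset.range n, (g (i + 1) - g i) * z ^ (i + 1)‖ ≤ B := by
    refine (norm_sum_le _ _).trans ?_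
    calc _ ≤ ∑ i ∈ Finset.range n, B * ((n + 1 : ℕ) : ℝ)⁻¹ := Finset.sum_le_sum fun i hi => by
          rw [Finset.mem_range] at hi
          rw [norm_mul, norm_pow, hz1, one_pow, mul_one]
          refine (hL _ (hm _ (by omega)) _ (hm _ (by omega))).trans (le_of_eq ?_)
          rw [← sub_div]
          push_cast
          rw [show (i : ℝ) + 1 + 1 - (i + 1) = 1 by ring, abs_of_nonneg (by positivity), one_div]
      _ = n * (B * ((n + 1 : ℕ) : ℝ)⁻¹) := by simp
      _ ≤ B := by
          rw [mul_left_comm, ← div_eq_mul_inv]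
          refine mul_le_of_le_one_right hB0 ((div_le_one hT0).2 ?_)
          push_cast; linarith
  have key : ‖(z - 1) * ∑ i ∈ Finset.range (n + 1), g i * z ^ i‖ ≤ 3 * B := by
    rw [sum_geom_by_parts]
    refine (norm_sub_le _ _).trans ?_
    have h1 := norm_sub_le (g n * z ^ (n + 1)) (g 0)
    rw [norm_mul, norm_pow, hz1, one_pow, mul_one] at h1
    have h2 := hB _ (hm n (by omega))
    have h3 := hB _ (hm 0 (by omega))
    simp only [hg] at *
    linarith
  rw [twisted, e, norm_mul, norm_mul, hz1, one_mul, norm_inv, Complex.norm_natCast, mul_assoc,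
    mul_comm ‖_‖ ‖z - 1‖, ← norm_mul, inv_mul_eq_div]
  gcongr

end Twisted

/-! ### Moments of the DFT in terms of $F_2$ and fourth-order coefficients -/

section SecondOrder

variable {Ω : Type*} [MeasurableSpace Ω] {μ : Measure Ω} {ε : ℤ → Ω → ℝ} {X : ℕ → ℕ → Ω → ℝ}
  {ψT : ℕ → ℕ → ℕ → ℝ} {ψ : ℕ → ℝ → ℝ} {ℓ : ℕ → ℝ}

lemma hasSum_Icc_int (T : ℕ) {φ : ℤ → ℂ} (hφ : ∀ s, ¬ (1 ≤ s ∧ s ≤ (T : ℤ)) → φ s = 0) :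
    HasSum φ (∑ t ∈ Finset.Icc 1 T, φ (t : ℤ)) := by
  have h : ∑ t ∈ Finset.Icc 1 T, φ (t : ℤ) = ∑ s ∈ Finset.Icc (1 : ℤ) T, φ s := by
    refine Finset.sum_nbij' (fun k => (k : ℤ)) (fun k => k.toNat) ?_ ?_ ?_ ?_ ?_
    · intro k hk; rw [Finset.mem_Icc] at *; omega
    · intro k hk; rw [Finset.mem_Icc] at *; omega
    · intro k hk; simp
    · intro k hk; rw [Finset.mem_Icc] at hk; omega
    · intro k hk; rfl
  rw [h]
  exact hasSum_sum_of_ne_finset_zero fun s hs => hφ s (by rwa [Finset.mem_Icc] at hs)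

lemma mainCoef_natCast {T t : ℕ} (ht : t ∈ Finset.Icc 1 T) (ω : ℝ) :
    mainCoef ψ T ω (t : ℤ) = Complex.exp (Complex.I * (t : ℂ) * (ω : ℂ)) *
      ((Real.sqrt (2 * Real.pi) : ℝ) * transfer ψ ((t : ℝ) / T) ω) := by
  rw [Finset.mem_Icc] at ht
  have h0 : ((Real.sqrt (2 * Real.pi) : ℝ) : ℂ) ≠ 0 := by
    exact_mod_cast (Real.sqrt_pos.2 (by positivity)).ne'
  rw [mainCoef, if_pos (by omega), transfer, Complex.ofReal_inv, mul_inv_cancel_left₀ h0]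
  push_cast
  rfl

lemma sqrt_two_pi_sq : ((Real.sqrt (2 * Real.pi) : ℝ) : ℂ) * (Real.sqrt (2 * Real.pi) : ℝ) =
    2 * Real.pi := by
  rw [← Complex.ofReal_mul, Real.mul_self_sqrt (by positivity)]; push_cast; rfl

lemma exp_freq_add (T t : ℕ) (m n : ℤ) :
    Complex.exp (Complex.I * (t : ℂ) * (freq T (m + n) : ℂ)) =
      Complex.exp (Complex.I * (t : ℂ) * (freq T m : ℂ)) *
        Complex.exp (Complex.I * (t : ℂ) * (freq T n : ℂ)) := by
  rw [freq_add, ← Complex.exp_add]; push_cast; ring_nf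

lemma hasSum_mainCoef_mul {T : ℕ} (hT : 1 ≤ T) (m n : ℤ) :
    HasSum (fun s => mainCoef ψ T (freq T m) s * mainCoef ψ T (freq T n) s)
      (2 * Real.pi * T * twisted T (m + n)
        (fun u => transfer ψ u (freq T m) * transfer ψ u (freq T n))) := by
  have hT0 : (T : ℂ) ≠ 0 := by exact_mod_cast (by omega : T ≠ 0)
  have h := hasSum_Icc_int T (φ := fun s => mainCoef ψ T (freq T m) s * mainCoef ψ T (freq T n) s)
    (fun s hs => by simp only [mainCoef, if_neg hs, zero_mul])
  convert h using 1
  rw [twisted, mul_assoc, mul_inv_cancel_left₀ hT0, Finset.mul_sum]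
  refine Finset.sum_congr rfl fun t ht => ?_
  rw [mainCoef_natCast ht, mainCoef_natCast ht, exp_freq_add, ← sqrt_two_pi_sq]
  ring

lemma hasSum_mainCoef_mul_four {T : ℕ} (hT : 1 ≤ T) (m n p q : ℤ) :
    HasSum (fun s => mainCoef ψ T (freq T m) s * mainCoef ψ T (freq T n) s *
        (mainCoef ψ T (freq T p) s * mainCoef ψ T (freq T q) s))
      ((2 * Real.pi) ^ 2 * T * twisted T (m + n + p + q)
        (fun u => transfer ψ u (freq T m) * transfer ψ u (freq T n) *
          (transfer ψ u (freq T p) * transfer ψ u (freq T q)))) := by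
  have hT0 : (T : ℂ) ≠ 0 := by exact_mod_cast (by omega : T ≠ 0)
  have h := hasSum_Icc_int T (φ := fun s => mainCoef ψ T (freq T m) s * mainCoef ψ T (freq T n) s *
        (mainCoef ψ T (freq T p) s * mainCoef ψ T (freq T q) s))
    (fun s hs => by simp only [mainCoef, if_neg hs, zero_mul])
  convert h using 1
  rw [twisted, mul_assoc, mul_inv_cancel_left₀ hT0, Finset.mul_sum]
  refine Finset.sum_congr rfl fun t ht => ?_
  rw [mainCoef_natCast ht, mainCoef_natCast ht, mainCoef_natCast ht, mainCoef_natCast ht,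
    exp_freq_add, exp_freq_add, exp_freq_add, ← sqrt_two_pi_sq]
  ring

/-- The contribution of the fourth cumulant to the fourth moment of the discrete Fourier
transform. -/
def cumFour (ψT : ℕ → ℕ → ℕ → ℝ) (T : ℕ) (m n p q : ℤ) : ℂ :=
  ((2 * Real.pi * T : ℂ) ^ 2)⁻¹ * ∑' s, linCoef ψT T (freq T m) s * linCoef ψT T (freq T n) s *
    (linCoef ψT T (freq T p) s * linCoef ψT T (freq T q) s)

/-- The second moment `E J_T(ω_m) J_T(ω_n)`. -/
def momTwo (μ : Measure Ω) (X : ℕ → ℕ → Ω → ℝ) (T : ℕ) (m n : ℤ) : ℂ :=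
  ∫ w, dft X T (freq T m) w * dft X T (freq T n) w ∂μ

omit [MeasurableSpace Ω] in
lemma dft_eq (T : ℕ) (ω : ℝ) (w : Ω) :
    dft X T ω w = ((Real.sqrt (2 * Real.pi * (T : ℝ)))⁻¹ : ℝ) * dftSum X T ω w := rfl

lemma sqrt_norm_sq (T : ℕ) :
    (((Real.sqrt (2 * Real.pi * (T : ℝ)))⁻¹ : ℝ) : ℂ) *
      ((Real.sqrt (2 * Real.pi * (T : ℝ)))⁻¹ : ℝ) = (2 * Real.pi * T : ℂ)⁻¹ := by
  rw [← Complex.ofReal_mul, ← mul_inv, Real.mul_self_sqrt (by positivity)]; push_cast; rfl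

namespace LocallyStationary

variable [IsProbabilityMeasure μ] (H : LocallyStationary μ ε X ψT ψ ℓ)

include H

lemma memLp_dft (T : ℕ) (ω : ℝ) : MemLp (dft X T ω) 4 μ :=
  ((H.isLinearForm T ω).memLp H.innovations (H.summable_coefBound T)
    (coefBound_nonneg T)).const_mul _

lemma momTwo_eq (T : ℕ) (m n : ℤ) : momTwo μ X T m n =
    (2 * Real.pi * T : ℂ)⁻¹ * ∑' s, linCoef ψT T (freq T m) s * linCoef ψT T (freq T n) s := by
  rw [← (H.isLinearForm T (freq T m)).integral_two H.innovations (H.summable_coefBound T)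
    (coefBound_nonneg T) (H.isLinearForm T (freq T n)), momTwo, ← sqrt_norm_sq,
    ← integral_const_mul]
  refine integral_congr_ae (Eventually.of_forall fun w => ?_)
  simp only [dft_eq]; ring

lemma integral_dft_four (T : ℕ) (m n p q : ℤ) :
    ∫ w, dft X T (freq T m) w * dft X T (freq T n) w *
      (dft X T (freq T p) w * dft X T (freq T q) w) ∂μ =
    momTwo μ X T m n * momTwo μ X T p q + momTwo μ X T m p * momTwo μ X T n q +
    momTwo μ X T m q * momTwo μ X T n p +
    (fourthCumulant μ (ε 0) : ℂ) * cumFour ψT T m n p q := by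
  have h := (H.isLinearForm T (freq T m)).integral_four H.innovations (H.summable_coefBound T)
    (coefBound_nonneg T) (H.isLinearForm T (freq T n)) (H.isLinearForm T (freq T p))
    (H.isLinearForm T (freq T q))
  simp only [H.momTwo_eq, cumFour]
  have e : ∫ w, dft X T (freq T m) w * dft X T (freq T n) w *
      (dft X T (freq T p) w * dft X T (freq T q) w) ∂μ = ((2 * Real.pi * T : ℂ)⁻¹) ^ 2 *
      ∫ w, dftSum X T (freq T m) w * dftSum X T (freq T n) w *
      (dftSum X T (freq T p) w * dftSum X T (freq T q) w) ∂μ := by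
    rw [← sqrt_norm_sq, ← integral_const_mul]
    refine integral_congr_ae (Eventually.of_forall fun w => ?_)
    simp only [dft_eq]; ring
  rw [e, h]; ring

/-- The two coefficient products are $O(1)$ apart in $\ell^1$, and the normalisation divides this by
$2\pi T$. -/
lemma exists_momTwo_approx : ∃ C : ℝ, 0 ≤ C ∧ ∀ T : ℕ, 1 ≤ T → ∀ m n : ℤ,
    ‖momTwo μ X T m n - twisted T (m + n)
      (fun u => transfer ψ u (freq T m) * transfer ψ u (freq T n))‖ ≤ C / T := by
  obtain ⟨C, hC, h⟩ := H.exists_isClose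
  refine ⟨2 * C ^ 2, by positivity, fun T hT m n => ?_⟩
  have hT0 : (0 : ℝ) < T := by exact_mod_cast hT
  have hT0' : (2 * Real.pi * T : ℂ) ≠ 0 := by
    exact_mod_cast (by positivity : (2 * Real.pi * T : ℝ) ≠ 0)
  have hs := hasSum_mainCoef_mul (ψ := ψ) hT m n
  have hc := ((h T hT (freq T m)).mul (h T hT (freq T n))).norm_tsum_sub_le hs.summable
  rw [hs.tsum_eq] at hc
  have e : momTwo μ X T m n - twisted T (m + n)
      (fun u => transfer ψ u (freq T m) * transfer ψ u (freq T n)) = (2 * Real.pi * T : ℂ)⁻¹ *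
      (∑' s, linCoef ψT T (freq T m) s * linCoef ψT T (freq T n) s - 2 * Real.pi * T *
        twisted T (m + n) (fun u => transfer ψ u (freq T m) * transfer ψ u (freq T n))) := by
    rw [H.momTwo_eq, mul_sub, inv_mul_cancel_left₀ hT0']
  rw [e, norm_mul, norm_inv]
  have hn : ‖(2 * Real.pi * T : ℂ)‖ = 2 * Real.pi * T := by
    rw [show (2 * Real.pi * T : ℂ) = ((2 * Real.pi * T : ℝ) : ℂ) by push_cast; rfl,
      Complex.norm_real, Real.norm_of_nonneg (by positivity)]
  rw [hn, inv_mul_eq_div]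
  refine (div_le_div_of_nonneg_right hc.2 (by positivity)).trans ?_
  rw [show C * C + C * C = 2 * C ^ 2 by ring]
  refine div_le_div_of_nonneg_left (by positivity) hT0 ?_
  nlinarith [Real.pi_gt_three]

omit [IsProbabilityMeasure μ] in
-- The $\ell^1$ error of the fourfold product is again $O(1)$, but the normalisation is $(2\pi
-- T)^{-2}$ while the main sum has only $T$ terms; hence a main part of size $1/T$ and an error of
-- size $1/T^2$.
lemma exists_cumFour_approx : ∃ C : ℝ, 0 ≤ C ∧ ∀ T : ℕ, 1 ≤ T → ∀ m n p q : ℤ,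
    ‖cumFour ψT T m n p q - (T : ℂ)⁻¹ * twisted T (m + n + p + q)
      (fun u => transfer ψ u (freq T m) * transfer ψ u (freq T n) *
        (transfer ψ u (freq T p) * transfer ψ u (freq T q)))‖ ≤ C / T ^ 2 := by
  obtain ⟨C, hC, h⟩ := H.exists_isClose
  refine ⟨4 * C ^ 4, by positivity, fun T hT m n p q => ?_⟩
  have hT0 : (0 : ℝ) < T := by exact_mod_cast hT
  have hT0' : (T : ℂ) ≠ 0 := by exact_mod_cast hT0.ne'
  have hpi : (Real.pi : ℂ) ≠ 0 := by exact_mod_cast Real.pi_ne_zero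
  have hs := hasSum_mainCoef_mul_four (ψ := ψ) hT m n p q
  have hc := (((h T hT (freq T m)).mul (h T hT (freq T n))).mul
    ((h T hT (freq T p)).mul (h T hT (freq T q)))).norm_tsum_sub_le hs.summable
  rw [hs.tsum_eq] at hc
  set tw := twisted T (m + n + p + q) (fun u => transfer ψ u (freq T m) * transfer ψ u (freq T n) *
        (transfer ψ u (freq T p) * transfer ψ u (freq T q))) with htw
  have e : cumFour ψT T m n p q - (T : ℂ)⁻¹ * tw = ((2 * Real.pi * T : ℂ) ^ 2)⁻¹ *
      (∑' s, linCoef ψT T (freq T m) s * linCoef ψT T (freq T n) s *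
    (linCoef ψT T (freq T p) s * linCoef ψT T (freq T q) s) - (2 * Real.pi) ^ 2 * T * tw) := by
    rw [cumFour, mul_sub]
    congr 1
    field_simp
  have hn : ‖(2 * Real.pi * T : ℂ)‖ = 2 * Real.pi * T := by
    rw [show (2 * Real.pi * T : ℂ) = ((2 * Real.pi * T : ℝ) : ℂ) by push_cast; rfl,
      Complex.norm_real, Real.norm_of_nonneg (by positivity)]
  rw [e, norm_mul, norm_inv, norm_pow, hn, inv_mul_eq_div]
  refine (div_le_div_of_nonneg_right hc.2 (by positivity)).trans ?_
  rw [show C * C * (C * C + C * C) + C * C * (C * C + C * C) = 4 * C ^ 4 by ring]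
  refine div_le_div_of_nonneg_left (by positivity) (by positivity) ?_
  refine pow_le_pow_left₀ hT0.le ?_ 2
  nlinarith [Real.pi_gt_three]

end LocallyStationary

lemma F2_eq_twisted (T : ℕ) (s : ℤ) (ω : ℝ) : F2 ψ T s ω = twisted T s (fun u => spec2 ψ u ω) := rfl

namespace LocallyStationary

lemma exists_F2_decay (H : LocallyStationary μ ε X ψT ψ ℓ) :
    ∃ C : ℝ, 0 ≤ C ∧ ∀ T : ℕ, 1 ≤ T → ∀ (s : ℤ) (ω : ℝ), ‖F2 ψ T s ω‖ ≤ C * decay T s := by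
  obtain ⟨C, hC, h1, h2, -, -⟩ := H.exists_transfer_bounds
  refine ⟨3 * (2 * C ^ 2), by positivity, fun T hT s ω => ?_⟩
  have hb : ∀ u ∈ Icc (0 : ℝ) 1, ‖spec2 ψ u ω‖ ≤ 2 * C ^ 2 := fun u hu => by
    rw [spec2, norm_mul]
    have := mul_le_mul (h1 u hu ω) (h1 u hu (-ω)) (norm_nonneg _) (by positivity)
    nlinarith
  have hl : ∀ u ∈ Icc (0 : ℝ) 1, ∀ v ∈ Icc (0 : ℝ) 1,
      ‖spec2 ψ u ω - spec2 ψ v ω‖ ≤ 2 * C ^ 2 * |u - v| := fun u hu v hv => by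
    rw [spec2, spec2, show transfer ψ u ω * transfer ψ u (-ω) - transfer ψ v ω * transfer ψ v (-ω)
      = transfer ψ u ω * (transfer ψ u (-ω) - transfer ψ v (-ω)) +
        (transfer ψ u ω - transfer ψ v ω) * transfer ψ v (-ω) by ring]
    refine (norm_add_le _ _).trans ?_
    rw [norm_mul, norm_mul]
    have a1 := mul_le_mul (h1 u hu ω) (h2 u hu v hv (-ω)) (norm_nonneg _) (by positivity)
    have a2 := mul_le_mul (h2 u hu v hv ω) (h1 v hv (-ω)) (norm_nonneg _) (by positivity)
    linarith
  rw [F2_eq_twisted]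
  exact le_decay hT (norm_nonneg _) (norm_twisted_le hT s hb) (norm_twisted_mul_le hT s hb hl)

/-- The difference is the Fourier coefficient at $m+n$ of
$A(u,\omega_m)\{A(u,\omega_n)-A(u,-\omega_m)\}$. With $q=|e^{i\omega_{m+n}}-1|$, also the chord
between the last two frequencies, this function has sup bound and Lipschitz constant $O(q)$, and
Abel summation gives $O(q)/(Tq)$. No decay in $m+n$ is needed for the error to be $O(1/T)$. -/
lemma exists_twisted_sub_F2 (H : LocallyStationary μ ε X ψT ψ ℓ) :
    ∃ C : ℝ, 0 ≤ C ∧ ∀ T : ℕ, 1 ≤ T → ∀ m n : ℤ,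
      ‖twisted T (m + n) (fun u => transfer ψ u (freq T m) * transfer ψ u (freq T n)) -
        F2 ψ T (m + n) (freq T m)‖ ≤ C / T := by
  obtain ⟨C, hC, h1, h2, h3, h4⟩ := H.exists_transfer_bounds
  refine ⟨3 * (2 * C ^ 2), by positivity, fun T hT m n => ?_⟩
  have hT0 : (0 : ℝ) < T := by exact_mod_cast hT
  set x := freq T m with hx
  set y := freq T n with hy
  set q := ‖Complex.exp (Complex.I * (freq T (m + n) : ℂ)) - 1‖ with hq
  have hq' : ‖Complex.exp (Complex.I * (y : ℂ)) -
      Complex.exp (Complex.I * ((-x : ℝ) : ℂ))‖ = q := by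
    have : Complex.exp (Complex.I * (y : ℂ)) - Complex.exp (Complex.I * ((-x : ℝ) : ℂ)) =
        Complex.exp (Complex.I * ((-x : ℝ) : ℂ)) *
          (Complex.exp (Complex.I * (freq T (m + n) : ℂ)) - 1) := by
      rw [mul_sub, ← Complex.exp_add, freq_add, ← hx, ← hy]
      push_cast; ring_nf
    rw [this, norm_mul, norm_exp_I_mul, one_mul]
  have hq0 : 0 ≤ q := norm_nonneg _
  rw [F2_eq_twisted, twisted_sub]
  have e : ∀ u, transfer ψ u x * transfer ψ u y - spec2 ψ u x =
      transfer ψ u x * (transfer ψ u y - transfer ψ u (-x)) := fun u => by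
    rw [spec2]; ring
  simp_rw [e]
  have hb : ∀ u ∈ Icc (0 : ℝ) 1, ‖transfer ψ u x * (transfer ψ u y - transfer ψ u (-x))‖ ≤
      2 * C ^ 2 * q := fun u hu => by
    rw [norm_mul]
    have a := h3 u hu y (-x)
    rw [hq'] at a
    have := mul_le_mul (h1 u hu x) a (norm_nonneg _) (by positivity)
    nlinarith [mul_nonneg (sq_nonneg C) hq0]
  have hl : ∀ u ∈ Icc (0 : ℝ) 1, ∀ v ∈ Icc (0 : ℝ) 1,
      ‖transfer ψ u x * (transfer ψ u y - transfer ψ u (-x)) -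
        transfer ψ v x * (transfer ψ v y - transfer ψ v (-x))‖ ≤ 2 * C ^ 2 * q * |u - v| :=
    fun u hu v hv => by
    rw [show transfer ψ u x * (transfer ψ u y - transfer ψ u (-x)) -
        transfer ψ v x * (transfer ψ v y - transfer ψ v (-x)) =
        transfer ψ u x * ((transfer ψ u y - transfer ψ u (-x)) -
          (transfer ψ v y - transfer ψ v (-x))) +
        (transfer ψ u x - transfer ψ v x) * (transfer ψ v y - transfer ψ v (-x)) by ring]
    refine (norm_add_le _ _).trans ?_
    rw [norm_mul, norm_mul]
    have b1 := h4 u hu v hv y (-x)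
    have b2 := h3 v hv y (-x)
    rw [hq'] at b1 b2
    have a1 := mul_le_mul (h1 u hu x) b1 (norm_nonneg _) (by positivity)
    have a2 := mul_le_mul (h2 u hu v hv x) b2 (norm_nonneg _) (by positivity)
    linarith
  -- If $q=0$ the frequencies agree modulo $2\pi$ and the function itself vanishes; otherwise $q$ is
  -- cancelled.
  rcases hq0.eq_or_lt with h0 | h0
  · refine (norm_twisted_le hT _ hb).trans ?_
    rw [← h0, mul_zero]; positivity
  · have := norm_twisted_mul_le hT (m + n) hb hl
    rw [← hq] at this
    refine le_of_mul_le_mul_right (this.trans (le_of_eq ?_)) h0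
    ring

lemma exists_momTwo_sub_F2 [IsProbabilityMeasure μ] (H : LocallyStationary μ ε X ψT ψ ℓ) :
    ∃ C : ℝ, 0 ≤ C ∧ ∀ T : ℕ, 1 ≤ T → ∀ m n : ℤ,
      ‖momTwo μ X T m n - F2 ψ T (m + n) (freq T m)‖ ≤ C / T := by
  obtain ⟨C₁, h₁, H₁⟩ := H.exists_momTwo_approx
  obtain ⟨C₂, h₂, H₂⟩ := H.exists_twisted_sub_F2
  refine ⟨C₁ + C₂, by positivity, fun T hT m n => ?_⟩
  rw [add_div]
  exact (norm_sub_le_norm_sub_add_norm_sub _ _ _).trans (add_le_add (H₁ T hT m n) (H₂ T hT m n))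

lemma exists_momTwo_decay [IsProbabilityMeasure μ] (H : LocallyStationary μ ε X ψT ψ ℓ) :
    ∃ C : ℝ, 0 ≤ C ∧ ∀ T : ℕ, 1 ≤ T → ∀ m n : ℤ, ‖momTwo μ X T m n‖ ≤ C * decay T (m + n) := by
  obtain ⟨C₁, h₁, H₁⟩ := H.exists_momTwo_sub_F2
  obtain ⟨C₂, h₂, H₂⟩ := H.exists_F2_decay
  refine ⟨C₁ + C₂, by positivity, fun T hT m n => ?_⟩
  have h1 := H₁ T hT m n
  have h2 := H₂ T hT (m + n) (freq T m)
  have h3 := mul_le_mul_of_nonneg_left (inv_le_decay hT (m + n)) h₁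
  rw [← div_eq_mul_inv] at h3
  have h4 := norm_add_le (momTwo μ X T m n - F2 ψ T (m + n) (freq T m)) (F2 ψ T (m + n) (freq T m))
  rw [sub_add_cancel] at h4
  linarith

end LocallyStationary

end SecondOrder

end LocStat

end

noncomputable section

namespace LocStat

/-! ### Riemann sums -/

section Riemann

/-- Right-endpoint Riemann sums of a Lipschitz function on `[0,1]`. -/
lemma norm_riemann_sub_le {h : ℝ → ℂ} {B : ℝ}
    (hL : ∀ u ∈ Icc (0 : ℝ) 1, ∀ v ∈ Icc (0 : ℝ) 1, ‖h u - h v‖ ≤ B * |u - v|)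
    {T : ℕ} (hT : 1 ≤ T) :
    ‖(T : ℂ)⁻¹ * ∑ t ∈ Finset.Icc 1 T, h ((t : ℝ) / T) - ∫ u in (0 : ℝ)..1, h u‖ ≤ B / T := by
  have hT0 : (0 : ℝ) < T := by exact_mod_cast hT
  have hB : 0 ≤ B := by
    have := (norm_nonneg _).trans (hL 1 (by simp) 0 (by simp))
    simpa using this
  have hcont : ContinuousOn h (Icc 0 1) :=
    (LipschitzOnWith.of_dist_le_mul (K := B.toNNReal) fun x hx y hy => by
      rw [dist_eq_norm, Real.dist_eq, Real.coe_toNNReal _ hB]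
      exact hL x hx y hy).continuousOn
  have hm : ∀ k : ℕ, k ≤ T → (k : ℝ) / T ∈ Icc (0 : ℝ) 1 := fun k hk =>
    ⟨by positivity, (div_le_one hT0).2 (by exact_mod_cast hk)⟩
  have hsub : ∀ k : ℕ, k < T → uIcc ((k : ℝ) / T) (((k + 1 : ℕ) : ℝ) / T) ⊆ Icc 0 1 :=
    fun k hk => uIcc_subset_Icc (hm k hk.le) (hm (k + 1) hk)
  have hint : ∀ k : ℕ, k < T →
      IntervalIntegrable h volume ((k : ℝ) / T) (((k + 1 : ℕ) : ℝ) / T) := fun k hk =>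
    (hcont.mono (hsub k hk)).intervalIntegrable
  have hsplit := intervalIntegral.sum_integral_adjacent_intervals (f := h) (μ := volume)
    (a := fun k : ℕ => (k : ℝ) / T) (n := T) hint
  simp only [Nat.cast_zero, zero_div, div_self hT0.ne'] at hsplit
  have hsum : (T : ℂ)⁻¹ * ∑ t ∈ Finset.Icc 1 T, h ((t : ℝ) / T) =
      ∑ k ∈ Finset.range T, (T : ℂ)⁻¹ * h (((k + 1 : ℕ) : ℝ) / T) := by
    rw [← Finset.Ico_add_one_right_eq_Icc, Finset.sum_Ico_eq_sum_range, Finset.mul_sum]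
    exact Finset.sum_congr (by simp) fun k _ => by rw [add_comm 1 k]
  rw [← hsplit, hsum, ← Finset.sum_sub_distrib]
  refine (norm_sum_le _ _).trans ?_
  calc _ ≤ ∑ k ∈ Finset.range T, B / T * (T : ℝ)⁻¹ := Finset.sum_le_sum fun k hk => by
        rw [Finset.mem_range] at hk
        have hd : ((k + 1 : ℕ) : ℝ) / T - (k : ℝ) / T = (T : ℝ)⁻¹ := by
          push_cast; field_simp; ring
        have e : (T : ℂ)⁻¹ * h (((k + 1 : ℕ) : ℝ) / T) =
            ∫ _u in ((k : ℝ) / T)..(((k + 1 : ℕ) : ℝ) / T), h (((k + 1 : ℕ) : ℝ) / T) := by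
          rw [intervalIntegral.integral_const, hd, Complex.real_smul]; push_cast; rfl
        rw [e, ← intervalIntegral.integral_sub intervalIntegrable_const (hint k hk)]
        have := intervalIntegral.norm_integral_le_of_norm_le_const (a := (k : ℝ) / T)
          (b := ((k + 1 : ℕ) : ℝ) / T) (C := B / T)
          (f := fun u => h (((k + 1 : ℕ) : ℝ) / T) - h u) fun u hu => by
            have hle : (k : ℝ) / T ≤ ((k + 1 : ℕ) : ℝ) / T := by
              rw [← sub_nonneg, hd]; positivity
            have hu' := hsub k hk (uIoc_subset_uIcc hu)
            refine (hL _ (hm (k + 1) hk) u hu').trans ?_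
            rw [div_eq_mul_inv B]
            refine mul_le_mul_of_nonneg_left ?_ hB
            rw [uIoc_of_le hle] at hu
            rw [abs_of_nonneg (by linarith [hu.2]), ← hd]
            linarith [hu.1]
        rwa [hd, abs_of_nonneg (by positivity)] at this
    _ = B / T := by
        rw [Finset.sum_const, Finset.card_range, nsmul_eq_mul]; field_simp

end Riemann

/-! ### Regularity of the spectral densities and the mean of $\tilde c_T(r)$ -/

section Spectrum

variable {Ω : Type*} [MeasurableSpace Ω] {μ : Measure Ω} {ε : ℤ → Ω → ℝ} {X : ℕ → ℕ → Ω → ℝ}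
  {ψT : ℕ → ℕ → ℕ → ℝ} {ψ : ℕ → ℝ → ℝ} {ℓ : ℕ → ℝ}

lemma transfer_neg (u ω : ℝ) : transfer ψ u (-ω) = (starRingEnd ℂ) (transfer ψ u ω) := by
  rw [transfer, transfer, map_mul, Complex.conj_ofReal, Complex.conj_tsum]
  congr 1
  refine tsum_congr fun j => ?_
  rw [map_mul, Complex.conj_ofReal, ← Complex.exp_conj]
  congr 2
  simp

lemma localSpec_eq (u ω : ℝ) : localSpec ψ u ω = ‖transfer ψ u ω‖ ^ 2 := by
  rw [localSpec, transfer, norm_mul, Complex.norm_real, mul_pow, Real.norm_eq_abs, sq_abs, inv_pow,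
    Real.sq_sqrt (by positivity)]

lemma spec2_eq_localSpec (u ω : ℝ) : spec2 ψ u ω = (localSpec ψ u ω : ℂ) := by
  rw [spec2, transfer_neg, Complex.mul_conj, localSpec_eq, Complex.normSq_eq_norm_sq]

lemma norm_exp_sub_exp_le (x y : ℝ) :
    ‖Complex.exp (Complex.I * (x : ℂ)) - Complex.exp (Complex.I * (y : ℂ))‖ ≤ |x - y| := by
  have : Complex.exp (Complex.I * (x : ℂ)) - Complex.exp (Complex.I * (y : ℂ)) =
      Complex.exp (Complex.I * (y : ℂ)) * (Complex.exp (Complex.I * ((x - y : ℝ) : ℂ)) - 1) := by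
    rw [mul_sub, ← Complex.exp_add]; push_cast; ring_nf
  rw [this, norm_mul, norm_exp_I_mul, one_mul]
  exact Real.norm_exp_I_mul_ofReal_sub_one_le

namespace LocallyStationary

variable (H : LocallyStationary μ ε X ψT ψ ℓ)

include H

lemma exists_localSpec_bounds : ∃ C : ℝ, 1 ≤ C ∧
    (∀ u ∈ Icc (0 : ℝ) 1, ∀ ω, |localSpec ψ u ω| ≤ C) ∧
    (∀ u ∈ Icc (0 : ℝ) 1, ∀ v ∈ Icc (0 : ℝ) 1, ∀ ω,
      |localSpec ψ u ω - localSpec ψ v ω| ≤ C * |u - v|) ∧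
    (∀ u ∈ Icc (0 : ℝ) 1, ∀ ω ω', |localSpec ψ u ω - localSpec ψ u ω'| ≤ C * |ω - ω'|) := by
  obtain ⟨C, hC, h1, h2, h3, -⟩ := H.exists_transfer_bounds
  have key : ∀ {a b : ℂ} {d : ℝ}, ‖a‖ ≤ C → ‖b‖ ≤ C → ‖a - b‖ ≤ C * d →
      |‖a‖ ^ 2 - ‖b‖ ^ 2| ≤ 2 * C ^ 2 * d := fun {a b d} ha hb hab => by
    rw [show ‖a‖ ^ 2 - ‖b‖ ^ 2 = (‖a‖ + ‖b‖) * (‖a‖ - ‖b‖) by ring, abs_mul,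
      abs_of_nonneg (by positivity : 0 ≤ ‖a‖ + ‖b‖)]
    have := mul_le_mul (add_le_add ha hb) ((abs_norm_sub_norm_le a b).trans hab)
      (abs_nonneg _) (by positivity)
    linarith
  refine ⟨2 * C ^ 2, by nlinarith, ?_, ?_, ?_⟩
  · intro u hu ω
    rw [localSpec_eq, abs_of_nonneg (by positivity)]
    nlinarith [h1 u hu ω, norm_nonneg (transfer ψ u ω)]
  · intro u hu v hv ω
    rw [localSpec_eq, localSpec_eq]
    exact key (h1 u hu ω) (h1 v hv ω) (h2 u hu v hv ω)
  · intro u hu ω ω'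
    rw [localSpec_eq, localSpec_eq]
    refine key (h1 u hu ω) (h1 u hu ω') ((h3 u hu ω ω').trans ?_)
    gcongr
    exact norm_exp_sub_exp_le ω ω'

lemma continuousOn_localSpec (ω : ℝ) : ContinuousOn (fun u => localSpec ψ u ω) (Icc 0 1) := by
  obtain ⟨C, hC, -, h2, -⟩ := H.exists_localSpec_bounds
  exact (LipschitzOnWith.of_dist_le_mul (K := C.toNNReal) fun x hx y hy => by
      rw [Real.dist_eq, Real.dist_eq, Real.coe_toNNReal _ (by linarith)]
      exact h2 x hx y hy ω).continuousOn

/-- The Fourier coefficients in rescaled time of the local spectral density. -/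
def _root_.LocStat.specCoef (ψ : ℕ → ℝ → ℝ) (r : ℤ) (ω : ℝ) : ℂ :=
  ∫ u in (0 : ℝ)..1,
    (localSpec ψ u ω : ℂ) * Complex.exp (-2 * Complex.I * Real.pi * (r : ℂ) * (u : ℂ))

omit H in
lemma _root_.LocStat.norm_exp_specCoef (r : ℤ) (u : ℝ) :
    ‖Complex.exp (-2 * Complex.I * Real.pi * (r : ℂ) * (u : ℂ))‖ = 1 := by
  rw [show -2 * Complex.I * Real.pi * (r : ℂ) * (u : ℂ) =
    Complex.I * ((-2 * Real.pi * r * u : ℝ) : ℂ) by push_cast; ring, norm_exp_I_mul]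

lemma continuousOn_specCoef_integrand (r : ℤ) (ω : ℝ) :
    ContinuousOn (fun u : ℝ => (localSpec ψ u ω : ℂ) *
      Complex.exp (-2 * Complex.I * Real.pi * (r : ℂ) * (u : ℂ))) (uIcc 0 1) := by
  rw [uIcc_of_le zero_le_one]
  exact (Complex.continuous_ofReal.comp_continuousOn (H.continuousOn_localSpec ω)).mul
    (by fun_prop)

omit [MeasurableSpace Ω] H in
lemma _root_.LocStat.specCoef_zero (ω : ℝ) : specCoef ψ 0 ω = (intSpec ψ ω : ℂ) := by
  rw [specCoef, intSpec, ← intervalIntegral.integral_ofReal]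
  simp

lemma exists_specCoef_bounds : ∃ C : ℝ, 1 ≤ C ∧ (∀ r ω, ‖specCoef ψ r ω‖ ≤ C) ∧
    (∀ r ω ω', ‖specCoef ψ r ω - specCoef ψ r ω'‖ ≤ C * |ω - ω'|) := by
  obtain ⟨C, hC, h1, -, h3⟩ := H.exists_localSpec_bounds
  have hmem : ∀ u ∈ uIoc (0 : ℝ) 1, u ∈ Icc (0 : ℝ) 1 := fun u hu => by
    rw [uIoc_of_le zero_le_one] at hu; exact ⟨hu.1.le, hu.2⟩
  refine ⟨C, hC, fun r ω => ?_, fun r ω ω' => ?_⟩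
  · have := intervalIntegral.norm_integral_le_of_norm_le_const (a := 0) (b := 1) (C := C)
      (f := fun u : ℝ => (localSpec ψ u ω : ℂ) *
        Complex.exp (-2 * Complex.I * Real.pi * (r : ℂ) * (u : ℂ))) fun u hu => by
        rw [norm_mul, norm_exp_specCoef, mul_one, Complex.norm_real]
        exact h1 u (hmem u hu) ω
    simpa [specCoef] using this
  · rw [specCoef, specCoef, ← intervalIntegral.integral_sub
      (H.continuousOn_specCoef_integrand r ω).intervalIntegrable
      (H.continuousOn_specCoef_integrand r ω').intervalIntegrable]
    have := intervalIntegral.norm_integral_le_of_norm_le_const (a := 0) (b := 1)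
      (C := C * |ω - ω'|) (f := fun u : ℝ => (localSpec ψ u ω : ℂ) *
        Complex.exp (-2 * Complex.I * Real.pi * (r : ℂ) * (u : ℂ)) - (localSpec ψ u ω' : ℂ) *
        Complex.exp (-2 * Complex.I * Real.pi * (r : ℂ) * (u : ℂ))) fun u hu => by
        rw [← sub_mul, norm_mul, norm_exp_specCoef, mul_one, ← Complex.ofReal_sub,
          Complex.norm_real]
        exact h3 u (hmem u hu) ω ω'
    simpa using this

lemma exists_intSpec_bounds : ∃ c C : ℝ, 0 < c ∧ 1 ≤ C ∧ (∀ ω, c ≤ intSpec ψ ω) ∧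
    (∀ ω, intSpec ψ ω ≤ C) ∧ ∀ ω ω', |intSpec ψ ω - intSpec ψ ω'| ≤ C * |ω - ω'| := by
  obtain ⟨c, hc, h0⟩ := H.spec_pos
  obtain ⟨C, hC, h1, h2⟩ := H.exists_specCoef_bounds
  refine ⟨c, C, hc, hC, h0, fun ω => ?_, fun ω ω' => ?_⟩
  · have := h1 0 ω
    rw [specCoef_zero, Complex.norm_real] at this
    exact (le_abs_self _).trans this
  · have := h2 0 ω ω'
    rwa [specCoef_zero, specCoef_zero, ← Complex.ofReal_sub, Complex.norm_real] at this

/-- $F_2(-r;\omega)$ is the right-endpoint Riemann sum of the integral. The constant depends on $r$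
through the Lipschitz constant $2\pi|r|$ of the exponential, but not on $\omega$. -/
lemma exists_F2_sub_specCoef (r : ℤ) : ∃ C : ℝ, 0 ≤ C ∧ ∀ T : ℕ, 1 ≤ T → ∀ ω : ℝ,
    ‖F2 ψ T (-r) ω - specCoef ψ r ω‖ ≤ C / T := by
  obtain ⟨C, hC, h1, h2, -⟩ := H.exists_localSpec_bounds
  refine ⟨C + C * (2 * Real.pi * |(r : ℝ)|), by positivity, fun T hT ω => ?_⟩
  have e : F2 ψ T (-r) ω = (T : ℂ)⁻¹ * ∑ t ∈ Finset.Icc 1 T,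
      (fun u : ℝ => (localSpec ψ u ω : ℂ) *
        Complex.exp (-2 * Complex.I * Real.pi * (r : ℂ) * (u : ℂ))) ((t : ℝ) / T) := by
    rw [F2]
    congr 1
    refine Finset.sum_congr rfl fun t _ => ?_
    have e1 : Complex.I * (t : ℂ) * (freq T (-r) : ℂ) =
        -2 * Complex.I * Real.pi * (r : ℂ) * (((t : ℝ) / (T : ℝ) : ℝ) : ℂ) := by
      rw [freq]; push_cast; ring
    rw [spec2_eq_localSpec, e1]
  suffices hmain : ∀ u ∈ Icc (0 : ℝ) 1, ∀ v ∈ Icc (0 : ℝ) 1,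
      ‖(localSpec ψ u ω : ℂ) * Complex.exp (-2 * Complex.I * Real.pi * (r : ℂ) * (u : ℂ)) -
        (localSpec ψ v ω : ℂ) * Complex.exp (-2 * Complex.I * Real.pi * (r : ℂ) * (v : ℂ))‖ ≤
      (C + C * (2 * Real.pi * |(r : ℝ)|)) * |u - v| by
    rw [e, specCoef]
    exact norm_riemann_sub_le hmain hT
  intro u hu v hv
  rw [show ∀ a b x y : ℂ, a * x - b * y = (a - b) * x + b * (x - y) by intros; ring]
  refine (norm_add_le _ _).trans ?_
  rw [norm_mul, norm_mul, norm_exp_specCoef, mul_one, ← Complex.ofReal_sub, Complex.norm_real,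
    Complex.norm_real, add_mul]
  have e2 : ∀ u : ℝ, -2 * Complex.I * Real.pi * (r : ℂ) * (u : ℂ) =
    Complex.I * ((-2 * Real.pi * r * u : ℝ) : ℂ) := fun u => by push_cast; ring
  have h5 : ‖Complex.exp (-2 * Complex.I * Real.pi * (r : ℂ) * (u : ℂ)) -
      Complex.exp (-2 * Complex.I * Real.pi * (r : ℂ) * (v : ℂ))‖ ≤
      2 * Real.pi * |(r : ℝ)| * |u - v| := by
    rw [e2, e2]
    refine (norm_exp_sub_exp_le _ _).trans (le_of_eq ?_)
    rw [← mul_sub, abs_mul, abs_mul, abs_mul, abs_neg, abs_two, abs_of_pos Real.pi_pos]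
  refine add_le_add (h2 u hu v hv ω) ?_
  rw [mul_assoc C]
  exact mul_le_mul (h1 v hv ω) h5 (norm_nonneg _) (by positivity)

/-- The weight `(f(ω) f(ω + δ))^{-1/2}`. -/
def _root_.LocStat.weight (ψ : ℕ → ℝ → ℝ) (δ ω : ℝ) : ℝ :=
  (Real.sqrt (intSpec ψ ω * intSpec ψ (ω + δ)))⁻¹

omit [MeasurableSpace Ω] H in
lemma _root_.LocStat.gWeight_eq (T : ℕ) (r k : ℤ) :
    gWeight ψ T r k = weight ψ (freq T r) (freq T k) := by
  rw [gWeight, weight, freq_add]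

/-- Uniformity in $\delta$ is essential because $\delta=\omega_r$ moves with $T$. The lower bound on
$f$ keeps the denominators in $a^{-1}-b^{-1}=(b^2-a^2)/(ab(a+b))$ away from zero. -/
lemma exists_weight_bounds : ∃ C : ℝ, 1 ≤ C ∧ (∀ δ ω, |weight ψ δ ω| ≤ C) ∧
    ∀ δ ω ω', |weight ψ δ ω - weight ψ δ ω'| ≤ C * |ω - ω'| := by
  obtain ⟨c, C, hc, hC, h0, h1, h2⟩ := H.exists_intSpec_bounds
  have hs : ∀ δ ω, c ≤ Real.sqrt (intSpec ψ ω * intSpec ψ (ω + δ)) := fun δ ω =>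
    Real.le_sqrt_of_sq_le (by
      have := mul_le_mul (h0 ω) (h0 (ω + δ)) hc.le (hc.le.trans (h0 ω))
      nlinarith)
  refine ⟨1 + c⁻¹ + C * C / c ^ 3, by
    have : 0 ≤ c⁻¹ := by positivity
    have : 0 ≤ C * C / c ^ 3 := by positivity
    linarith, fun δ ω => ?_, fun δ ω ω' => ?_⟩
  · rw [weight, abs_of_nonneg (by positivity)]
    have h3 := inv_anti₀ hc (hs δ ω)
    have : 0 ≤ C * C / c ^ 3 := by positivity
    linarith
  · have ha := hs δ ω
    have hb := hs δ ω'
    rw [weight, weight]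
    set a := Real.sqrt (intSpec ψ ω * intSpec ψ (ω + δ)) with hadef
    set b := Real.sqrt (intSpec ψ ω' * intSpec ψ (ω' + δ)) with hbdef
    have ha0 : 0 < a := hc.trans_le ha
    have hb0 : 0 < b := hc.trans_le hb
    have hpos : ∀ ω, 0 ≤ intSpec ψ ω := fun ω => hc.le.trans (h0 ω)
    have hab : |b ^ 2 - a ^ 2| ≤ 2 * (C * C * |ω - ω'|) := by
      rw [hadef, hbdef, Real.sq_sqrt (mul_nonneg (hpos _) (hpos _)),
        Real.sq_sqrt (mul_nonneg (hpos _) (hpos _)),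
        show intSpec ψ ω' * intSpec ψ (ω' + δ) - intSpec ψ ω * intSpec ψ (ω + δ) =
          intSpec ψ ω' * (intSpec ψ (ω' + δ) - intSpec ψ (ω + δ)) +
          intSpec ψ (ω + δ) * (intSpec ψ ω' - intSpec ψ ω) by ring]
      refine (abs_add_le _ _).trans ?_
      rw [abs_mul, abs_mul, abs_of_nonneg (hpos _), abs_of_nonneg (hpos _)]
      have t1 := mul_le_mul (h1 ω') (h2 (ω' + δ) (ω + δ)) (abs_nonneg _) (by positivity)
      have t2 := mul_le_mul (h1 (ω + δ)) (h2 ω' ω) (abs_nonneg _) (by positivity)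
      rw [add_sub_add_right_eq_sub] at t1
      rw [abs_sub_comm ω' ω] at t1 t2
      linarith
    have e : a⁻¹ - b⁻¹ = (b ^ 2 - a ^ 2) / (a * b * (a + b)) := by
      field_simp; ring
    rw [e, abs_div, abs_of_pos (by positivity : 0 < a * b * (a + b)), div_le_iff₀ (by positivity)]
    have h3 : 2 * c ^ 3 ≤ a * b * (a + b) := by
      have t1 : c * c ≤ a * b := mul_le_mul ha hb hc.le ha0.le
      have t2 : c + c ≤ a + b := add_le_add ha hb
      have := mul_le_mul t1 t2 (by positivity) (by positivity)
      linarith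
    have h4 : 0 ≤ |ω - ω'| := abs_nonneg _
    calc |b ^ 2 - a ^ 2| ≤ 2 * (C * C * |ω - ω'|) := hab
      _ = C * C / c ^ 3 * |ω - ω'| * (2 * c ^ 3) := by field_simp
      _ ≤ C * C / c ^ 3 * |ω - ω'| * (a * b * (a + b)) := by gcongr
      _ ≤ (1 + c⁻¹ + C * C / c ^ 3) * |ω - ω'| * (a * b * (a + b)) := by
          gcongr
          have : 0 ≤ c⁻¹ := by positivity
          linarith

end LocallyStationary

omit [MeasurableSpace Ω] in
-- The observations are real. This removes all conjugates, so the bilinear moment formulas apply to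
-- periodograms and to $\tilde c_T(r)$ alike.
lemma dft_neg_freq (T : ℕ) (n : ℤ) (w : Ω) :
    dft X T (freq T (-n)) w = (starRingEnd ℂ) (dft X T (freq T n) w) := by
  rw [dft, dft, map_mul, Complex.conj_ofReal, map_sum, freq_neg]
  congr 1
  refine Finset.sum_congr rfl fun t _ => ?_
  rw [map_mul, Complex.conj_ofReal, ← Complex.exp_conj]
  congr 2
  simp

omit [MeasurableSpace Ω] in
lemma covTilde_eq (T : ℕ) (r : ℤ) (w : Ω) : covTilde X ψ T r w =
    (T : ℂ)⁻¹ * ∑ k ∈ Finset.Icc (1 : ℤ) T, (gWeight ψ T r k : ℂ) *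
      (dft X T (freq T k) w * dft X T (freq T (-(k + r))) w) := by
  rw [covTilde]
  congr 1
  refine Finset.sum_congr rfl fun k _ => ?_
  rw [dft_neg_freq, gWeight, div_eq_mul_inv, Complex.ofReal_inv, mul_comm]

lemma sum_Icc_int_eq_nat (T : ℕ) (φ : ℤ → ℂ) :
    ∑ s ∈ Finset.Icc (1 : ℤ) T, φ s = ∑ t ∈ Finset.Icc 1 T, φ (t : ℤ) := by
  refine Finset.sum_nbij' (fun k => k.toNat) (fun k => (k : ℤ)) ?_ ?_ ?_ ?_ ?_
  · intro k hk; rw [Finset.mem_Icc] at *; omega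
  · intro k hk; rw [Finset.mem_Icc] at *; omega
  · intro k hk; rw [Finset.mem_Icc] at hk; omega
  · intro k hk; simp
  · intro k hk; rw [Finset.mem_Icc] at hk; rw [Int.toNat_of_nonneg (by omega)]

namespace LocallyStationary

variable [IsProbabilityMeasure μ] (H : LocallyStationary μ ε X ψT ψ ℓ)

include H

lemma memLp_dft_mul (T : ℕ) (x y : ℝ) :
    MemLp (fun w => dft X T x w * dft X T y w) 2 μ :=
  memLp_mul_four (H.memLp_dft T x) (H.memLp_dft T y)

lemma memLp_covTilde (T : ℕ) (r : ℤ) : MemLp (covTilde X ψ T r) 2 μ := by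
  rw [show covTilde X ψ T r = fun w => (T : ℂ)⁻¹ * ∑ k ∈ Finset.Icc (1 : ℤ) T,
    (gWeight ψ T r k : ℂ) * (dft X T (freq T k) w * dft X T (freq T (-(k + r))) w) from
    funext (covTilde_eq T r)]
  exact (memLp_finsetSum _ fun k _ => (H.memLp_dft_mul T _ _).const_mul _).const_mul _

lemma integral_covTilde (T : ℕ) (r : ℤ) : ∫ w, covTilde X ψ T r w ∂μ =
    (T : ℂ)⁻¹ * ∑ k ∈ Finset.Icc (1 : ℤ) T,
      (gWeight ψ T r k : ℂ) * momTwo μ X T k (-(k + r)) := by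
  simp_rw [covTilde_eq]
  rw [integral_const_mul, integral_finsetSum _ fun k _ =>
    (((H.memLp_dft_mul T _ _).integrable (by norm_num)).const_mul _)]
  simp_rw [integral_const_mul]
  rfl

omit [MeasurableSpace Ω] [IsProbabilityMeasure μ] H in
lemma _root_.LocStat.meanLimit_eq_integral (T : ℕ) (r : ℤ) : meanLimit ψ T r =
    ∫ x in (0 : ℝ)..1, (weight ψ (freq T r) (2 * Real.pi * x) : ℂ) *
      specCoef ψ r (2 * Real.pi * x) := by
  have h := intervalIntegral.integral_comp_mul_left (a := 0) (b := 1)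
    (f := fun ω => (weight ψ (freq T r) ω : ℂ) * specCoef ψ r ω)
    (c := 2 * Real.pi) (by positivity)
  rw [h, meanLimit, mul_zero, mul_one, Complex.real_smul]
  push_cast [weight]
  rfl

/-- Each summand has frequency sum $-r$, so its mean is $F_2(-r;\omega_k)+O(1/T)$, that is, the
Fourier coefficient of $f(\cdot,\omega_k)$ up to $O(1/T)$. The remaining average over $k$ is a
Riemann sum of a function whose Lipschitz constant does not depend on $T$; the rate obtained is
$O(1/T)$. -/
lemma tendsto_integral_covTilde (r : ℤ) : Tendsto
    (fun T : ℕ => (∫ w, covTilde X ψ T r w ∂μ) - meanLimit ψ T r) atTop (𝓝 0) := by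
  obtain ⟨C₁, h₁, H₁⟩ := H.exists_momTwo_sub_F2
  obtain ⟨C₂, h₂, H₂⟩ := H.exists_F2_sub_specCoef r
  obtain ⟨C₃, h₃, H₃, H₃'⟩ := H.exists_weight_bounds
  obtain ⟨C₄, h₄, H₄, H₄'⟩ := H.exists_specCoef_bounds
  set B := C₃ * (C₁ + C₂) + 2 * C₃ * C₄ * (2 * Real.pi) with hB
  refine squeeze_zero_norm' (a := fun T : ℕ => B / T) ?_
    (tendsto_const_div_atTop_nhds_zero_nat B)
  filter_upwards [eventually_ge_atTop 1] with T hT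
  have hT0 : (0 : ℝ) < T := by exact_mod_cast hT
  set φ : ℝ → ℂ := fun x => (weight ψ (freq T r) (2 * Real.pi * x) : ℂ) *
      specCoef ψ r (2 * Real.pi * x) with hφ
  have hR := norm_riemann_sub_le (h := φ) (B := 2 * C₃ * C₄ * (2 * Real.pi))
    (fun u _ v _ => by
      simp only [hφ]
      rw [show ∀ a b x y : ℂ, a * x - b * y = (a - b) * x + b * (x - y) by intros; ring]
      refine (norm_add_le _ _).trans ?_
      rw [norm_mul, norm_mul, ← Complex.ofReal_sub, Complex.norm_real, Complex.norm_real]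
      have e : |2 * Real.pi * u - 2 * Real.pi * v| = 2 * Real.pi * |u - v| := by
        rw [← mul_sub, abs_mul, abs_of_pos (by positivity : 0 < 2 * Real.pi)]
      have t1 := mul_le_mul (H₃' (freq T r) (2 * Real.pi * u) (2 * Real.pi * v))
        (H₄ r (2 * Real.pi * u)) (norm_nonneg _) (by positivity)
      have t2 := mul_le_mul (H₃ (freq T r) (2 * Real.pi * v))
        (H₄' r (2 * Real.pi * u) (2 * Real.pi * v)) (norm_nonneg _) (by positivity)
      rw [e] at t1 t2
      simp only [Real.norm_eq_abs]
      linarith) hT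
  rw [← meanLimit_eq_integral] at hR
  have hf : ∀ t : ℕ, 2 * Real.pi * ((t : ℝ) / T) = freq T t := fun t => by
    rw [freq]; push_cast; ring
  have hS : ‖(∫ w, covTilde X ψ T r w ∂μ) - (T : ℂ)⁻¹ * ∑ t ∈ Finset.Icc 1 T, φ ((t : ℝ) / T)‖ ≤
      C₃ * (C₁ + C₂) / T := by
    rw [H.integral_covTilde, sum_Icc_int_eq_nat, ← mul_sub, ← Finset.sum_sub_distrib, norm_mul,
      norm_inv, Complex.norm_natCast, inv_mul_le_iff₀ hT0]
    refine (norm_sum_le _ _).trans ?_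
    calc _ ≤ ∑ t ∈ Finset.Icc 1 T, C₃ * (C₁ + C₂) / T := Finset.sum_le_sum fun t _ => by
          simp only [hφ, hf]
          rw [gWeight_eq, ← mul_sub, norm_mul, Complex.norm_real, mul_div_assoc]
          have a1 := H₁ T hT t (-((t : ℤ) + r))
          rw [show (t : ℤ) + (-((t : ℤ) + r)) = -r by ring] at a1
          have a2 := H₂ T hT (freq T t)
          refine mul_le_mul (H₃ _ _) ?_ (norm_nonneg _) (by positivity)
          rw [add_div]
          exact (norm_sub_le_norm_sub_add_norm_sub _ _ _).trans (add_le_add a1 a2)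
      _ = _ := by simp
  refine (norm_sub_le_norm_sub_add_norm_sub _ _ _).trans ((add_le_add hS hR).trans (le_of_eq ?_))
  rw [← add_div]

end LocallyStationary

end Spectrum

end LocStat

end

noncomputable section

namespace LocStat

/-! ### Riemann sums of the kernel -/

section Kernel

variable {K : ℝ → ℝ}

lemma IsKernel.exists_bound (hK : IsKernel K) : ∃ M : ℝ, 0 ≤ M ∧ ∀ x, K x ≤ M := by
  obtain ⟨M, hM⟩ := isCompact_Icc.exists_bound_of_continuousOn hK.continuousOn
  refine ⟨max M 0, le_max_right _ _, fun x => ?_⟩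
  by_cases hx : x ∈ Icc (-(1 / 2) : ℝ) (1 / 2)
  · exact ((le_abs_self _).trans (hM x hx)).trans (le_max_left _ _)
  · rw [hK.support x hx]; exact le_max_right _ _

lemma IsKernel.integrable (hK : IsKernel K) : Integrable K := by
  have h : IntegrableOn K (Icc (-(1 / 2) : ℝ) (1 / 2)) := hK.continuousOn.integrableOn_Icc
  exact h.integrable_of_forall_notMem_eq_zero hK.support

lemma IsKernel.integral_eq_one (hK : IsKernel K) {a b : ℝ} (ha : a < -(1 / 2)) (hb : 1 / 2 ≤ b) :
    ∫ x in a..b, K x = 1 := by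
  have hsupp : Function.support K ⊆ Icc (-(1 / 2) : ℝ) (1 / 2) := fun x hx => by
    by_contra h; exact hx (hK.support x h)
  have e : ∀ {a b : ℝ}, a < -(1 / 2) → 1 / 2 ≤ b → ∫ x in a..b, K x = ∫ x, K x :=
    fun {a b} ha hb => intervalIntegral.integral_eq_integral_of_support_subset
      (hsupp.trans fun x hx => ⟨ha.trans_le hx.1, hx.2.trans hb⟩)
  rw [e ha hb, ← e (a := -1) (b := 1) (by norm_num) (by norm_num), hK.integral_one]

/-- The increments of a kernel are dominated by those of a bounded monotone function. -/
lemma IsKernel.exists_monotone (hK : IsKernel K) : ∃ G : ℝ → ℝ, ∃ B : ℝ, Monotone G ∧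
    (∀ x y, G y - G x ≤ B) ∧ ∀ x y, x ≤ y → |K y - K x| ≤ G y - G x := by
  obtain ⟨M, hM0, hM⟩ := hK.exists_bound
  -- Jordan decomposition $K=p-q$ on the support; the increments of $p+q$ dominate those of $K$
  -- there.
  obtain ⟨p, q, hp, hq, hpq⟩ :=
    hK.boundedVariation.locallyBoundedVariationOn.exists_monotoneOn_sub_monotoneOn
  set I := Icc (-(1 / 2) : ℝ) (1 / 2) with hI
  have hl : (-(1 / 2) : ℝ) ∈ I := by simp [hI]
  have hr : (1 / 2 : ℝ) ∈ I := by simp [hI]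
  set g : ℝ → ℝ := fun x => p x + q x with hg
  have hgm : MonotoneOn g I := hp.add hq
  have hgK : ∀ x ∈ I, ∀ y ∈ I, x ≤ y → |K y - K x| ≤ g y - g x := fun x hx y hy hxy => by
    have e : ∀ z, K z = p z - q z := fun z => congrFun hpq z
    rw [e, e, abs_le]
    have h1 := hp hx hy hxy
    have h2 := hq hx hy hxy
    simp only [hg]
    constructor <;> linarith
  -- $K$ may jump at $\pm\frac12$, by at most $M$; adding jumps of size $M$ to $G$ there extends the
  -- domination to the whole line.
  set G : ℝ → ℝ := fun x => if x < -(1 / 2) then g (-(1 / 2)) - M else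
    if x ≤ 1 / 2 then g x else g (1 / 2) + M with hG
  have G1 : ∀ x, x < -(1 / 2) → G x = g (-(1 / 2)) - M := fun x hx => if_pos hx
  have G2 : ∀ x ∈ I, G x = g x := fun x hx => by
    simp only [hG]; rw [if_neg (not_lt.2 hx.1), if_pos hx.2]
  have G3 : ∀ x, 1 / 2 < x → G x = g (1 / 2) + M := fun x hx => by
    simp only [hG]; rw [if_neg (by linarith), if_neg (by linarith)]
  have K1 : ∀ x, x < -(1 / 2) → K x = 0 := fun x hx =>
    hK.support x fun h => by linarith [h.1]
  have K3 : ∀ x, 1 / 2 < x → K x = 0 := fun x hx => hK.support x fun h => by linarith [h.2]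
  have cases : ∀ x, x < -(1 / 2) ∨ x ∈ I ∨ 1 / 2 < x := fun x => by
    rcases lt_or_ge x (-(1 / 2)) with h | h
    · exact Or.inl h
    · rcases le_or_gt x (1 / 2) with h' | h'
      · exact Or.inr (Or.inl ⟨h, h'⟩)
      · exact Or.inr (Or.inr h')
  have hglr := hgm hl hr (by norm_num)
  have habs : ∀ x y, x ≤ y → |K y - K x| ≤ G y - G x := by
    intro x y hxy
    rcases cases x with hx | hx | hx <;> rcases cases y with hy | hy | hy
    · rw [G1 x hx, G1 y hy, K1 x hx, K1 y hy]; simp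
    · rw [G1 x hx, G2 y hy, K1 x hx, sub_zero, abs_of_nonneg (hK.nonneg y)]
      linarith [hM y, hgm hl hy hy.1]
    · rw [G1 x hx, G3 y hy, K1 x hx, K3 y hy, sub_zero, abs_zero]; linarith
    · linarith [hx.1]
    · rw [G2 x hx, G2 y hy]; exact hgK x hx y hy hxy
    · rw [G2 x hx, G3 y hy, K3 y hy, zero_sub, abs_neg, abs_of_nonneg (hK.nonneg x)]
      linarith [hM x, hgm hx hr hx.2]
    · linarith
    · linarith [hy.2]
    · rw [G3 x hx, G3 y hy, K3 x hx, K3 y hy]; simp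
  refine ⟨G, g (1 / 2) - g (-(1 / 2)) + 2 * M,
    fun x y hxy => by linarith [habs x y hxy, abs_nonneg (K y - K x)], fun x y => ?_, habs⟩
  have hb : ∀ x, g (-(1 / 2)) - M ≤ G x ∧ G x ≤ g (1 / 2) + M := fun x => by
    rcases cases x with hx | hx | hx
    · rw [G1 x hx]; constructor <;> linarith
    · rw [G2 x hx]; constructor <;> linarith [hgm hl hx hx.1, hgm hx hr hx.2]
    · rw [G3 x hx]; constructor <;> linarith
  linarith [(hb x).1, (hb y).2]

/-- On each cell the error is at most $h$ times the increment of the dominating monotone function,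
and these increments telescope to a bounded total. The rate is that of a Lipschitz kernel, despite
the possible jumps. -/
lemma IsKernel.exists_riemann (hK : IsKernel K) : ∃ B : ℝ, 0 ≤ B ∧ ∀ (h y : ℝ) (N : ℕ), 0 < h →
    y < -(1 / 2) → 1 / 2 ≤ y + N * h →
    |∑ i ∈ Finset.range N, h * K (y + i * h) - 1| ≤ B * h := by
  obtain ⟨G, B, hGm, hGB, hG⟩ := hK.exists_monotone
  refine ⟨B, by simpa using hGB 0 0, fun h y N hh hy hN => ?_⟩
  have hii : ∀ a b : ℝ, IntervalIntegrable K volume a b := fun a b =>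
    hK.integrable.intervalIntegrable
  have hsplit := intervalIntegral.sum_integral_adjacent_intervals (f := K) (μ := volume)
    (a := fun k : ℕ => y + k * h) (n := N) fun k _ => hii _ _
  simp only [Nat.cast_zero, zero_mul, add_zero] at hsplit
  rw [← hK.integral_eq_one hy hN, ← hsplit, ← Finset.sum_sub_distrib]
  refine (Finset.abs_sum_le_sum_abs _ _).trans ?_
  have hstep : ∀ i : ℕ, y + ((i + 1 : ℕ) : ℝ) * h - (y + i * h) = h := fun i => by
    push_cast; ring
  calc _ ≤ ∑ i ∈ Finset.range N, (G (y + ((i + 1 : ℕ) : ℝ) * h) - G (y + i * h)) * h :=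
        Finset.sum_le_sum fun i _ => by
          have hle : y + i * h ≤ y + ((i + 1 : ℕ) : ℝ) * h := by linarith [hstep i]
          have e : h * K (y + i * h) =
              ∫ _x in (y + i * h)..(y + ((i + 1 : ℕ) : ℝ) * h), K (y + i * h) := by
            rw [intervalIntegral.integral_const, hstep, smul_eq_mul]
          rw [e, ← intervalIntegral.integral_sub intervalIntegrable_const (hii _ _)]
          have := intervalIntegral.norm_integral_le_of_norm_le_const (a := y + i * h)
            (b := y + ((i + 1 : ℕ) : ℝ) * h)
            (C := G (y + ((i + 1 : ℕ) : ℝ) * h) - G (y + i * h))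
            (f := fun x => K (y + i * h) - K x) fun x hx => by
              rw [uIoc_of_le hle] at hx
              rw [Real.norm_eq_abs, abs_sub_comm]
              exact (hG _ _ hx.1.le).trans (sub_le_sub_right (hGm hx.2) _)
          rwa [hstep, abs_of_pos hh] at this
    _ = (G (y + N * h) - G y) * h := by
        rw [← Finset.sum_mul, Finset.sum_range_sub (fun i : ℕ => G (y + i * h))]
        simp
    _ ≤ B * h := mul_le_mul_of_nonneg_right (hGB _ _) hh.le

end Kernel

/-! ### The kernel spectral density estimator -/

section Estimator

variable {Ω : Type*} [MeasurableSpace Ω] {μ : Measure Ω} {ε : ℤ → Ω → ℝ} {X : ℕ → ℕ → Ω → ℝ}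
  {ψT : ℕ → ℕ → ℕ → ℝ} {ψ : ℕ → ℝ → ℝ} {ℓ : ℕ → ℝ} {K : ℝ → ℝ}

/-- The weight of the periodogram at `ω_j` in the spectral estimator at `ω`. -/
def kerWeight (K : ℝ → ℝ) (b : ℝ) (T : ℕ) (ω : ℝ) (j : ℤ) : ℝ :=
  2 * Real.pi / (b * (T : ℝ)) * K ((ω - freq T j) / b)

/-- The index of the first frequency of a window of width `b` around `ω`. -/
def winStart (b : ℝ) (T : ℕ) (ω : ℝ) : ℤ := ⌈(ω - b / 2) * T / (2 * Real.pi)⌉ - 1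

/-- The number of frequencies of a window of width `b`. -/
def winLength (b : ℝ) (T : ℕ) : ℕ := ⌈b * T / (2 * Real.pi)⌉₊ + 2

/-- Indices of the frequencies in a window of width `b` around `ω`. -/
def window (b : ℝ) (T : ℕ) (ω : ℝ) : Finset ℤ :=
  Finset.Ico (winStart b T ω) (winStart b T ω + winLength b T)

/-- After the reflection allowed by the symmetry of $K$, the kernel arguments form an increasing
arithmetic progression of step $2\pi/(bT)$, as `IsKernel.exists_riemann` requires. -/
lemma kernel_arg_eq {b : ℝ} {T : ℕ} (ω : ℝ) (n j : ℤ) :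
    -((ω - freq T j) / b) =
      (freq T n - ω) / b + ((j - n : ℤ) : ℝ) * (2 * Real.pi / (b * (T : ℝ))) := by
  rw [freq, freq]; push_cast
  ring

lemma winStart_lt {b : ℝ} {T : ℕ} (hb : 0 < b) (hT : 1 ≤ T) (ω : ℝ) :
    (freq T (winStart b T ω) - ω) / b < -(1 / 2) := by
  have hT0 : (0 : ℝ) < T := by exact_mod_cast hT
  have h1 : ((winStart b T ω : ℤ) : ℝ) < (ω - b / 2) * T / (2 * Real.pi) := by
    rw [winStart]; push_cast
    linarith [Int.ceil_lt_add_one ((ω - b / 2) * T / (2 * Real.pi))]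
  rw [lt_div_iff₀ (by positivity)] at h1
  have h2 : freq T (winStart b T ω) < ω - b / 2 := by
    rw [freq, div_lt_iff₀ hT0]; linarith
  rw [div_lt_iff₀ hb]; linarith

/-- With step $h$, the starting point lies at or above $-\frac12-h$, and the window has length at
least $1+2h$. The two extra indices in `winLength` pay for the index subtracted in `winStart` and
leave a strict inequality. -/
lemma le_winEnd {b : ℝ} {T : ℕ} (hb : 0 < b) (hT : 1 ≤ T) (ω : ℝ) :
    1 / 2 < (freq T (winStart b T ω) - ω) / b +
      winLength b T * (2 * Real.pi / (b * (T : ℝ))) := by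
  have hT0 : (0 : ℝ) < T := by exact_mod_cast hT
  set h := 2 * Real.pi / (b * (T : ℝ)) with hh
  have hpos : 0 < h := by positivity
  have h1 : (ω - b / 2) * T / (2 * Real.pi) - 1 ≤ ((winStart b T ω : ℤ) : ℝ) := by
    rw [winStart]; push_cast
    linarith [Int.le_ceil ((ω - b / 2) * T / (2 * Real.pi))]
  have h2 : b * T / (2 * Real.pi) + 2 ≤ winLength b T := by
    rw [winLength]; push_cast
    linarith [Nat.le_ceil (b * T / (2 * Real.pi))]
  have h3 : (freq T (winStart b T ω) - ω) / b = winStart b T ω * h - ω / b := by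
    rw [freq, hh]; field_simp
  have h4 : ((ω - b / 2) * T / (2 * Real.pi) - 1) * h = ω / b - 1 / 2 - h := by
    rw [hh]; field_simp
  have h5 : (b * T / (2 * Real.pi) + 2) * h = 1 + 2 * h := by
    rw [hh]; field_simp
  have h6 := mul_le_mul_of_nonneg_right h1 hpos.le
  have h7 := mul_le_mul_of_nonneg_right h2 hpos.le
  rw [h3]
  linarith

lemma kerWeight_eq_zero (hK : IsKernel K) {b : ℝ} {T : ℕ} (hb : 0 < b) (hT : 1 ≤ T) {ω : ℝ}
    {j : ℤ} (hj : j ∉ window b T ω) : kerWeight K b T ω j = 0 := by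
  have hT0 : (0 : ℝ) < T := by exact_mod_cast hT
  rw [kerWeight, ← hK.symm, kernel_arg_eq ω (winStart b T ω) j]
  have hs := winStart_lt hb hT ω
  have he := le_winEnd hb hT ω
  set h := 2 * Real.pi / (b * (T : ℝ)) with hh
  have hpos : 0 < h := by positivity
  rw [hK.support, mul_zero]
  rw [window, Finset.mem_Ico, not_and_or, not_le, not_lt] at hj
  rintro ⟨h1, h2⟩
  rcases hj with hj | hj
  · have : ((j - winStart b T ω : ℤ) : ℝ) ≤ 0 := by exact_mod_cast (by omega)
    nlinarith
  · have : (winLength b T : ℝ) ≤ ((j - winStart b T ω : ℤ) : ℝ) := by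
      exact_mod_cast (by omega : (winLength b T : ℤ) ≤ j - winStart b T ω)
    nlinarith

omit [MeasurableSpace Ω] in
lemma specEst_eq_sum (hK : IsKernel K) {b : ℝ} {T : ℕ} (hb : 0 < b) (hT : 1 ≤ T) (ω : ℝ)
    (w : Ω) : specEst X K b T ω w =
      ∑ j ∈ window b T ω, kerWeight K b T ω j * ‖dft X T (freq T j) w‖ ^ 2 := by
  rw [specEst]
  refine tsum_eq_sum fun j hj => ?_
  have := kerWeight_eq_zero hK hb hT hj
  rw [kerWeight] at this
  rw [this, zero_mul]

lemma sum_kerWeight_eq (hK : IsKernel K) (b : ℝ) (T : ℕ) (ω : ℝ) :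
    ∑ j ∈ window b T ω, kerWeight K b T ω j = ∑ i ∈ Finset.range (winLength b T),
      2 * Real.pi / (b * (T : ℝ)) * K ((freq T (winStart b T ω) - ω) / b +
        i * (2 * Real.pi / (b * (T : ℝ)))) := by
  refine Finset.sum_nbij' (fun k => (k - winStart b T ω).toNat) (fun i => winStart b T ω + i)
    ?_ ?_ ?_ ?_ ?_
  · intro k hk; rw [window, Finset.mem_Ico] at hk; rw [Finset.mem_range]; omega
  · intro k hk; rw [Finset.mem_range] at hk; rw [window, Finset.mem_Ico]; omega
  · intro k hk; rw [window, Finset.mem_Ico] at hk; omega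
  · intro k hk; simp
  · intro k hk
    rw [window, Finset.mem_Ico] at hk
    rw [kerWeight, ← hK.symm, kernel_arg_eq ω (winStart b T ω) k,
      ← Int.cast_natCast (k - winStart b T ω).toNat, Int.toNat_of_nonneg (by omega)]

lemma kerWeight_nonneg (hK : IsKernel K) {b : ℝ} (hb : 0 < b) (T : ℕ) (ω : ℝ) (j : ℤ) :
    0 ≤ kerWeight K b T ω j := mul_nonneg (by positivity) (hK.nonneg _)

lemma winLength_le {b : ℝ} {T : ℕ} (hb : 0 < b) (hT : 1 ≤ T) (hbT : 4 ≤ b * T) :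
    (winLength b T : ℝ) ≤ b * T := by
  have h1 := Nat.ceil_lt_add_one (a := b * T / (2 * Real.pi)) (by positivity)
  have h2 : b * T / (2 * Real.pi) ≤ b * T / 6 :=
    div_le_div_of_nonneg_left (by positivity) (by norm_num) (by linarith [Real.pi_gt_three])
  rw [winLength]; push_cast
  linarith

/-- There are at most $bT$ weights in the window, each $O(1/(bT))$. Their sum is a Riemann sum of
$K$ with mesh $2\pi/(bT)$, which gives the deviation from 1. -/
lemma IsKernel.exists_weight_bounds (hK : IsKernel K) : ∃ C : ℝ, 1 ≤ C ∧
    ∀ (b : ℝ) (T : ℕ) (ω : ℝ), 0 < b → 1 ≤ T → 4 ≤ b * T →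
      (∀ j, kerWeight K b T ω j ≤ C / (b * T)) ∧
      (∑ j ∈ window b T ω, kerWeight K b T ω j ≤ C) ∧
      |∑ j ∈ window b T ω, kerWeight K b T ω j - 1| ≤ C / (b * T) ∧
      ∀ j, kerWeight K b T ω j ≠ 0 → |freq T j - ω| ≤ b := by
  obtain ⟨M, hM0, hM⟩ := hK.exists_bound
  obtain ⟨B, hB0, hB⟩ := hK.exists_riemann
  refine ⟨1 + 2 * Real.pi * M + 2 * Real.pi * B, by
    have : 0 ≤ 2 * Real.pi * M := by positivity
    have : 0 ≤ 2 * Real.pi * B := by positivity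
    linarith, fun b T ω hb hT hbT => ?_⟩
  have hT0 : (0 : ℝ) < T := by exact_mod_cast hT
  have hp : 0 < b * T := by positivity
  have hpM : 0 ≤ 2 * Real.pi * M := by positivity
  have hpB : 0 ≤ 2 * Real.pi * B := by positivity
  have hw : ∀ j, kerWeight K b T ω j ≤ 2 * Real.pi * M / (b * T) := fun j => by
    rw [kerWeight, mul_div_right_comm (2 * Real.pi)]
    exact mul_le_mul_of_nonneg_left (hM _) (by positivity)
  refine ⟨fun j => (hw j).trans ?_, ?_, ?_, fun j hj => ?_⟩
  · gcongr; linarith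
  · calc _ ≤ ∑ j ∈ window b T ω, 2 * Real.pi * M / (b * T) := Finset.sum_le_sum fun j _ => hw j
      _ = winLength b T * (2 * Real.pi * M / (b * T)) := by
          rw [Finset.sum_const, window, Int.card_Ico, nsmul_eq_mul]; simp
      _ ≤ b * T * (2 * Real.pi * M / (b * T)) := by
          gcongr; exact winLength_le hb hT hbT
      _ = 2 * Real.pi * M := by field_simp
      _ ≤ _ := by linarith
  · rw [sum_kerWeight_eq hK]
    refine (hB _ _ _ (by positivity) (winStart_lt hb hT ω) (le_winEnd hb hT ω).le).trans ?_
    rw [← mul_div_assoc]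
    gcongr
    linarith
  · have hx : (ω - freq T j) / b ∈ Icc (-(1 / 2) : ℝ) (1 / 2) := by
      by_contra h
      exact hj (by rw [kerWeight, hK.support _ h, mul_zero])
    rw [mem_Icc, le_div_iff₀ hb, div_le_iff₀ hb] at hx
    rw [abs_le]
    constructor <;> linarith [hx.1, hx.2]

omit [MeasurableSpace Ω] in
lemma norm_dft_sq (T : ℕ) (j : ℤ) (w : Ω) : ((‖dft X T (freq T j) w‖ ^ 2 : ℝ) : ℂ) =
    dft X T (freq T j) w * dft X T (freq T (-j)) w := by
  rw [dft_neg_freq, Complex.mul_conj, Complex.normSq_eq_norm_sq]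

namespace LocallyStationary

variable [IsProbabilityMeasure μ] (H : LocallyStationary μ ε X ψT ψ ℓ)

include H

lemma memLp_norm_dft_sq (T : ℕ) (x : ℝ) : MemLp (fun w => ‖dft X T x w‖ ^ 2) 2 μ := by
  have := memLp_mul_four_real (H.memLp_dft T x).norm (H.memLp_dft T x).norm
  simpa only [pow_two] using this

lemma memLp_specEst (hK : IsKernel K) {b : ℝ} {T : ℕ} (hb : 0 < b) (hT : 1 ≤ T) (ω : ℝ) :
    MemLp (specEst X K b T ω) 2 μ := by
  rw [show specEst X K b T ω = fun w => ∑ j ∈ window b T ω, kerWeight K b T ω j *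
    ‖dft X T (freq T j) w‖ ^ 2 from funext (specEst_eq_sum hK hb hT ω)]
  exact memLp_finsetSum _ fun j _ => (H.memLp_norm_dft_sq T _).const_mul _

omit H [IsProbabilityMeasure μ] in
lemma _root_.LocStat.integral_norm_dft_sq (T : ℕ) (j : ℤ) :
    ((∫ w, ‖dft X T (freq T j) w‖ ^ 2 ∂μ : ℝ) : ℂ) = momTwo μ X T j (-j) := by
  rw [← integral_complex_ofReal, momTwo]
  simp_rw [norm_dft_sq]

omit [IsProbabilityMeasure μ] in
lemma exists_cumFour_bound : ∃ C : ℝ, 0 ≤ C ∧ ∀ T : ℕ, 1 ≤ T → ∀ m n p q : ℤ,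
    ‖cumFour ψT T m n p q‖ ≤ C / T := by
  obtain ⟨C₁, h₁, H₁⟩ := H.exists_cumFour_approx
  obtain ⟨C, hC, h1, -⟩ := H.exists_transfer_bounds
  refine ⟨C₁ + C * C * (C * C), by positivity, fun T hT m n p q => ?_⟩
  have hT0 : (0 : ℝ) < T := by exact_mod_cast hT
  have hT1 : (1 : ℝ) ≤ T := by exact_mod_cast hT
  have h2 : ‖(T : ℂ)⁻¹ * twisted T (m + n + p + q)
      (fun u => transfer ψ u (freq T m) * transfer ψ u (freq T n) *
        (transfer ψ u (freq T p) * transfer ψ u (freq T q)))‖ ≤ C * C * (C * C) / T := by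
    rw [norm_mul, norm_inv, Complex.norm_natCast, inv_mul_eq_div]
    gcongr
    refine norm_twisted_le hT _ fun u hu => ?_
    simp only [norm_mul]
    gcongr <;> exact h1 u hu _
  have h3 := H₁ T hT m n p q
  have h4 : C₁ / (T : ℝ) ^ 2 ≤ C₁ / T :=
    div_le_div_of_nonneg_left h₁ hT0 (le_self_pow₀ hT1 two_ne_zero)
  have h5 := norm_add_le (cumFour ψT T m n p q - (T : ℂ)⁻¹ * twisted T (m + n + p + q)
      (fun u => transfer ψ u (freq T m) * transfer ψ u (freq T n) *
        (transfer ψ u (freq T p) * transfer ψ u (freq T q)))) ((T : ℂ)⁻¹ *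
      twisted T (m + n + p + q) (fun u => transfer ψ u (freq T m) * transfer ψ u (freq T n) *
        (transfer ψ u (freq T p) * transfer ψ u (freq T q))))
  rw [sub_add_cancel] at h5
  rw [add_div]
  linarith

/-- Writing $|J_T(\omega_j)|^2=J_T(\omega_j)J_T(\omega_{-j})$, the pairing inside each periodogram
is the product of means and cancels. Each of the other two pairings is a product of two factors with
the same `decay`, hence the squares; the cumulant part is $O(1/T)$. -/
lemma exists_cov_periodogram : ∃ C : ℝ, 0 ≤ C ∧ ∀ T : ℕ, 1 ≤ T → ∀ j k : ℤ,
    |∫ w, ‖dft X T (freq T j) w‖ ^ 2 * ‖dft X T (freq T k) w‖ ^ 2 ∂μ -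
      (∫ w, ‖dft X T (freq T j) w‖ ^ 2 ∂μ) * ∫ w, ‖dft X T (freq T k) w‖ ^ 2 ∂μ| ≤
      C * (decay T (j + k) ^ 2 + decay T (-j + k) ^ 2 + 1 / T) := by
  obtain ⟨C₁, h₁, H₁⟩ := H.exists_momTwo_decay
  obtain ⟨C₂, h₂, H₂⟩ := H.exists_cumFour_bound
  set κ := |fourthCumulant μ (ε 0)| with hκ
  have hκ0 : 0 ≤ κ := abs_nonneg _
  refine ⟨C₁ ^ 2 + κ * C₂, by positivity, fun T hT j k => ?_⟩
  have hT0 : (0 : ℝ) < T := by exact_mod_cast hT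
  have e : (((∫ w, ‖dft X T (freq T j) w‖ ^ 2 * ‖dft X T (freq T k) w‖ ^ 2 ∂μ -
      (∫ w, ‖dft X T (freq T j) w‖ ^ 2 ∂μ) * ∫ w, ‖dft X T (freq T k) w‖ ^ 2 ∂μ : ℝ)) : ℂ) =
      momTwo μ X T j k * momTwo μ X T (-j) (-k) + momTwo μ X T j (-k) * momTwo μ X T (-j) k +
      (fourthCumulant μ (ε 0) : ℂ) * cumFour ψT T j (-j) k (-k) := by
    rw [Complex.ofReal_sub, Complex.ofReal_mul, integral_norm_dft_sq, integral_norm_dft_sq,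
      ← integral_complex_ofReal]
    simp_rw [Complex.ofReal_mul, norm_dft_sq]
    rw [H.integral_dft_four]; ring
  rw [← Real.norm_eq_abs, ← Complex.norm_real, e]
  have m1 := H₁ T hT j k
  have m2 := H₁ T hT (-j) (-k)
  have m3 := H₁ T hT j (-k)
  have m4 := H₁ T hT (-j) k
  rw [show -j + -k = -(j + k) by ring, decay_neg] at m2
  rw [show j + -k = -(-j + k) by ring, decay_neg] at m3
  have d1 := decay_nonneg hT (j + k)
  have d2 := decay_nonneg hT (-j + k)
  refine (norm_add_le _ _).trans ((add_le_add (norm_add_le _ _) le_rfl).trans ?_)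
  rw [norm_mul, norm_mul, norm_mul, Complex.norm_real, Real.norm_eq_abs, ← hκ]
  have t1 := mul_le_mul m1 m2 (norm_nonneg _) (by positivity)
  have t2 := mul_le_mul m3 m4 (norm_nonneg _) (by positivity)
  have t3 := mul_le_mul_of_nonneg_left (H₂ T hT j (-j) k (-k)) hκ0
  have s1 : 0 ≤ κ * C₂ * (decay T (j + k) ^ 2 + decay T (-j + k) ^ 2) := by positivity
  have s2 : 0 ≤ C₁ ^ 2 * (1 / T) := by positivity
  have s3 : κ * (C₂ / T) = κ * C₂ * (1 / T) := by ring
  rw [s3] at t3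
  linarith

lemma exists_bias_periodogram : ∃ C : ℝ, 0 ≤ C ∧ ∀ T : ℕ, 1 ≤ T → ∀ j : ℤ,
    |∫ w, ‖dft X T (freq T j) w‖ ^ 2 ∂μ - intSpec ψ (freq T j)| ≤ C / T := by
  obtain ⟨C₁, h₁, H₁⟩ := H.exists_momTwo_sub_F2
  obtain ⟨C₂, h₂, H₂⟩ := H.exists_F2_sub_specCoef 0
  refine ⟨C₁ + C₂, by positivity, fun T hT j => ?_⟩
  rw [← Real.norm_eq_abs, ← Complex.norm_real, Complex.ofReal_sub, integral_norm_dft_sq,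
    ← specCoef_zero, add_div]
  have a1 := H₁ T hT j (-j)
  have a2 := H₂ T hT (freq T j)
  rw [neg_zero] at a2
  rw [add_neg_cancel] at a1
  exact (norm_sub_le_norm_sub_add_norm_sub _ _ _).trans (add_le_add a1 a2)

/-- Three errors: the periodogram bias $O(1/T)$, the oscillation of $f$ over a window of width $b$,
and the deviation from 1 of the sum of the weights. -/
lemma exists_specEst_bias (hK : IsKernel K) : ∃ C : ℝ, 0 ≤ C ∧
    ∀ (b : ℝ) (T : ℕ) (ω : ℝ), 0 < b → b ≤ 1 → 1 ≤ T → 4 ≤ b * T →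
      |∫ w, specEst X K b T ω w ∂μ - intSpec ψ ω| ≤ C * (b + 1 / (b * T)) := by
  obtain ⟨C₁, h₁, H₁⟩ := hK.exists_weight_bounds
  obtain ⟨C₂, h₂, H₂⟩ := H.exists_bias_periodogram
  obtain ⟨c, C₃, hc, h₃, P₁, P₂, P₃⟩ := H.exists_intSpec_bounds
  refine ⟨C₁ * (C₂ + C₃), by positivity, fun b T ω hb hb1 hT hbT => ?_⟩
  have hT0 : (0 : ℝ) < T := by exact_mod_cast hT
  have hp : 0 < b * T := by positivity
  obtain ⟨-, W₂, W₃, W₄⟩ := H₁ b T ω hb hT hbT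
  have hTb : 1 / (T : ℝ) ≤ 1 / (b * T) :=
    one_div_le_one_div_of_le hp (by nlinarith)
  have em : ∫ w, specEst X K b T ω w ∂μ = ∑ j ∈ window b T ω, kerWeight K b T ω j *
      ∫ w, ‖dft X T (freq T j) w‖ ^ 2 ∂μ := by
    simp_rw [specEst_eq_sum hK hb hT ω]
    rw [integral_finsetSum _ fun j _ =>
      ((H.memLp_norm_dft_sq T _).integrable (by norm_num)).const_mul _]
    simp_rw [integral_const_mul]
  have e : ∫ w, specEst X K b T ω w ∂μ - intSpec ψ ω =
      ∑ j ∈ window b T ω, kerWeight K b T ω j *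
        (∫ w, ‖dft X T (freq T j) w‖ ^ 2 ∂μ - intSpec ψ ω) +
      (∑ j ∈ window b T ω, kerWeight K b T ω j - 1) * intSpec ψ ω := by
    rw [em]
    simp_rw [mul_sub, Finset.sum_sub_distrib, ← Finset.sum_mul]
    ring
  have hD : 0 ≤ C₂ / T + C₃ * b := by positivity
  have hterm : ∀ j, |kerWeight K b T ω j * (∫ w, ‖dft X T (freq T j) w‖ ^ 2 ∂μ -
      intSpec ψ ω)| ≤ kerWeight K b T ω j * (C₂ / T + C₃ * b) := fun j => by
    rw [abs_mul, abs_of_nonneg (kerWeight_nonneg hK hb T ω j)]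
    by_cases hj : kerWeight K b T ω j = 0
    · rw [hj, zero_mul, zero_mul]
    · refine mul_le_mul_of_nonneg_left ?_ (kerWeight_nonneg hK hb T ω j)
      have a1 := H₂ T hT j
      have a2 := (P₃ (freq T j) ω).trans
        (mul_le_mul_of_nonneg_left (W₄ j hj) (by linarith))
      exact (abs_sub_le _ _ _).trans (add_le_add a1 a2)
  rw [e]
  refine (abs_add_le _ _).trans ?_
  have t1 : |∑ j ∈ window b T ω, kerWeight K b T ω j *
        (∫ w, ‖dft X T (freq T j) w‖ ^ 2 ∂μ - intSpec ψ ω)| ≤ C₁ * (C₂ / T + C₃ * b) := by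
    refine (Finset.abs_sum_le_sum_abs _ _).trans
      ((Finset.sum_le_sum fun j _ => hterm j).trans ?_)
    rw [← Finset.sum_mul]
    exact mul_le_mul_of_nonneg_right W₂ hD
  have t2 : |(∑ j ∈ window b T ω, kerWeight K b T ω j - 1) * intSpec ψ ω| ≤
      C₁ / (b * T) * C₃ := by
    rw [abs_mul, abs_of_nonneg (hc.le.trans (P₁ ω))]
    exact mul_le_mul W₃ (P₂ ω) (hc.le.trans (P₁ ω)) (by positivity)
  have t3 : C₁ * (C₂ / T + C₃ * b) = C₁ * C₂ * (1 / T) + C₁ * C₃ * b := by ring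
  have t4 : C₁ / (b * T) * C₃ = C₁ * C₃ * (1 / (b * T)) := by ring
  rw [t3] at t1
  rw [t4] at t2
  have t5 := mul_le_mul_of_nonneg_left hTb (by positivity : 0 ≤ C₁ * C₂)
  have t6 : 0 ≤ C₁ * C₂ * b := by positivity
  linarith

/-- For fixed $j$, one weight is bounded by $C/(bT)$ while the squares of `decay` over the window
sum to at most 8, the window being contained in one period. The outer weights sum to $O(1)$. -/
lemma exists_specEst_variance (hK : IsKernel K) : ∃ C : ℝ, 0 ≤ C ∧
    ∀ (b : ℝ) (T : ℕ) (ω : ℝ), 0 < b → b ≤ 1 → 1 ≤ T → 4 ≤ b * T →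
      ∫ w, specEst X K b T ω w ^ 2 ∂μ - (∫ w, specEst X K b T ω w ∂μ) ^ 2 ≤ C * (1 / (b * T)) := by
  obtain ⟨C₁, h₁, H₁⟩ := hK.exists_weight_bounds
  obtain ⟨C₂, h₂, H₂⟩ := H.exists_cov_periodogram
  -- $17=8+8+1$: two sums of squared `decay` and the $1/T$ term.
  refine ⟨C₁ ^ 2 * C₂ * 17, by positivity, fun b T ω hb hb1 hT hbT => ?_⟩
  have hT0 : (0 : ℝ) < T := by exact_mod_cast hT
  have hp : 0 < b * T := by positivity
  obtain ⟨W₁, W₂, -, -⟩ := H₁ b T ω hb hT hbT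
  have W0 := kerWeight_nonneg hK hb T ω
  have hTb : 1 / (T : ℝ) ≤ 1 / (b * T) :=
    one_div_le_one_div_of_le hp (by nlinarith)
  set I : ℤ → Ω → ℝ := fun j w => ‖dft X T (freq T j) w‖ ^ 2 with hI
  have hIm : ∀ j, MemLp (I j) 2 μ := fun j => H.memLp_norm_dft_sq T _
  have hIi : ∀ j, Integrable (I j) μ := fun j => (hIm j).integrable (by norm_num)
  have hIj : ∀ j k, Integrable (fun w => I j w * I k w) μ := fun j k =>
    (hIm j).integrable_mul (hIm k)
  set κ := kerWeight K b T ω with hκ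
  set W := window b T ω with hW
  have e1 : ∫ w, specEst X K b T ω w ∂μ = ∑ j ∈ W, κ j * ∫ w, I j w ∂μ := by
    simp_rw [specEst_eq_sum hK hb hT ω]
    rw [integral_finsetSum _ fun j _ => (hIi j).const_mul _]
    simp_rw [integral_const_mul]
    rfl
  have e2 : ∫ w, specEst X K b T ω w ^ 2 ∂μ =
      ∑ j ∈ W, ∑ k ∈ W, κ j * κ k * ∫ w, I j w * I k w ∂μ := by
    have : ∀ w, specEst X K b T ω w ^ 2 = ∑ j ∈ W, ∑ k ∈ W, κ j * κ k * (I j w * I k w) := by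
      intro w
      rw [specEst_eq_sum hK hb hT ω, pow_two, Finset.sum_mul_sum]
      exact Finset.sum_congr rfl fun j _ => Finset.sum_congr rfl fun k _ => by
        simp only [hI, hκ]; ring
    simp_rw [this]
    rw [integral_finsetSum _ fun j _ => integrable_finsetSum _ fun k _ => (hIj j k).const_mul _]
    refine Finset.sum_congr rfl fun j _ => ?_
    rw [integral_finsetSum _ fun k _ => (hIj j k).const_mul _]
    simp_rw [integral_const_mul]
  have e3 : ∫ w, specEst X K b T ω w ^ 2 ∂μ - (∫ w, specEst X K b T ω w ∂μ) ^ 2 =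
      ∑ j ∈ W, κ j * ∑ k ∈ W, κ k *
        (∫ w, I j w * I k w ∂μ - (∫ w, I j w ∂μ) * ∫ w, I k w ∂μ) := by
    rw [e1, e2, pow_two, Finset.sum_mul_sum, ← Finset.sum_sub_distrib]
    refine Finset.sum_congr rfl fun j _ => ?_
    rw [← Finset.sum_sub_distrib, Finset.mul_sum]
    exact Finset.sum_congr rfl fun k _ => by ring
  have hlen : winLength b T ≤ T := by
    have : (winLength b T : ℝ) ≤ T := (winLength_le hb hT hbT).trans (by nlinarith)
    exact_mod_cast this
  have hWs : W ⊆ Finset.Ico (winStart b T ω) (winStart b T ω + T) :=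
    Finset.Ico_subset_Ico le_rfl (by omega)
  have hdec : ∀ c : ℤ, ∑ k ∈ W, decay T (c + k) ^ 2 ≤ 8 := fun c =>
    (Finset.sum_le_sum_of_subset_of_nonneg hWs fun k _ _ => sq_nonneg _).trans
      (sum_decay_sq_Ico hT _ c)
  have hin : ∀ j, ∑ k ∈ W, κ k *
      (∫ w, I j w * I k w ∂μ - (∫ w, I j w ∂μ) * ∫ w, I k w ∂μ) ≤ C₁ * C₂ * 17 * (1 / (b * T)) := by
    intro j
    calc _ ≤ ∑ k ∈ W, (C₁ / (b * T) * C₂ * (decay T (j + k) ^ 2 + decay T (-j + k) ^ 2) +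
          κ k * (C₂ * (1 / T))) := Finset.sum_le_sum fun k _ => by
          have a := mul_le_mul_of_nonneg_left ((le_abs_self _).trans (H₂ T hT j k)) (W0 k)
          have a2 := mul_le_mul_of_nonneg_right (W₁ k)
            (by positivity : 0 ≤ C₂ * (decay T (j + k) ^ 2 + decay T (-j + k) ^ 2))
          simp only [hI]
          linarith
      _ = C₁ / (b * T) * C₂ * (∑ k ∈ W, decay T (j + k) ^ 2 + ∑ k ∈ W, decay T (-j + k) ^ 2) +
          (∑ k ∈ W, κ k) * (C₂ * (1 / T)) := by
          rw [Finset.sum_add_distrib, ← Finset.mul_sum, ← Finset.sum_mul, Finset.sum_add_distrib]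
      _ ≤ C₁ / (b * T) * C₂ * (8 + 8) + C₁ * (C₂ * (1 / (b * T))) := by
          have := hdec j
          have := hdec (-j)
          gcongr
      _ = _ := by ring
  rw [e3]
  calc _ ≤ ∑ j ∈ W, κ j * (C₁ * C₂ * 17 * (1 / (b * T))) :=
        Finset.sum_le_sum fun j _ => mul_le_mul_of_nonneg_left (hin j) (W0 j)
    _ = (∑ j ∈ W, κ j) * (C₁ * C₂ * 17 * (1 / (b * T))) := by rw [Finset.sum_mul]
    _ ≤ C₁ * (C₁ * C₂ * 17 * (1 / (b * T))) := mul_le_mul_of_nonneg_right W₂ (by positivity)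
    _ = _ := by ring

lemma specEst_meanSquare (hK : IsKernel K) {b : ℕ → ℝ} (hb : Tendsto b atTop (𝓝 0))
    (hbT : Tendsto (fun T : ℕ => b T * (T : ℝ)) atTop atTop) :
    ∃ C : ℝ, ∀ᶠ T : ℕ in atTop, ∀ ω : ℝ, MemLp (specEst X K (b T) T ω) 2 μ ∧
      ∫ w, (specEst X K (b T) T ω w - intSpec ψ ω) ^ 2 ∂μ ≤
        C * (b T ^ 2 + 1 / (b T * (T : ℝ))) := by
  obtain ⟨C₁, h₁, H₁⟩ := H.exists_specEst_bias hK
  obtain ⟨C₂, h₂, H₂⟩ := H.exists_specEst_variance hK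
  refine ⟨C₂ + 2 * C₁ ^ 2, ?_⟩
  filter_upwards [eventually_ge_atTop 1, hbT.eventually_ge_atTop 4,
    hb.eventually_le_const zero_lt_one] with T hT hbT4 hb1 ω
  have hT0 : (0 : ℝ) < T := by exact_mod_cast hT
  -- Positivity of the bandwidth follows from $bT\ge4$.
  have hb0 : 0 < b T := by
    by_contra h
    nlinarith [not_lt.1 h]
  have hm := H.memLp_specEst (X := X) hK hb0 hT ω
  refine ⟨hm, ?_⟩
  have hi := hm.integrable (by norm_num)
  have hi2 := hm.integrable_sq
  have e : ∫ w, (specEst X K (b T) T ω w - intSpec ψ ω) ^ 2 ∂μ =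
      (∫ w, specEst X K (b T) T ω w ^ 2 ∂μ - (∫ w, specEst X K (b T) T ω w ∂μ) ^ 2) +
      (∫ w, specEst X K (b T) T ω w ∂μ - intSpec ψ ω) ^ 2 := by
    have : ∀ w, (specEst X K (b T) T ω w - intSpec ψ ω) ^ 2 =
        specEst X K (b T) T ω w ^ 2 - 2 * intSpec ψ ω * specEst X K (b T) T ω w +
          intSpec ψ ω ^ 2 := fun w => by ring
    simp_rw [this]
    rw [integral_add (f := fun w => specEst X K (b T) T ω w ^ 2 -
      2 * intSpec ψ ω * specEst X K (b T) T ω w) (hi2.sub (hi.const_mul _)) (integrable_const _),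
      integral_sub hi2 (hi.const_mul _), integral_const_mul, integral_const]
    simp
    ring
  have hbias := H₁ (b T) T ω hb0 hb1 hT hbT4
  have hvar := H₂ (b T) T ω hb0 hb1 hT hbT4
  rw [e]
  set x := 1 / (b T * (T : ℝ)) with hx
  have hx0 : 0 ≤ x := by positivity
  have hx1 : x ≤ 1 := by
    rw [hx, div_le_one (by positivity)]; linarith
  have hsq : (∫ w, specEst X K (b T) T ω w ∂μ - intSpec ψ ω) ^ 2 ≤ (C₁ * (b T + x)) ^ 2 :=
    sq_le_sq' (abs_le.1 hbias).1 (abs_le.1 hbias).2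
  -- Since $x=1/(bT)\le1$, the squared bias contribution $x^2$ is absorbed into $x$.
  have h3 : (b T + x) ^ 2 ≤ 2 * (b T ^ 2 + x) := by nlinarith [sq_nonneg (b T - x)]
  have h4 := mul_le_mul_of_nonneg_left h3 (sq_nonneg C₁)
  have h5 : 0 ≤ C₂ * b T ^ 2 := by positivity
  nlinarith

end LocallyStationary

end Estimator

end LocStat

end

noncomputable section

namespace LocStat

/-! ### Covariances of $\tilde c_T(r)$ and its conjugate -/

section Covariance

variable {Ω : Type*} [MeasurableSpace Ω] {μ : Measure Ω} {ε : ℤ → Ω → ℝ} {X : ℕ → ℕ → Ω → ℝ}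
  {ψT : ℕ → ℕ → ℕ → ℝ} {ψ : ℕ → ℝ → ℝ} {ℓ : ℕ → ℝ}

/-- `c̃_T(r)` for `s = 1` and its complex conjugate for `s = -1`. -/
def signedCov (X : ℕ → ℕ → Ω → ℝ) (ψ : ℕ → ℝ → ℝ) (T : ℕ) (s r : ℤ) (w : Ω) : ℂ :=
  (T : ℂ)⁻¹ * ∑ k ∈ Finset.Icc (1 : ℤ) T, (gWeight ψ T r k : ℂ) *
    (dft X T (freq T (s * k)) w * dft X T (freq T (-s * (k + r))) w)

/-- The two pairings in the covariance of two products of discrete Fourier transforms. -/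
def pairTerm (ψ : ℕ → ℝ → ℝ) (T : ℕ) (m n p q : ℤ) : ℂ :=
  F2 ψ T (m + p) (freq T m) * F2 ψ T (n + q) (freq T n) +
    F2 ψ T (m + q) (freq T m) * F2 ψ T (n + p) (freq T n)

/-- The common form of the three main terms. -/
def signedGamma (κ₄ : ℝ) (ψ : ℕ → ℝ → ℝ) (T : ℕ) (s₁ s₂ r₁ r₂ : ℤ) : ℂ :=
  (T : ℂ)⁻¹ * ∑ k₁ ∈ Finset.Icc (1 : ℤ) (T : ℤ), ∑ k₂ ∈ Finset.Icc (1 : ℤ) (T : ℤ),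
    (gWeight ψ T r₁ k₁ : ℂ) * (gWeight ψ T r₂ k₂ : ℂ) *
      pairTerm ψ T (s₁ * k₁) (-s₁ * (k₁ + r₁)) (s₂ * k₂) (-s₂ * (k₂ + r₂)) +
  2 * (Real.pi : ℂ) / (T : ℂ) ^ 2 *
    ∑ k₁ ∈ Finset.Icc (1 : ℤ) (T : ℤ), ∑ k₂ ∈ Finset.Icc (1 : ℤ) (T : ℤ),
      (gWeight ψ T r₁ k₁ : ℂ) * (gWeight ψ T r₂ k₂ : ℂ) *
        F4 κ₄ ψ T (s₁ * k₁ + -s₁ * (k₁ + r₁) + s₂ * k₂ + -s₂ * (k₂ + r₂))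
          (freq T (s₁ * k₁)) (freq T (-s₁ * (k₁ + r₁))) (freq T (-k₂))

/-- A complex covariance conjugates its second argument, whereas the signs in `signedGamma` describe
a bilinear product. Hence $\operatorname{cov}(\tilde c,\tilde c)$ has signs $(1,-1)$; likewise
$\Gamma^{(2)}$ has $(1,1)$ and $\Gamma^{(3)}$ has $(-1,1)$. -/
lemma Gamma1_eq (κ₄ : ℝ) (T : ℕ) (r₁ r₂ : ℤ) :
    Gamma1 κ₄ ψ T r₁ r₂ = signedGamma κ₄ ψ T 1 (-1) r₁ r₂ := by
  rw [Gamma1, signedGamma]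
  refine congrArg₂ (· + ·)
    (congrArg _ (Finset.sum_congr rfl fun k₁ _ => Finset.sum_congr rfl fun k₂ _ => ?_))
    (congrArg _ (Finset.sum_congr rfl fun k₁ _ => Finset.sum_congr rfl fun k₂ _ => ?_))
  · rw [pairTerm, show (1 : ℤ) * k₁ + -1 * k₂ = k₁ - k₂ by ring,
      show -1 * (k₁ + r₁) + -(-1) * (k₂ + r₂) = -k₁ - r₁ + k₂ + r₂ by ring,
      show (1 : ℤ) * k₁ + -(-1) * (k₂ + r₂) = k₁ + k₂ + r₂ by ring,
      show -1 * (k₁ + r₁) + -1 * k₂ = -k₁ - r₁ - k₂ by ring,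
      one_mul, neg_one_mul, freq_neg T (k₁ + r₁)]
  · rw [show (1 : ℤ) * k₁ + -1 * (k₁ + r₁) + -1 * k₂ + -(-1) * (k₂ + r₂) = r₂ - r₁ by ring,
      one_mul, neg_one_mul, freq_neg T (k₁ + r₁), freq_neg T k₂]

lemma Gamma2_eq (κ₄ : ℝ) (T : ℕ) (r₁ r₂ : ℤ) :
    Gamma2 κ₄ ψ T r₁ r₂ = signedGamma κ₄ ψ T 1 1 r₁ r₂ := by
  rw [Gamma2, signedGamma]
  refine congrArg₂ (· + ·)
    (congrArg _ (Finset.sum_congr rfl fun k₁ _ => Finset.sum_congr rfl fun k₂ _ => ?_))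
    (congrArg _ (Finset.sum_congr rfl fun k₁ _ => Finset.sum_congr rfl fun k₂ _ => ?_))
  · rw [pairTerm, show (1 : ℤ) * k₁ + 1 * k₂ = k₁ + k₂ by ring,
      show -1 * (k₁ + r₁) + -1 * (k₂ + r₂) = -k₁ - r₁ - k₂ - r₂ by ring,
      show (1 : ℤ) * k₁ + -1 * (k₂ + r₂) = k₁ - k₂ - r₂ by ring,
      show -1 * (k₁ + r₁) + 1 * k₂ = -k₁ - r₁ + k₂ by ring,
      one_mul, neg_one_mul, freq_neg T (k₁ + r₁)]
  · rw [show (1 : ℤ) * k₁ + -1 * (k₁ + r₁) + 1 * k₂ + -1 * (k₂ + r₂) = -r₂ - r₁ by ring,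
      one_mul, neg_one_mul, freq_neg T (k₁ + r₁), freq_neg T k₂]

lemma Gamma3_eq (κ₄ : ℝ) (T : ℕ) (r₁ r₂ : ℤ) :
    Gamma3 κ₄ ψ T r₁ r₂ = signedGamma κ₄ ψ T (-1) 1 r₁ r₂ := by
  rw [Gamma3, signedGamma]
  refine congrArg₂ (· + ·)
    (congrArg _ (Finset.sum_congr rfl fun k₁ _ => Finset.sum_congr rfl fun k₂ _ => ?_))
    (congrArg _ (Finset.sum_congr rfl fun k₁ _ => Finset.sum_congr rfl fun k₂ _ => ?_))
  · rw [pairTerm, show (-1 : ℤ) * k₁ + 1 * k₂ = -k₁ + k₂ by ring,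
      show -(-1) * (k₁ + r₁) + -1 * (k₂ + r₂) = k₁ + r₁ - k₂ - r₂ by ring,
      show (-1 : ℤ) * k₁ + -1 * (k₂ + r₂) = -k₁ - k₂ - r₂ by ring,
      show -(-1) * (k₁ + r₁) + 1 * k₂ = k₁ + r₁ + k₂ by ring,
      neg_one_mul, freq_neg T k₁, neg_neg, one_mul]
  · rw [show (-1 : ℤ) * k₁ + -(-1) * (k₁ + r₁) + 1 * k₂ + -1 * (k₂ + r₂) = r₁ - r₂ by ring,
      neg_one_mul, freq_neg T k₁, neg_neg, one_mul, freq_neg T k₂]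

omit [MeasurableSpace Ω] in
lemma signedCov_one (T : ℕ) (r : ℤ) (w : Ω) : signedCov X ψ T 1 r w = covTilde X ψ T r w := by
  rw [covTilde_eq, signedCov]
  simp only [one_mul, neg_mul]

omit [MeasurableSpace Ω] in
lemma signedCov_neg_one (T : ℕ) (r : ℤ) (w : Ω) :
    signedCov X ψ T (-1) r w = (starRingEnd ℂ) (covTilde X ψ T r w) := by
  rw [covTilde_eq, signedCov, map_mul, map_inv₀, Complex.conj_natCast, map_sum]
  congr 1
  refine Finset.sum_congr rfl fun k _ => ?_
  rw [map_mul, map_mul, Complex.conj_ofReal, ← dft_neg_freq, ← dft_neg_freq]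
  simp only [neg_neg, one_mul, neg_mul]

lemma F4_eq_twisted (κ₄ : ℝ) (T : ℕ) (s m n p : ℤ) :
    2 * (Real.pi : ℂ) / T * F4 κ₄ ψ T s (freq T m) (freq T n) (freq T p) =
      κ₄ * ((T : ℂ)⁻¹ * twisted T s (fun u => transfer ψ u (freq T m) * transfer ψ u (freq T n) *
        (transfer ψ u (freq T p) * transfer ψ u (freq T (-(m + n + p)))))) := by
  have hpi : (Real.pi : ℂ) ≠ 0 := by exact_mod_cast Real.pi_ne_zero
  have h : ∀ t : ℕ, 2 * (Real.pi : ℂ) * spec4 κ₄ ψ ((t : ℝ) / T) (freq T m) (freq T n) (freq T p) =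
      κ₄ * (transfer ψ ((t : ℝ) / T) (freq T m) * transfer ψ ((t : ℝ) / T) (freq T n) *
        (transfer ψ ((t : ℝ) / T) (freq T p) *
          transfer ψ ((t : ℝ) / T) (freq T (-(m + n + p))))) := fun t => by
    rw [spec4, freq_neg, freq_add, freq_add]
    push_cast
    field_simp
  have hF : 2 * (Real.pi : ℂ) * F4 κ₄ ψ T s (freq T m) (freq T n) (freq T p) =
      κ₄ * twisted T s (fun u => transfer ψ u (freq T m) * transfer ψ u (freq T n) *
        (transfer ψ u (freq T p) * transfer ψ u (freq T (-(m + n + p))))) := by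
    rw [F4, twisted, mul_left_comm, mul_left_comm (κ₄ : ℂ), Finset.mul_sum _ _ (2 * _),
      Finset.mul_sum _ _ (κ₄ : ℂ)]
    refine congrArg ((T : ℂ)⁻¹ * ·) (Finset.sum_congr rfl fun t _ => ?_)
    rw [← mul_assoc, h, mul_assoc]
  rw [div_mul_eq_mul_div, hF]
  ring

namespace LocallyStationary

variable (H : LocallyStationary μ ε X ψT ψ ℓ)

include H

lemma exists_transfer_freq_sub : ∃ C : ℝ, 1 ≤ C ∧ ∀ T : ℕ, 1 ≤ T → ∀ u ∈ Icc (0 : ℝ) 1,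
    ∀ (R : ℝ) (m n : ℤ), |((m - n : ℤ) : ℝ)| ≤ R →
      ‖transfer ψ u (freq T m) - transfer ψ u (freq T n)‖ ≤ C * R / T := by
  obtain ⟨C, hC, -, -, h3, -⟩ := H.exists_transfer_bounds
  refine ⟨C * (2 * Real.pi), by nlinarith [Real.pi_gt_three], fun T hT u hu R m n hR => ?_⟩
  have hT0 : (0 : ℝ) < T := by exact_mod_cast hT
  refine (h3 u hu _ _).trans ((mul_le_mul_of_nonneg_left (norm_exp_sub_exp_le _ _)
    (by positivity)).trans ?_)
  have e : freq T m - freq T n = 2 * Real.pi * ((m - n : ℤ) : ℝ) / T := by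
    rw [freq, freq]; push_cast; ring
  rw [e, abs_div, abs_mul, abs_of_pos (by positivity : 0 < 2 * Real.pi), abs_of_pos hT0,
    mul_div_assoc, mul_div_assoc, mul_assoc C]
  gcongr

/-- The frequencies in $F_4$ sum to zero, while the true ones $p,q$ are off by bounded shifts,
possibly after exchanging the last two, which the symmetric product permits. Each shift changes $A$
by $O(R/T)$, and the cumulant term already carries a factor $1/T$. -/
lemma exists_cumFour_sub_F4 (R : ℝ) (hR : 0 ≤ R) (κ₄ : ℝ) : ∃ C : ℝ, 0 ≤ C ∧
    ∀ T : ℕ, 1 ≤ T → ∀ m n p q p' q' : ℤ, m + n + p' + q' = 0 →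
      (|((p - p' : ℤ) : ℝ)| ≤ R ∧ |((q - q' : ℤ) : ℝ)| ≤ R ∨
        |((p - q' : ℤ) : ℝ)| ≤ R ∧ |((q - p' : ℤ) : ℝ)| ≤ R) →
      ‖κ₄ * cumFour ψT T m n p q - 2 * (Real.pi : ℂ) / T *
        F4 κ₄ ψ T (m + n + p + q) (freq T m) (freq T n) (freq T p')‖ ≤ C / T ^ 2 := by
  obtain ⟨C₁, h₁, H₁⟩ := H.exists_cumFour_approx
  obtain ⟨C₂, h₂, H₂⟩ := H.exists_transfer_freq_sub
  obtain ⟨C, hC, hA, -⟩ := H.exists_transfer_bounds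
  refine ⟨|κ₄| * (C₁ + C * C * (2 * C * (C₂ * R))), by positivity,
    fun T hT m n p q p' q' hsum hpq => ?_⟩
  have hT0 : (0 : ℝ) < T := by exact_mod_cast hT
  have hq' : -(m + n + p') = q' := by omega
  rw [F4_eq_twisted, hq', ← mul_sub, norm_mul, Complex.norm_real, Real.norm_eq_abs, mul_div_assoc]
  refine mul_le_mul_of_nonneg_left ?_ (abs_nonneg _)
  rw [add_div]
  refine (norm_sub_le_norm_sub_add_norm_sub _ _ _).trans (add_le_add (H₁ T hT m n p q) ?_)
  rw [← mul_sub, twisted_sub, norm_mul, norm_inv, Complex.norm_natCast, inv_mul_eq_div, pow_two,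
    ← div_div]
  refine div_le_div_of_nonneg_right ?_ hT0.le
  refine norm_twisted_le hT _ fun u hu => ?_
  have key : ∀ x y x' y' : ℤ, |((x - x' : ℤ) : ℝ)| ≤ R → |((y - y' : ℤ) : ℝ)| ≤ R →
      ‖transfer ψ u (freq T x) * transfer ψ u (freq T y) -
        transfer ψ u (freq T x') * transfer ψ u (freq T y')‖ ≤ 2 * C * (C₂ * R / T) := by
    intro x y x' y' hx hy
    rw [show ∀ a b c d : ℂ, a * b - c * d = (a - c) * b + c * (b - d) by intros; ring]
    refine (norm_add_le _ _).trans ?_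
    rw [norm_mul, norm_mul]
    have t1 := mul_le_mul (H₂ T hT u hu R _ _ hx) (hA u hu (freq T y)) (norm_nonneg _)
      (by positivity)
    have t2 := mul_le_mul (hA u hu (freq T x')) (H₂ T hT u hu R _ _ hy) (norm_nonneg _)
      (by positivity)
    linarith
  have key2 : ‖transfer ψ u (freq T p) * transfer ψ u (freq T q) -
        transfer ψ u (freq T p') * transfer ψ u (freq T q')‖ ≤ 2 * C * (C₂ * R / T) := by
    rcases hpq with h | h
    · exact key _ _ _ _ h.1 h.2
    · rw [mul_comm (transfer ψ u (freq T p'))]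
      exact key _ _ _ _ h.1 h.2
  rw [← mul_sub, norm_mul, norm_mul, mul_div_assoc, mul_div_assoc (2 * C)]
  exact mul_le_mul (mul_le_mul (hA u hu _) (hA u hu _) (norm_nonneg _) (by positivity)) key2
    (norm_nonneg _) (by positivity)

variable [IsProbabilityMeasure μ]

/-- In a difference of products, one factor contributes the error $O(1/T)$ and the other its
`decay`; it is this surviving decay that makes the double sum only logarithmically larger than its
diagonal. -/
lemma exists_pair_approx : ∃ C : ℝ, 0 ≤ C ∧ ∀ T : ℕ, 1 ≤ T → ∀ m n p q : ℤ,
    ‖momTwo μ X T m p * momTwo μ X T n q + momTwo μ X T m q * momTwo μ X T n p -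
      pairTerm ψ T m n p q‖ ≤
      C / T * (decay T (m + p) + decay T (n + q) + decay T (m + q) + decay T (n + p)) := by
  obtain ⟨C₁, h₁, H₁⟩ := H.exists_momTwo_sub_F2
  obtain ⟨C₂, h₂, H₂⟩ := H.exists_momTwo_decay
  obtain ⟨C₃, h₃, H₃⟩ := H.exists_F2_decay
  refine ⟨C₁ * (C₂ + C₃), by positivity, fun T hT m n p q => ?_⟩
  have hT0 : (0 : ℝ) < T := by exact_mod_cast hT
  have key : ∀ m n p q : ℤ, ‖momTwo μ X T m p * momTwo μ X T n q -
      F2 ψ T (m + p) (freq T m) * F2 ψ T (n + q) (freq T n)‖ ≤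
      C₁ * (C₂ + C₃) / T * (decay T (m + p) + decay T (n + q)) := by
    intro m n p q
    have d1 := decay_nonneg hT (m + p)
    have d2 := decay_nonneg hT (n + q)
    rw [show ∀ a b c d : ℂ, a * b - c * d = (a - c) * b + c * (b - d) by intros; ring]
    refine (norm_add_le _ _).trans ?_
    rw [norm_mul, norm_mul]
    have t1 := mul_le_mul (H₁ T hT m p) (H₂ T hT n q) (norm_nonneg _) (by positivity)
    have t2 := mul_le_mul (H₃ T hT (m + p) (freq T m)) (H₁ T hT n q) (norm_nonneg _)
      (by positivity)
    have s1 : 0 ≤ C₁ / T * C₃ * decay T (n + q) := by positivity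
    have s2 : 0 ≤ C₁ / T * C₂ * decay T (m + p) := by positivity
    have e : C₁ * (C₂ + C₃) / T * (decay T (m + p) + decay T (n + q)) =
      C₁ / T * (C₂ * decay T (n + q)) + C₃ * decay T (m + p) * (C₁ / T) +
      C₁ / T * C₃ * decay T (n + q) + C₁ / T * C₂ * decay T (m + p) := by ring
    rw [e]; linarith
  rw [pairTerm, add_sub_add_comm]
  refine (norm_add_le _ _).trans ((add_le_add (key m n p q) (key m n q p)).trans (le_of_eq ?_))
  ring

lemma memLp_signedCov (T : ℕ) (s r : ℤ) : MemLp (signedCov X ψ T s r) 2 μ :=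
  (memLp_finsetSum _ fun _ _ => (H.memLp_dft_mul T _ _).const_mul _).const_mul _

lemma integral_signedCov (T : ℕ) (s r : ℤ) : ∫ w, signedCov X ψ T s r w ∂μ =
    (T : ℂ)⁻¹ * ∑ k ∈ Finset.Icc (1 : ℤ) T,
      (gWeight ψ T r k : ℂ) * momTwo μ X T (s * k) (-s * (k + r)) := by
  simp_rw [signedCov]
  rw [integral_const_mul, integral_finsetSum _ fun k _ =>
    (((H.memLp_dft_mul T _ _).integrable (by norm_num)).const_mul _)]
  simp_rw [integral_const_mul]
  rfl

lemma integral_signedCov_mul (T : ℕ) (s₁ s₂ r₁ r₂ : ℤ) :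
    ∫ w, signedCov X ψ T s₁ r₁ w * signedCov X ψ T s₂ r₂ w ∂μ =
    (T : ℂ)⁻¹ * (T : ℂ)⁻¹ * ∑ k₁ ∈ Finset.Icc (1 : ℤ) T, ∑ k₂ ∈ Finset.Icc (1 : ℤ) T,
      (gWeight ψ T r₁ k₁ : ℂ) * (gWeight ψ T r₂ k₂ : ℂ) *
      ∫ w, dft X T (freq T (s₁ * k₁)) w * dft X T (freq T (-s₁ * (k₁ + r₁))) w *
        (dft X T (freq T (s₂ * k₂)) w * dft X T (freq T (-s₂ * (k₂ + r₂))) w) ∂μ := by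
  have e : ∀ w, signedCov X ψ T s₁ r₁ w * signedCov X ψ T s₂ r₂ w =
      (T : ℂ)⁻¹ * (T : ℂ)⁻¹ * ∑ k₁ ∈ Finset.Icc (1 : ℤ) T, ∑ k₂ ∈ Finset.Icc (1 : ℤ) T,
      (gWeight ψ T r₁ k₁ : ℂ) * (gWeight ψ T r₂ k₂ : ℂ) *
      (dft X T (freq T (s₁ * k₁)) w * dft X T (freq T (-s₁ * (k₁ + r₁))) w *
        (dft X T (freq T (s₂ * k₂)) w * dft X T (freq T (-s₂ * (k₂ + r₂))) w)) := by
    intro w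
    rw [signedCov, signedCov, mul_mul_mul_comm, Finset.sum_mul_sum]
    congr 1
    exact Finset.sum_congr rfl fun k₁ _ => Finset.sum_congr rfl fun k₂ _ => by ring
  have hint : ∀ k₁ k₂ : ℤ, Integrable (fun w => (gWeight ψ T r₁ k₁ : ℂ) *
      (gWeight ψ T r₂ k₂ : ℂ) *
      (dft X T (freq T (s₁ * k₁)) w * dft X T (freq T (-s₁ * (k₁ + r₁))) w *
        (dft X T (freq T (s₂ * k₂)) w * dft X T (freq T (-s₂ * (k₂ + r₂))) w))) μ := fun k₁ k₂ =>
    ((H.memLp_dft_mul T _ _).integrable_mul (H.memLp_dft_mul T _ _)).const_mul _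
  simp_rw [e]
  rw [integral_const_mul, integral_finsetSum _ fun k₁ _ =>
    integrable_finsetSum _ fun k₂ _ => hint k₁ k₂]
  congr 1
  refine Finset.sum_congr rfl fun k₁ _ => ?_
  rw [integral_finsetSum _ fun k₂ _ => hint k₁ k₂]
  simp_rw [integral_const_mul]

/-- The bilinear covariance of signed covariances, scaled by `T`. -/
def _root_.LocStat.crossCov (μ : Measure Ω) (X : ℕ → ℕ → Ω → ℝ) (ψ : ℕ → ℝ → ℝ) (T : ℕ)
    (s₁ s₂ r₁ r₂ : ℤ) : ℂ :=
  T * (∫ w, signedCov X ψ T s₁ r₁ w * signedCov X ψ T s₂ r₂ w ∂μ -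
    (∫ w, signedCov X ψ T s₁ r₁ w ∂μ) * ∫ w, signedCov X ψ T s₂ r₂ w ∂μ)

/-- The pairing inside each of the two factors reproduces the product of the means and cancels. -/
lemma crossCov_eq {T : ℕ} (hT : 1 ≤ T) (s₁ s₂ r₁ r₂ : ℤ) : crossCov μ X ψ T s₁ s₂ r₁ r₂ =
    (T : ℂ)⁻¹ * ∑ k₁ ∈ Finset.Icc (1 : ℤ) T, ∑ k₂ ∈ Finset.Icc (1 : ℤ) T,
      (gWeight ψ T r₁ k₁ : ℂ) * (gWeight ψ T r₂ k₂ : ℂ) *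
      (momTwo μ X T (s₁ * k₁) (s₂ * k₂) * momTwo μ X T (-s₁ * (k₁ + r₁)) (-s₂ * (k₂ + r₂)) +
        momTwo μ X T (s₁ * k₁) (-s₂ * (k₂ + r₂)) * momTwo μ X T (-s₁ * (k₁ + r₁)) (s₂ * k₂) +
        (fourthCumulant μ (ε 0) : ℂ) *
          cumFour ψT T (s₁ * k₁) (-s₁ * (k₁ + r₁)) (s₂ * k₂) (-s₂ * (k₂ + r₂))) := by
  have hT0 : (T : ℂ) ≠ 0 := by exact_mod_cast (by omega : T ≠ 0)
  rw [crossCov, H.integral_signedCov_mul, H.integral_signedCov, H.integral_signedCov,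
    mul_mul_mul_comm, Finset.sum_mul_sum, ← mul_sub, ← mul_assoc, ← mul_assoc,
    mul_inv_cancel₀ hT0, one_mul, ← Finset.sum_sub_distrib]
  congr 1
  refine Finset.sum_congr rfl fun k₁ _ => ?_
  rw [← Finset.sum_sub_distrib]
  refine Finset.sum_congr rfl fun k₂ _ => ?_
  rw [H.integral_dft_four]
  ring

/-- For fixed $k_1$ the pairing errors sum over $k_2$ to $O(\log T/T)$ and the cumulant errors to
$O(1/T)$; the outer sum over $k_1$ is an average. -/
lemma exists_crossCov_approx (s₁ s₂ r₁ r₂ : ℤ) (hs₁ : s₁ = 1 ∨ s₁ = -1)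
    (hs₂ : s₂ = 1 ∨ s₂ = -1) : ∃ C : ℝ, 0 ≤ C ∧ ∀ T : ℕ, 3 ≤ T →
      ‖crossCov μ X ψ T s₁ s₂ r₁ r₂ -
        signedGamma (fourthCumulant μ (ε 0)) ψ T s₁ s₂ r₁ r₂‖ ≤ C * (Real.log T / T) := by
  obtain ⟨C₁, h₁, H₁, -⟩ := H.exists_weight_bounds
  obtain ⟨C₂, h₂, H₂⟩ := H.exists_pair_approx
  obtain ⟨C₃, h₃, H₃⟩ := H.exists_cumFour_sub_F4 (|(r₁ : ℝ)| + |(r₂ : ℝ)|) (by positivity)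
    (fourthCumulant μ (ε 0))
  -- Four sums of `decay`, each at most $4\log T$. For $T\ge3$ one has $\log T\ge1$, so $2(1+\log
  -- T)\le4\log T$, and the cumulant error is absorbed as well.
  refine ⟨C₁ * C₁ * (16 * C₂ + C₃), by positivity, fun T hT3 => ?_⟩
  have hT : 1 ≤ T := by omega
  have hT0 : (0 : ℝ) < T := by exact_mod_cast hT
  have hT0' : (T : ℂ) ≠ 0 := by exact_mod_cast hT0.ne'
  have hlog : 1 ≤ Real.log T := by
    rw [Real.le_log_iff_exp_le hT0]
    have : (3 : ℝ) ≤ T := by exact_mod_cast hT3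
    linarith [Real.exp_one_lt_d9]
  have e : signedGamma (fourthCumulant μ (ε 0)) ψ T s₁ s₂ r₁ r₂ =
      (T : ℂ)⁻¹ * ∑ k₁ ∈ Finset.Icc (1 : ℤ) T, ∑ k₂ ∈ Finset.Icc (1 : ℤ) T,
      (gWeight ψ T r₁ k₁ : ℂ) * (gWeight ψ T r₂ k₂ : ℂ) *
      (pairTerm ψ T (s₁ * k₁) (-s₁ * (k₁ + r₁)) (s₂ * k₂) (-s₂ * (k₂ + r₂)) +
        2 * (Real.pi : ℂ) / T * F4 (fourthCumulant μ (ε 0)) ψ T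
          (s₁ * k₁ + -s₁ * (k₁ + r₁) + s₂ * k₂ + -s₂ * (k₂ + r₂))
          (freq T (s₁ * k₁)) (freq T (-s₁ * (k₁ + r₁))) (freq T (-k₂))) := by
    rw [signedGamma, show 2 * (Real.pi : ℂ) / (T : ℂ) ^ 2 =
      (T : ℂ)⁻¹ * (2 * (Real.pi : ℂ) / T) by field_simp, mul_assoc (T : ℂ)⁻¹, ← mul_add]
    refine congrArg _ ?_
    rw [Finset.mul_sum, ← Finset.sum_add_distrib]
    refine Finset.sum_congr rfl fun k₁ _ => ?_
    rw [Finset.mul_sum, ← Finset.sum_add_distrib]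
    refine Finset.sum_congr rfl fun k₂ _ => ?_
    ring
  rw [H.crossCov_eq hT, e, ← mul_sub, ← Finset.sum_sub_distrib, norm_mul, norm_inv,
    Complex.norm_natCast, inv_mul_le_iff₀ hT0]
  refine (norm_sum_le _ _).trans ?_
  have hdec : ∀ c s : ℤ, s = 1 ∨ s = -1 → ∑ k ∈ Finset.Icc (1 : ℤ) T, decay T (c + s * k) ≤
      4 * Real.log T := by
    intro c s hs
    rw [← Finset.Ico_add_one_right_eq_Icc, add_comm (T : ℤ) 1]
    rcases hs with rfl | rfl
    · simp only [one_mul]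
      linarith [sum_decay_Ico hT 1 c]
    · have : ∀ k, decay T (c + -1 * k) = decay T (-c + k) := fun k => by
        rw [← decay_neg]; ring_nf
      simp_rw [this]
      linarith [sum_decay_Ico hT 1 (-c)]
  have hinner : ∀ k₁ ∈ Finset.Icc (1 : ℤ) T, ‖∑ k₂ ∈ Finset.Icc (1 : ℤ) T,
      (gWeight ψ T r₁ k₁ : ℂ) * (gWeight ψ T r₂ k₂ : ℂ) *
      (momTwo μ X T (s₁ * k₁) (s₂ * k₂) * momTwo μ X T (-s₁ * (k₁ + r₁)) (-s₂ * (k₂ + r₂)) +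
        momTwo μ X T (s₁ * k₁) (-s₂ * (k₂ + r₂)) * momTwo μ X T (-s₁ * (k₁ + r₁)) (s₂ * k₂) +
        (fourthCumulant μ (ε 0) : ℂ) *
          cumFour ψT T (s₁ * k₁) (-s₁ * (k₁ + r₁)) (s₂ * k₂) (-s₂ * (k₂ + r₂))) -
      ∑ k₂ ∈ Finset.Icc (1 : ℤ) T, (gWeight ψ T r₁ k₁ : ℂ) * (gWeight ψ T r₂ k₂ : ℂ) *
      (pairTerm ψ T (s₁ * k₁) (-s₁ * (k₁ + r₁)) (s₂ * k₂) (-s₂ * (k₂ + r₂)) +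
        2 * (Real.pi : ℂ) / T * F4 (fourthCumulant μ (ε 0)) ψ T
          (s₁ * k₁ + -s₁ * (k₁ + r₁) + s₂ * k₂ + -s₂ * (k₂ + r₂))
          (freq T (s₁ * k₁)) (freq T (-s₁ * (k₁ + r₁))) (freq T (-k₂)))‖ ≤
      C₁ * C₁ * (16 * C₂ + C₃) * (Real.log T / T) := by
    intro k₁ _
    rw [← Finset.sum_sub_distrib]
    refine (norm_sum_le _ _).trans ?_
    calc _ ≤ ∑ k₂ ∈ Finset.Icc (1 : ℤ) T, C₁ * C₁ * (C₂ / T *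
          (decay T (s₁ * k₁ + s₂ * k₂) +
            decay T (-s₁ * (k₁ + r₁) - s₂ * r₂ + -s₂ * k₂) +
            decay T (s₁ * k₁ - s₂ * r₂ + -s₂ * k₂) +
            decay T (-s₁ * (k₁ + r₁) + s₂ * k₂)) + C₃ / T ^ 2) :=
          Finset.sum_le_sum fun k₂ _ => by
            rw [← mul_sub, norm_mul, norm_mul, Complex.norm_real, Complex.norm_real, gWeight_eq,
              gWeight_eq, add_sub_add_comm]
            have t1 := H₂ T hT (s₁ * k₁) (-s₁ * (k₁ + r₁)) (s₂ * k₂) (-s₂ * (k₂ + r₂))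
            have hR1 : |(r₁ : ℝ)| ≤ |(r₁ : ℝ)| + |(r₂ : ℝ)| := by linarith [abs_nonneg (r₂ : ℝ)]
            have hR2 : |(r₂ : ℝ)| ≤ |(r₁ : ℝ)| + |(r₂ : ℝ)| := by linarith [abs_nonneg (r₁ : ℝ)]
            have hR3 : |(r₂ : ℝ) - s₁ * r₁| ≤ |(r₁ : ℝ)| + |(r₂ : ℝ)| := by
              refine (abs_sub _ _).trans ?_
              rcases hs₁ with rfl | rfl <;> simp [add_comm]
            have hR4 : |(s₁ : ℝ) * r₁| ≤ |(r₁ : ℝ)| + |(r₂ : ℝ)| := by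
              refine le_trans ?_ hR1
              rcases hs₁ with rfl | rfl <;> simp
            -- The third frequency of $F_4$ is $-k_2$ for either sign; the fourth, $k_2+s_1r_1$, is
            -- forced by the zero sum. For $s_2=1$ they match the true frequencies in exchanged
            -- order, for $s_2=-1$ in the given order.
            have t2 := H₃ T hT (s₁ * k₁) (-s₁ * (k₁ + r₁)) (s₂ * k₂) (-s₂ * (k₂ + r₂))
              (-k₂) (k₂ + s₁ * r₁) (by ring) (by
                rcases hs₂ with rfl | rfl
                · right
                  constructor
                  · rw [show (1 : ℤ) * k₂ - (k₂ + s₁ * r₁) = -(s₁ * r₁) by ring]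
                    push_cast
                    rwa [abs_neg]
                  · rw [show -(1 : ℤ) * (k₂ + r₂) - -k₂ = -r₂ by ring]
                    push_cast
                    rwa [abs_neg]
                · left
                  constructor
                  · rw [show (-1 : ℤ) * k₂ - -k₂ = 0 by ring]
                    push_cast
                    rw [abs_zero]; positivity
                  · rw [show -(-1 : ℤ) * (k₂ + r₂) - (k₂ + s₁ * r₁) = r₂ - s₁ * r₁ by ring]
                    push_cast
                    exact hR3)
            rw [show -s₁ * (k₁ + r₁) + -s₂ * (k₂ + r₂) =
              -s₁ * (k₁ + r₁) - s₂ * r₂ + -s₂ * k₂ by ring,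
              show s₁ * k₁ + -s₂ * (k₂ + r₂) = s₁ * k₁ - s₂ * r₂ + -s₂ * k₂ by ring] at t1
            exact mul_le_mul (mul_le_mul (H₁ _ _) (H₁ _ _) (norm_nonneg _) (by positivity))
              ((norm_add_le _ _).trans (add_le_add t1 t2)) (norm_nonneg _) (by positivity)
      _ = C₁ * C₁ * (C₂ / T * (∑ k₂ ∈ Finset.Icc (1 : ℤ) T, decay T (s₁ * k₁ + s₂ * k₂) +
          ∑ k₂ ∈ Finset.Icc (1 : ℤ) T, decay T (-s₁ * (k₁ + r₁) - s₂ * r₂ + -s₂ * k₂) +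
          ∑ k₂ ∈ Finset.Icc (1 : ℤ) T, decay T (s₁ * k₁ - s₂ * r₂ + -s₂ * k₂) +
          ∑ k₂ ∈ Finset.Icc (1 : ℤ) T, decay T (-s₁ * (k₁ + r₁) + s₂ * k₂)) + C₃ / T) := by
          rw [← Finset.mul_sum, Finset.sum_add_distrib, ← Finset.mul_sum, Finset.sum_add_distrib,
            Finset.sum_add_distrib, Finset.sum_add_distrib, Finset.sum_const, Int.card_Icc]
          congr 2
          rw [show ((T : ℤ) + 1 - 1).toNat = T by omega, nsmul_eq_mul]
          field_simp
      _ ≤ C₁ * C₁ * (C₂ / T * (4 * Real.log T + 4 * Real.log T + 4 * Real.log T +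
          4 * Real.log T) + C₃ / T * Real.log T) := by
          have hs₂' : -s₂ = 1 ∨ -s₂ = -1 := by omega
          have a1 := hdec (s₁ * k₁) s₂ hs₂
          have a2 := hdec (-s₁ * (k₁ + r₁) - s₂ * r₂) (-s₂) hs₂'
          have a3 := hdec (s₁ * k₁ - s₂ * r₂) (-s₂) hs₂'
          have a4 := hdec (-s₁ * (k₁ + r₁)) s₂ hs₂
          have a5 : C₃ / T ≤ C₃ / T * Real.log T :=
            le_mul_of_one_le_right (by positivity) hlog
          gcongr
      _ = _ := by ring
  refine (Finset.sum_le_sum hinner).trans (le_of_eq ?_)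
  rw [Finset.sum_const, Int.card_Icc, show ((T : ℤ) + 1 - 1).toNat = T by omega, nsmul_eq_mul]

omit H [IsProbabilityMeasure μ] in
lemma _root_.LocStat.crossCov_comm (T : ℕ) (s₁ s₂ r₁ r₂ : ℤ) :
    crossCov μ X ψ T s₁ s₂ r₁ r₂ = crossCov μ X ψ T s₂ s₁ r₂ r₁ := by
  simp only [crossCov, mul_comm]

omit H [IsProbabilityMeasure μ] in
-- Conjugation flips both signs and symmetry exchanges the lags. This is the source of
-- $\overline{\Gamma^{(2)}_{r_2,r_1}}$ in the main terms.
lemma _root_.LocStat.crossCov_neg_neg (T : ℕ) (r₁ r₂ : ℤ) :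
    crossCov μ X ψ T (-1) (-1) r₁ r₂ = (starRingEnd ℂ) (crossCov μ X ψ T 1 1 r₂ r₁) := by
  rw [crossCov_comm, crossCov, crossCov, map_mul, Complex.conj_natCast, map_sub, map_mul,
    ← integral_conj, ← integral_conj, ← integral_conj]
  simp_rw [map_mul, signedCov_one, signedCov_neg_one]

omit H [IsProbabilityMeasure μ] [MeasurableSpace Ω] in
lemma _root_.LocStat.ofReal_re_covTilde (T : ℕ) (r : ℤ) (w : Ω) :
    ((covTilde X ψ T r w).re : ℂ) =
      (1 / 2) * signedCov X ψ T 1 r w + (1 / 2) * signedCov X ψ T (-1) r w := by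
  rw [Complex.re_eq_add_conj, signedCov_one, signedCov_neg_one]; ring

omit H [IsProbabilityMeasure μ] [MeasurableSpace Ω] in
lemma _root_.LocStat.ofReal_im_covTilde (T : ℕ) (r : ℤ) (w : Ω) :
    ((covTilde X ψ T r w).im : ℂ) =
      (-Complex.I / 2) * signedCov X ψ T 1 r w + (Complex.I / 2) * signedCov X ψ T (-1) r w := by
  rw [Complex.im_eq_sub_conj, signedCov_one, signedCov_neg_one]
  field_simp
  rw [Complex.I_sq]; ring

/-- Bilinearity, with $\sqrt T\sqrt T=T$ supplying the scaling in `crossCov`. The coefficients are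
complex although $Y$ and $Z$ are real, so the computation is done after embedding in $\mathbb C$. -/
lemma covariance_linearCombination {T : ℕ} {r₁ r₂ : ℤ} {Y Z : Ω → ℝ} {a b c d : ℂ}
    (hY : MemLp Y 2 μ) (hZ : MemLp Z 2 μ)
    (hYe : ∀ w, (Y w : ℂ) = a * signedCov X ψ T 1 r₁ w + b * signedCov X ψ T (-1) r₁ w)
    (hZe : ∀ w, (Z w : ℂ) = c * signedCov X ψ T 1 r₂ w + d * signedCov X ψ T (-1) r₂ w) :
    ((covariance (fun w => Real.sqrt T * Y w) (fun w => Real.sqrt T * Z w) μ : ℝ) : ℂ) =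
      a * c * crossCov μ X ψ T 1 1 r₁ r₂ + a * d * crossCov μ X ψ T 1 (-1) r₁ r₂ +
      b * c * crossCov μ X ψ T (-1) 1 r₁ r₂ + b * d * crossCov μ X ψ T (-1) (-1) r₁ r₂ := by
  have hi : ∀ s r, Integrable (signedCov X ψ T s r) μ := fun s r =>
    (H.memLp_signedCov T s r).integrable (by norm_num)
  have hm : ∀ s r s' r', Integrable (fun w => signedCov X ψ T s r w * signedCov X ψ T s' r' w) μ :=
    fun s r s' r' => (H.memLp_signedCov T s r).integrable_mul (H.memLp_signedCov T s' r')
  have e1 : ((∫ w, Y w ∂μ : ℝ) : ℂ) = a * ∫ w, signedCov X ψ T 1 r₁ w ∂μ +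
      b * ∫ w, signedCov X ψ T (-1) r₁ w ∂μ := by
    rw [← integral_complex_ofReal]
    simp_rw [hYe]
    rw [integral_add ((hi _ _).const_mul _) ((hi _ _).const_mul _), integral_const_mul,
      integral_const_mul]
  have e2 : ((∫ w, Z w ∂μ : ℝ) : ℂ) = c * ∫ w, signedCov X ψ T 1 r₂ w ∂μ +
      d * ∫ w, signedCov X ψ T (-1) r₂ w ∂μ := by
    rw [← integral_complex_ofReal]
    simp_rw [hZe]
    rw [integral_add ((hi _ _).const_mul _) ((hi _ _).const_mul _), integral_const_mul,
      integral_const_mul]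
  have e3 : ((∫ w, Y w * Z w ∂μ : ℝ) : ℂ) =
      a * c * (∫ w, signedCov X ψ T 1 r₁ w * signedCov X ψ T 1 r₂ w ∂μ) +
      a * d * (∫ w, signedCov X ψ T 1 r₁ w * signedCov X ψ T (-1) r₂ w ∂μ) +
      (b * c * (∫ w, signedCov X ψ T (-1) r₁ w * signedCov X ψ T 1 r₂ w ∂μ) +
      b * d * (∫ w, signedCov X ψ T (-1) r₁ w * signedCov X ψ T (-1) r₂ w ∂μ)) := by
    rw [← integral_complex_ofReal]
    have hYZ : ∀ w, ((Y w * Z w : ℝ) : ℂ) =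
        (a * c * (signedCov X ψ T 1 r₁ w * signedCov X ψ T 1 r₂ w) +
          a * d * (signedCov X ψ T 1 r₁ w * signedCov X ψ T (-1) r₂ w)) +
        (b * c * (signedCov X ψ T (-1) r₁ w * signedCov X ψ T 1 r₂ w) +
          b * d * (signedCov X ψ T (-1) r₁ w * signedCov X ψ T (-1) r₂ w)) := fun w => by
      rw [Complex.ofReal_mul, hYe, hZe]; ring
    have i1 := (hm 1 r₁ 1 r₂).const_mul (a * c)
    have i2 := (hm 1 r₁ (-1) r₂).const_mul (a * d)
    have i3 := (hm (-1) r₁ 1 r₂).const_mul (b * c)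
    have i4 := (hm (-1) r₁ (-1) r₂).const_mul (b * d)
    have i12 := i1.add i2
    have i34 := i3.add i4
    simp_rw [hYZ]
    refine (integral_add i12 i34).trans ?_
    refine congrArg₂ (· + ·) ((integral_add i1 i2).trans ?_) ((integral_add i3 i4).trans ?_) <;>
      rw [integral_const_mul, integral_const_mul]
  rw [covariance_const_mul_left, covariance_const_mul_right, covariance_eq_sub hY hZ,
    ← mul_assoc, Real.mul_self_sqrt (Nat.cast_nonneg T)]
  simp only [Pi.mul_apply]
  push_cast
  rw [e1, e2, e3]
  simp only [crossCov]
  ring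

end LocallyStationary

end Covariance

end LocStat

end

/-! ### The lemma: assembling the three claims -/

theorem mainTheorem7 {Ω : Type*} [MeasurableSpace Ω] (μ : Measure Ω) [IsProbabilityMeasure μ]
    (ε : ℤ → Ω → ℝ) (X : ℕ → ℕ → Ω → ℝ) (ψT : ℕ → ℕ → ℕ → ℝ) (ψ : ℕ → ℝ → ℝ) (ℓ : ℕ → ℝ)
    (hX : LocStat.LocallyStationary μ ε X ψT ψ ℓ)
    (K : ℝ → ℝ) (hK : LocStat.IsKernel K)
    (b : ℕ → ℝ) (hb : Tendsto b atTop (𝓝 0))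
    (hbT : Tendsto (fun T : ℕ => b T * (T : ℝ)) atTop atTop) :
    (∃ C : ℝ, ∀ᶠ T : ℕ in atTop, ∀ ω : ℝ,
      MemLp (LocStat.specEst X K (b T) T ω) 2 μ ∧
      ∫ w, (LocStat.specEst X K (b T) T ω w - LocStat.intSpec ψ ω) ^ 2 ∂μ ≤
        C * (b T ^ 2 + 1 / (b T * (T : ℝ)))) ∧
    (∀ (T : ℕ) (r : ℤ), MemLp (LocStat.covTilde X ψ T r) 2 μ) ∧
    (∀ r : ℤ, Tendsto
      (fun T : ℕ => (∫ w, LocStat.covTilde X ψ T r w ∂μ) - LocStat.meanLimit ψ T r)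
      atTop (𝓝 0)) ∧
    (∀ r₁ r₂ : ℤ,
      ((fun T : ℕ =>
          ((covariance (LocStat.scaledRe X ψ T r₁) (LocStat.scaledRe X ψ T r₂) μ : ℝ) : ℂ) -
            LocStat.Sigma11 (LocStat.fourthCumulant μ (ε 0)) ψ T r₁ r₂)
        =O[atTop] fun T : ℕ => Real.log (T : ℝ) / (T : ℝ)) ∧
      ((fun T : ℕ =>
          ((covariance (LocStat.scaledRe X ψ T r₁) (LocStat.scaledIm X ψ T r₂) μ : ℝ) : ℂ) -
            LocStat.Sigma12 (LocStat.fourthCumulant μ (ε 0)) ψ T r₁ r₂)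
        =O[atTop] fun T : ℕ => Real.log (T : ℝ) / (T : ℝ)) ∧
      ((fun T : ℕ =>
          ((covariance (LocStat.scaledIm X ψ T r₁) (LocStat.scaledIm X ψ T r₂) μ : ℝ) : ℂ) -
            LocStat.Sigma22 (LocStat.fourthCumulant μ (ε 0)) ψ T r₁ r₂)
        =O[atTop] fun T : ℕ => Real.log (T : ℝ) / (T : ℝ))) := by
  refine ⟨hX.specEst_meanSquare hK hb hbT, hX.memLp_covTilde, hX.tendsto_integral_covTilde,
    fun r₁ r₂ => ?_⟩
  have big : ∀ s₁ s₂ r₁ r₂ : ℤ, (s₁ = 1 ∨ s₁ = -1) → (s₂ = 1 ∨ s₂ = -1) →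
      (fun T : ℕ => LocStat.crossCov μ X ψ T s₁ s₂ r₁ r₂ -
        LocStat.signedGamma (LocStat.fourthCumulant μ (ε 0)) ψ T s₁ s₂ r₁ r₂)
        =O[atTop] fun T : ℕ => Real.log (T : ℝ) / (T : ℝ) := by
    intro s₁ s₂ r₁ r₂ h1 h2
    obtain ⟨C, -, hC⟩ := hX.exists_crossCov_approx s₁ s₂ r₁ r₂ h1 h2
    refine IsBigO.of_bound C ?_
    filter_upwards [eventually_ge_atTop 3] with T hT
    have hnn : 0 ≤ Real.log (T : ℝ) / (T : ℝ) :=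
      div_nonneg (Real.log_nonneg (by exact_mod_cast (by omega : 1 ≤ T))) (Nat.cast_nonneg T)
    rw [Real.norm_of_nonneg hnn]
    exact hC T hT
  have g1 := big 1 (-1) r₁ r₂ (by simp) (by simp)
  have g2 := big 1 1 r₁ r₂ (by simp) (by simp)
  have g3 := big (-1) 1 r₁ r₂ (by simp) (by simp)
  have g4 : (fun T : ℕ => LocStat.crossCov μ X ψ T (-1) (-1) r₁ r₂ - (starRingEnd ℂ)
      (LocStat.signedGamma (LocStat.fourthCumulant μ (ε 0)) ψ T 1 1 r₂ r₁))
        =O[atTop] fun T : ℕ => Real.log (T : ℝ) / (T : ℝ) := by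
    refine (IsBigO.of_norm_left ?_)
    refine (big 1 1 r₂ r₁ (by simp) (by simp)).norm_left.congr_left fun T => ?_
    rw [LocStat.crossCov_neg_neg, ← map_sub, RCLike.norm_conj]
  have hre : ∀ T r, MemLp (fun w => (LocStat.covTilde X ψ T r w).re) 2 μ := fun T r =>
    (hX.memLp_covTilde T r).re
  have him : ∀ T r, MemLp (fun w => (LocStat.covTilde X ψ T r w).im) 2 μ := fun T r =>
    (hX.memLp_covTilde T r).im
  have hI : Complex.I * Complex.I = -1 := Complex.I_mul_I
  refine ⟨?_, ?_, ?_⟩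
  -- The weights are the products of the coefficients in $\Re c=\frac12(c+\bar c)$ and $\Im c=-\frac
  -- i2(c-\bar c)$; here all four equal $\frac14$.
  · refine ((((g2.const_mul_left (1 / 4)).add (g1.const_mul_left (1 / 4))).add
      (g3.const_mul_left (1 / 4))).add (g4.const_mul_left (1 / 4))).congr_left fun T => ?_
    have h : ((covariance (LocStat.scaledRe X ψ T r₁) (LocStat.scaledRe X ψ T r₂) μ : ℝ) : ℂ) = _ :=
      hX.covariance_linearCombination (hre T r₁) (hre T r₂)
        (LocStat.ofReal_re_covTilde T r₁) (LocStat.ofReal_re_covTilde T r₂)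
    simp only [LocStat.Sigma11, LocStat.Gamma1_eq, LocStat.Gamma2_eq,
      LocStat.Gamma3_eq]
    linear_combination -h
  · refine ((((g2.const_mul_left (-Complex.I / 4)).add (g1.const_mul_left (Complex.I / 4))).add
      (g3.const_mul_left (-Complex.I / 4))).add
      (g4.const_mul_left (Complex.I / 4))).congr_left fun T => ?_
    have h : ((covariance (LocStat.scaledRe X ψ T r₁) (LocStat.scaledIm X ψ T r₂) μ : ℝ) : ℂ) = _ :=
      hX.covariance_linearCombination (hre T r₁) (him T r₂)
        (LocStat.ofReal_re_covTilde T r₁) (LocStat.ofReal_im_covTilde T r₂)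
    simp only [LocStat.Sigma12, LocStat.Gamma1_eq,
      LocStat.Gamma2_eq, LocStat.Gamma3_eq]
    linear_combination -h
  · refine ((((g2.const_mul_left (-1 / 4)).add (g1.const_mul_left (1 / 4))).add
      (g3.const_mul_left (1 / 4))).add (g4.const_mul_left (-1 / 4))).congr_left fun T => ?_
    have h : ((covariance (LocStat.scaledIm X ψ T r₁) (LocStat.scaledIm X ψ T r₂) μ : ℝ) : ℂ) = _ :=
      hX.covariance_linearCombination (him T r₁) (him T r₂)
        (LocStat.ofReal_im_covTilde T r₁) (LocStat.ofReal_im_covTilde T r₂)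
    simp only [LocStat.Sigma22, LocStat.Gamma1_eq, LocStat.Gamma2_eq,
      LocStat.Gamma3_eq]
    -- For two imaginary parts the coefficient products contain $i^2$, which the multiple of `hI`
    -- replaces by $-1$.
    linear_combination -h - (LocStat.crossCov μ X ψ T 1 1 r₁ r₂ -
      LocStat.crossCov μ X ψ T 1 (-1) r₁ r₂ - LocStat.crossCov μ X ψ T (-1) 1 r₁ r₂ +
      LocStat.crossCov μ X ψ T (-1) (-1) r₁ r₂) / 4 * hI
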